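/- **Yoke graphs.** For integers $n\ge 1$, $m\ge 0$, the vertices of $Y_{n,m}$ are the vectors $v=(v_0,\dots,v_{m+1})\in\mathbb{Z}_n\times\{0,1\}^m\times\mathbb{Z}_n$ with $\sum_{i=0}^{m+1}v_i\equiv 0 \pmod n$. Distinct vertices $u,v$ are adjacent if for some $0\le i\le m$ they differ by *shifting a unit between the entries $i$ and $i+1$*: $u_j=v_j$ for $j\notin\{i,i+1\}$, and either $u_i=v_i+1$, $u_{i+1}=v_{i+1}-1$, or $u_i=v_i-1$, $u_{i+1}=v_{i+1}+1$ (modulo $n$ in the entries $0$ and $m+1$, in $\mathbb{Z}$ elsewhere). A vertex is determined by its first $m+1$ entries. **Theorem.** 1. Let $n\ge 5$ and label the vertices of a convex $n$-gon cyclically by $\mathbb{Z}_n$. A triangulation is triangle-free if none of its triangles has three chords (diagonals) as sides. A colored triangle-free triangulation is a triangle-free triangulation whose $n-3$ chords are labeled by $0,\dots,n-4$, each label once, so that chords with consecutive labels are sides of a common triangle; the chords labeled $0$ and $n-4$ are then the two short chords, those of the form $(a-1,a+1)$. A flip of the chord labeled $i$ replaces it by the other diagonal of the quadrilateral formed by its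 two adjacent triangles; the new chord gets the label $i$, and all other labels are kept. Let $\Gamma_n$ be the graph on the colored triangle-free triangulations whose edges are the flips. Then there is a graph isomorphism $g:\Gamma_n\to Y_{n,n-4}$ given as follows. If the chord of $T$ labeled $0$ is $(a-1,a+1)$, then $g(T)_0=a$. For $1\le i\le n-4$, if the chord labeled $i-1$ is $(k,t)$ (where the chord labeled $0$ is written $(a-1,a+1)$), then the chord labeled $i$ is either $(k-1,t)$ or $(k,t+1)$, and $g(T)_i$ is $0$ in the former case and $1$ in the latter; write the chord labeled $i$ in this form for the next step. Moreover, $T'$ is obtained from $T$ by a flip of the chord labeled $i$ if and only if $g(T)$ and $g(T')$ differ by shifting a unit between the entries $i$ and $i+1$. 2. Let $n\ge 2$. An arc permutation is a permutation $\pi$ of $\{1,\dots,n\}$ such that, for every prefix and every suffix of $\pi(1)\pi(2)\cdots\pi(n)$, its set of letters is an interval in $\mathbb{Z}_n$ (with $n$ representing $0$). Let $X_n$ be the graph on the arc permutations in which $\pi$ and $\sigma$ are adjacent if $\pi=\sigma\circ(i,i+1)$ for some $1\le i\le n-1$. Then there is a graph isomorphism $f:X_n\to Y_{n,n-2}$ given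 by $f(\pi)_0=\pi(1)-1$ and, for $1\le i\le n-2$, with $I_i=\{\pi(1),\dots,\pi(i)\}\subseteq\mathbb{Z}_n$: $f(\pi)_i=1$ if $\pi(i+1)-1\in I_i$, and $f(\pi)_i=0$ if $\pi(i+1)+1\in I_i$ (exactly one of the two holds). Moreover, for $1\le i\le n-1$, $\pi=\sigma\circ(i,i+1)$ if and only if $f(\pi)$ and $f(\sigma)$ differ by shifting a unit between the entries $i-1$ and $i$. 3. Let $n\ge 3$ and label the vertices of a convex $n$-gon cyclically by $\mathbb{Z}_n$. A geometric caterpillar of order $n$ is a non-crossing spanning tree, with straight edges, on these vertices whose non-leaves form an interval in $\mathbb{Z}_n$. Its spine is its longest simple path whose edges are sides of the polygon. Let $\mathcal{G}_n$ be the graph on the geometric caterpillars of order $n$ in which two distinct caterpillars are adjacent if one is obtained from the other by replacing an edge $\{x,w\}$ by an edge $\{x,w'\}$, where $\{w,w'\}$ is an edge of the spine. Then there is a graph isomorphism $h:\mathcal{G}_n\to Y_{n,n-3}$ given as follows. Let the spine of $C$ run through $a,a+1,\dots,a+k$. Put $h(C)_0=a$ and $[l_0,r_0]=[a,a+1]$.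 For $1\le i\le n-3$, if $(l_{i-1}-1,r_{i-1})$ is an edge of $C$, put $[l_i,r_i]=[l_{i-1}-1,r_{i-1}]$ and $h(C)_i=0$; otherwise put $[l_i,r_i]=[l_{i-1},r_{i-1}+1]$ and $h(C)_i=1$. In particular $\Gamma_n\cong Y_{n,n-4}$ for $n\ge5$, $X_n\cong Y_{n,n-2}$ for $n\ge2$, and $\mathcal{G}_n\cong Y_{n,n-3}$ for $n\ge3$. -/

import Mathlib

namespace YokeFlip

/-! ### Yoke graphs -/

/-- The positions `0` and `m + 1` of a vector `(v_0, …, v_{m+1})`, whose entries lie in `ℤ/n`. -/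
def IsBucket {m : ℕ} (i : Fin (m + 2)) : Prop := i = 0 ∨ i = Fin.last (m + 1)

/-- The vertices of `Y_{n,m}`: vectors in `ℤ/n × {0,1}^m × ℤ/n` whose entries sum to `0` modulo `n`.
The two entries in `ℤ/n` are given by their representatives in `{0, …, n-1}`. -/
def YokeVertex (n m : ℕ) : Type :=
  {v : Fin (m + 2) → ℕ //
    (∀ i, IsBucket i → v i < n) ∧ (∀ i, ¬ IsBucket i → v i < 2) ∧ n ∣ ∑ i, v i}

/-- `y = x + 1` for entries at position `i`: modulo `n` in a bucket, in `ℤ` elsewhere. -/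
def EntrySucc (n : ℕ) {m : ℕ} (i : Fin (m + 2)) (x y : ℕ) : Prop :=
  (IsBucket i ∧ (y : ZMod n) = (x : ZMod n) + 1) ∨ (¬ IsBucket i ∧ y = x + 1)

/-- `u` and `v` differ by shifting a unit between the entries `i` and `i + 1`. -/
def YokeShift {n m : ℕ} (i : Fin (m + 1)) (u v : YokeVertex n m) : Prop :=
  (∀ j, j ≠ i.castSucc → j ≠ i.succ → u.1 j = v.1 j) ∧
    ((EntrySucc n i.castSucc (v.1 i.castSucc) (u.1 i.castSucc) ∧
        EntrySucc n i.succ (u.1 i.succ) (v.1 i.succ)) ∨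
      (EntrySucc n i.castSucc (u.1 i.castSucc) (v.1 i.castSucc) ∧
        EntrySucc n i.succ (v.1 i.succ) (u.1 i.succ)))

/-- The Yoke graph `Y_{n,m}`. -/
def yokeGraph (n m : ℕ) : SimpleGraph (YokeVertex n m) :=
  SimpleGraph.fromRel fun u v => ∃ i, YokeShift i u v

/-! ### The convex polygon with vertices labeled by `ℤ/n` in cyclic order -/

/-- A side (boundary edge) of the polygon. -/
def IsSide {n : ℕ} (e : Sym2 (ZMod n)) : Prop := ∃ a : ZMod n, e = s(a, a + 1)

/-- A diagonal of the polygon. -/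
def IsDiagonal {n : ℕ} (e : Sym2 (ZMod n)) : Prop := ¬ e.IsDiag ∧ ¬ IsSide e

/-- Two segments between vertices of the polygon cross (in an interior point): their endpoints
are four distinct vertices that alternate in the cyclic order. -/
def Crosses {n : ℕ} (e f : Sym2 (ZMod n)) : Prop :=
  ∃ a b c d : ZMod n, e = s(a, b) ∧ f = s(c, d) ∧ sbtw a c b ∧ sbtw b d a

def IsNoncrossing {n : ℕ} (S : Set (Sym2 (ZMod n))) : Prop :=
  ∀ e ∈ S, ∀ f ∈ S, ¬ Crosses e f

/-- An interval `{a, a+1, …, a+k-1}` in `ℤ/n`. -/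
def IsCyclicInterval {n : ℕ} (S : Set (ZMod n)) : Prop :=
  ∃ (a : ZMod n) (k : ℕ), S = {x | ∃ j < k, x = a + (j : ZMod n)}

/-! ### Colored triangle-free triangulations -/

/-- A triangulation of the polygon, given by its set of chords: a maximal set of pairwise
non-crossing diagonals. -/
def IsTriangulation {n : ℕ} (T : Set (Sym2 (ZMod n))) : Prop :=
  Maximal (fun S : Set (Sym2 (ZMod n)) => (∀ e ∈ S, IsDiagonal e) ∧ IsNoncrossing S) T

/-- `a, b, c` are the vertices of a triangle of the triangulation with set of chords `T`. -/
def IsTriangleOf {n : ℕ} (T : Set (Sym2 (ZMod n))) (a b c : ZMod n) : Prop :=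
  (s(a, b) ∈ T ∨ IsSide s(a, b)) ∧ (s(b, c) ∈ T ∨ IsSide s(b, c)) ∧
    (s(a, c) ∈ T ∨ IsSide s(a, c))

/-- No triangle has three chords as its sides. -/
def IsTriangleFree {n : ℕ} (T : Set (Sym2 (ZMod n))) : Prop :=
  ¬ ∃ a b c : ZMod n, s(a, b) ∈ T ∧ s(b, c) ∈ T ∧ s(a, c) ∈ T

/-- A short chord: it forms a triangle with two sides of the polygon. -/
def IsShort {n : ℕ} (e : Sym2 (ZMod n)) : Prop := ∃ a : ZMod n, e = s(a - 1, a + 1)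

/-- `CTFT(n)`: a triangle-free triangulation of the `n`-gon with its chords labeled by
`0, …, n-4` along one of its two linear orders: the chord labeled `i` is `chord i`, the first and
the last chord are short, and consecutive chords are sides of a common triangle. -/
structure CTFT (n : ℕ) where
  chord : Fin (n - 3) → Sym2 (ZMod n)
  injective : Function.Injective chord
  triangulation : IsTriangulation (Set.range chord)
  triangleFree : IsTriangleFree (Set.range chord)
  short_first : ∀ i : Fin (n - 3), i.val = 0 → IsShort (chord i)
  short_last : ∀ i : Fin (n - 3), i.val + 1 = n - 3 → IsShort (chord i)
  consecutive : ∀ i j : Fin (n - 3), i.val + 1 = j.val →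
    ∃ a b c : ZMod n, IsTriangleOf (Set.range chord) a b c ∧ chord i = s(a, b) ∧ chord j = s(b, c)

/-- `e` and `e'` are the two diagonals of a quadrilateral that is the union of two triangles of
the triangulation `T` with the common side `e`. -/
def IsOtherDiagonal {n : ℕ} (T : Set (Sym2 (ZMod n))) (e e' : Sym2 (ZMod n)) : Prop :=
  ∃ a b c d : ZMod n, e = s(a, c) ∧ e' = s(b, d) ∧ b ≠ d ∧
    IsTriangleOf T a b c ∧ IsTriangleOf T a d c

/-- `D` is obtained from `C` by flipping the chord labeled `i` (the new chord inherits the label,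
all other chords keep theirs). -/
def CTFTFlip {n : ℕ} (i : Fin (n - 3)) (C D : CTFT n) : Prop :=
  (∀ j, j ≠ i → C.chord j = D.chord j) ∧
    IsOtherDiagonal (Set.range C.chord) (C.chord i) (D.chord i)

/-- The flip graph `Γ_n`. -/
def ctftGraph (n : ℕ) : SimpleGraph (CTFT n) :=
  SimpleGraph.fromRel fun C D => ∃ i, CTFTFlip i C D

/-- The relation `v = g(C)`. The chord labeled `i` is `(k i, t i)`; the chord labeled `0` is
`(a-1, a+1)` with `a = v_0`; and for `1 ≤ i ≤ n - 4` the chord labeled `i` is `(k-1, t)` if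
`v_i = 0` and `(k, t+1)` if `v_i = 1`, where `(k, t)` is the chord labeled `i - 1`. -/
def CTFTCode {n : ℕ} (C : CTFT n) (v : YokeVertex n (n - 4)) : Prop :=
  ∃ k t : ℕ → ZMod n, (∀ i : Fin (n - 3), C.chord i = s(k i, t i)) ∧
    k 0 = (v.1 0 : ZMod n) - 1 ∧ t 0 = (v.1 0 : ZMod n) + 1 ∧
    ∀ i : Fin (n - 4 + 2), 1 ≤ i.val → i.val ≤ n - 4 →
      (v.1 i = 0 ∧ k i = k (i.val - 1) - 1 ∧ t i = t (i.val - 1)) ∨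
      (v.1 i = 1 ∧ k i = k (i.val - 1) ∧ t i = t (i.val - 1) + 1)

/-! ### Arc permutations -/

/-- The class in `ℤ/n` of the letter of `{1, …, n}` that corresponds to `x : Fin n`; the element
`x` of `Fin n` stands for the letter `x + 1`. -/
def letter {n : ℕ} (x : Fin n) : ZMod n := (x.val : ZMod n) + 1

/-- The set of the first `k` letters of a permutation, as classes in `ℤ/n`. -/
def prefixSet {n : ℕ} (π : Equiv.Perm (Fin n)) (k : ℕ) : Set (ZMod n) :=
  {x | ∃ i : Fin n, i.val < k ∧ x = letter (π i)}

/-- The set of all letters after the first `k`, as classes in `ℤ/n`. -/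
def suffixSet {n : ℕ} (π : Equiv.Perm (Fin n)) (k : ℕ) : Set (ZMod n) :=
  {x | ∃ i : Fin n, k ≤ i.val ∧ x = letter (π i)}

/-- Arc permutations: every prefix and every suffix forms an interval in `ℤ/n`. -/
def ArcPerm (n : ℕ) : Type :=
  {π : Equiv.Perm (Fin n) // ∀ k ≤ n,
    IsCyclicInterval (prefixSet π k) ∧ IsCyclicInterval (suffixSet π k)}

/-- `π = σ ∘ (i+1, i+2)`, a product with a simple reflection (`i` counts positions from `0`). -/
def ArcSwap {n : ℕ} (i : ℕ) (hi : i + 1 < n) (π σ : ArcPerm n) : Prop :=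
  π.1 = σ.1 * Equiv.swap ⟨i, Nat.lt_of_succ_lt hi⟩ ⟨i + 1, hi⟩

/-- The flip graph `X_n`. -/
def arcGraph (n : ℕ) : SimpleGraph (ArcPerm n) :=
  SimpleGraph.fromRel fun π σ => ∃ (i : ℕ) (hi : i + 1 < n), ArcSwap i hi π σ

/-- The relation `v = f(π)`: `v_0 = π(1) - 1`, and for `1 ≤ i ≤ n - 2`, with
`I_i = {π(1), …, π(i)}`, the entry `v_i` is `1` if `π(i+1) - 1 ∈ I_i`, and `0` if
`π(i+1) + 1 ∈ I_i`, in `ℤ/n`. -/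
def ArcCode {n : ℕ} (π : ArcPerm n) (v : YokeVertex n (n - 2)) : Prop :=
  (∀ p : Fin n, p.val = 0 → v.1 0 = (π.1 p).val) ∧
    ∀ (i : Fin (n - 2 + 2)) (p : Fin n), 1 ≤ i.val → i.val ≤ n - 2 → p.val = i.val →
      (letter (π.1 p) - 1 ∈ prefixSet π.1 i ∧ v.1 i = 1) ∨
      (letter (π.1 p) + 1 ∈ prefixSet π.1 i ∧ v.1 i = 0)

/-! ### Geometric caterpillars -/

def IsLeaf {V : Type*} (G : SimpleGraph V) (v : V) : Prop := ∃! w, G.Adj v w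

/-- Geometric caterpillars of order `n`: non-crossing spanning trees of the complete graph on the
vertices of a convex polygon whose non-leaves form an interval in `ℤ/n`. -/
def Caterpillar (n : ℕ) : Type :=
  {C : SimpleGraph (ZMod n) // C.IsTree ∧ IsNoncrossing C.edgeSet ∧
    IsCyclicInterval {v | ¬ IsLeaf C v}}

/-- A spine: a longest path whose edges are on the boundary of the polygon. -/
def IsSpine {n : ℕ} {C : SimpleGraph (ZMod n)} {u v : ZMod n} (p : C.Walk u v) : Prop :=
  (p.IsPath ∧ ∀ e ∈ p.edges, IsSide e) ∧
    ∀ (u' v' : ZMod n) (q : C.Walk u' v'), q.IsPath → (∀ e ∈ q.edges, IsSide e) →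
      q.length ≤ p.length

/-- `D` is obtained from `C` by shifting the endpoint `w` of an edge `{x, w}` along an edge
`{w, w'}` of the spine, to `w'`. -/
def CaterpillarShift {n : ℕ} (C D : Caterpillar n) : Prop :=
  ∃ (u v : ZMod n) (p : C.1.Walk u v), IsSpine p ∧
    ∃ x w w' : ZMod n, C.1.Adj x w ∧ s(w, w') ∈ p.edges ∧
      D.1.edgeSet = (C.1.edgeSet \ {s(x, w)}) ∪ {s(x, w')}

/-- The flip graph `𝒢_n`. -/
def caterpillarGraph (n : ℕ) : SimpleGraph (Caterpillar n) :=
  SimpleGraph.fromRel fun C D => CaterpillarShift C D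

/-- The relation `v = h(C)`. The spine runs through `a, a+1, …`, and `v_0 = a`. Intervals
`[l i, r i]` are built from `[a, a+1]`: for `1 ≤ i ≤ n - 3`, if `(l-1, r)` is an edge of `C`, the
interval `[l, r]` is extended to `[l-1, r]` and `v_i = 0`, otherwise it is extended to `[l, r+1]`
and `v_i = 1`. -/
def CaterpillarCode {n : ℕ} (C : Caterpillar n) (v : YokeVertex n (n - 3)) : Prop :=
  ∃ (a b : ZMod n) (p : C.1.Walk a b), IsSpine p ∧
    (∀ j ≤ p.length, p.getVert j = a + (j : ZMod n)) ∧
    (v.1 0 : ZMod n) = a ∧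
    ∃ l r : ℕ → ZMod n, l 0 = a ∧ r 0 = a + 1 ∧
      ∀ i : Fin (n - 3 + 2), 1 ≤ i.val → i.val ≤ n - 3 →
        (C.1.Adj (l (i.val - 1) - 1) (r (i.val - 1)) ∧
          l i = l (i.val - 1) - 1 ∧ r i = r (i.val - 1) ∧ v.1 i = 0) ∨
        (¬ C.1.Adj (l (i.val - 1) - 1) (r (i.val - 1)) ∧
          l i = l (i.val - 1) ∧ r i = r (i.val - 1) + 1 ∧ v.1 i = 1)

end YokeFlip

open YokeFlip

namespace YokeFlip

/-! ### Relations that are bijections -/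

/-! A vertex of `Y_{n,m}` is the same as the sequence of its partial sums of index `0, …, m` in
`ℤ/n`: the first is arbitrary, each further step is `0` or `1`, and the last entry is forced by the
total sum. Shifting a unit between the entries `i` and `i + 1` changes the `i`-th partial sum by one
and no other (`yokeShift_iff`). Conversely, if a single partial sum changes, its fixed neighbor in
the sequence forces the change to be `±1`; when `m = 0` there is no such neighbor, but then only `n
≤ 3` occurs (`YokeTight`).

A sequence `r` with steps `0` and `1` describes arcs `{r i - i, …, r i}` that grow by one vertex at
a time, downwards for a step `0` and upwards for a step `1`. Each family of objects is another form
of such growing arcs, and each move changes one arc.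

For an arc permutation the arcs are the prefixes. An adjacent transposition changes exactly one
prefix (`arcSwap_iff`).

For a colored triangulation the chord labeled `i` cuts off the arc of index `i`. Chords of nested
arcs do not cross, and an induction along the arcs shows maximality
(`exists_arcChord_eq_of_not_crosses`). Conversely, triangle-freeness makes each chord differ from
the previous one by moving one endpoint along a side, necessarily outwards (`CTFT.chord_succ`). A
flip exchanges the diagonals of a quadrilateral bounded by the neighboring chords or sides.

For a caterpillar, each new vertex of the growing arc is joined to the upper end of the previous
arc. This gives a non-crossing tree, and every caterpillar arises by greedily growing downwards
whenever the required edge exists (`SpineCoordinates.greedySeq_spec`). The degree of a vertex is one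
plus the number of times `r` takes it as a value in the range `1, …, n - 2`
(`ncard_neighborSet_arcTree`). Since a monotone sequence is determined by its multiset of values,
degrees recover the sequence; a shift along the spine moves one unit of degree to an adjacent
vertex, hence changes one term (`exists_index_of_spineCount_shift`).

Each correspondence is first set up as a relation that is total and unique on both sides, so that
the isomorphism comes with its description. -/

lemma exists_equiv_of_rel {A B : Type*} (R : A → B → Prop) (hA : ∀ a, ∃ b, R a b)
    (hB : ∀ b, ∃ a, R a b) (injA : ∀ a a' b, R a b → R a' b → a = a')
    (injB : ∀ a b b', R a b → R a b' → b = b') : ∃ e : A ≃ B, ∀ a, R a (e a) := by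
  choose f hf using hA
  refine ⟨Equiv.ofBijective f ⟨fun a a' h => injA a a' _ (hf a) (h ▸ hf a'), fun b => ?_⟩, hf⟩
  obtain ⟨a, ha⟩ := hB b
  exact ⟨a, injB a _ _ (hf a) ha⟩

/-! ### Integer coordinates on the polygon -/

section Coordinates
variable {n : ℕ}

/-- A multiple of `n` of absolute value less than `n` is zero. Equalities between points in a common
window of `n` integers thereby become linear arithmetic. -/
lemma intCast_eq_iff {x y : ℤ} (h₁ : x - y < n) (h₂ : y - x < n) :
    (x : ZMod n) = y ↔ x = y := by
  refine ⟨fun h => ?_, fun h => h ▸ rfl⟩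
  have h3 : (n : ℤ) ∣ x - y := by
    rw [← ZMod.intCast_zmod_eq_zero_iff_dvd]; push_cast; rw [h, sub_self]
  have := Int.eq_zero_of_abs_lt_dvd h3 (by rw [abs_lt]; constructor <;> linarith)
  linarith

variable [NeZero n]

lemma exists_intCast_eq (b : ℤ) (x : ZMod n) : ∃ y : ℤ, b ≤ y ∧ y < b + n ∧ (y : ZMod n) = x := by
  refine ⟨b + ((x - (b : ZMod n)).val : ℤ), by omega, ?_, ?_⟩
  · have := ZMod.val_lt (x - (b : ZMod n)); omega
  · push_cast
    rw [ZMod.natCast_zmod_val]; ring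

lemma sbtw_iff_val_lt {n : ℕ} [NeZero n] (a b c : ZMod n) :
    sbtw a b c ↔ a.val < b.val ∧ b.val < c.val ∨ b.val < c.val ∧ c.val < a.val ∨
      c.val < a.val ∧ a.val < b.val := by
  cases n with
  | zero => exact absurd rfl (NeZero.ne 0)
  | succ k => exact Iff.rfl

lemma val_intCast_eq (x : ℤ) : (((x : ZMod n)).val : ℤ) = x - n * (x / n) := by
  rw [ZMod.val_intCast]; have := Int.emod_add_mul_ediv x n; linarith

/-- The cyclic order does not depend on where the circle is cut: the standard representatives and
those in `[b, b + n)` differ by a rotation of the linear order, under which the three-fold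
disjunction is invariant. -/
lemma sbtw_intCast_iff {x y z b : ℤ} (hx : b ≤ x) (hx' : x < b + n) (hy : b ≤ y) (hy' : y < b + n)
    (hz : b ≤ z) (hz' : z < b + n) :
    sbtw (x : ZMod n) (y : ZMod n) (z : ZMod n) ↔ x < y ∧ y < z ∨ y < z ∧ z < x ∨ z < x ∧ x < y := by
  have hn : (0 : ℤ) < n := by have := NeZero.pos n; omega
  -- The window contains at most one change of quotient by `n`, at the first multiple of `n` beyond
  -- `b`.
  have key : ∀ w : ℤ, b ≤ w → w < b + n →
      ((((w : ZMod n)).val : ℤ) = w - n * (b / n) ∧ w < n * (b / n) + n) ∨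
      ((((w : ZMod n)).val : ℤ) = w - n * (b / n) - n ∧ n * (b / n) + n ≤ w) := by
    intro w h1 h2
    have hb1 := Int.emod_add_mul_ediv b n
    have hb2 := Int.emod_nonneg b hn.ne'
    have hb3 := Int.emod_lt_of_pos b hn
    rcases lt_or_ge w (n * (b / n) + n) with h | h
    · left
      refine ⟨?_, h⟩
      have : w / n = b / n := by
        rw [Int.ediv_eq_iff_of_pos hn]
        constructor <;> nlinarith
      rw [val_intCast_eq, this]
    · right
      refine ⟨?_, h⟩
      have : w / n = b / n + 1 := by
        rw [Int.ediv_eq_iff_of_pos hn]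
        constructor <;> nlinarith
      rw [val_intCast_eq, this]; ring
  rw [sbtw_iff_val_lt]
  zify
  generalize n * (b / n) = q at key
  rcases key x hx hx' with ⟨e1, h1⟩ | ⟨e1, h1⟩ <;> rcases key y hy hy' with ⟨e2, h2⟩ | ⟨e2, h2⟩ <;>
    rcases key z hz hz' with ⟨e3, h3⟩ | ⟨e3, h3⟩ <;> rw [e1, e2, e3] <;> omega

/-- Crossing of two segments in integer coordinates. -/
lemma crosses_intCast_iff {x y z w b : ℤ} (hx : b ≤ x) (hxy : x ≤ y) (hy : y < b + n)
    (hz : b ≤ z) (hzw : z ≤ w) (hw : w < b + n) :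
    Crosses s((x : ZMod n), (y : ZMod n)) s((z : ZMod n), (w : ZMod n)) ↔
      x < z ∧ z < y ∧ y < w ∨ z < x ∧ x < w ∧ w < y := by
  constructor
  · rintro ⟨a, b', c, d, h1, h2, h3, h4⟩
    rw [Sym2.eq_iff] at h1 h2
    rcases h1 with ⟨rfl, rfl⟩ | ⟨rfl, rfl⟩ <;> rcases h2 with ⟨rfl, rfl⟩ | ⟨rfl, rfl⟩ <;>
      rw [sbtw_intCast_iff (b := b) (by omega) (by omega) (by omega) (by omega) (by omega)
        (by omega)] at h3 h4 <;> omega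
  · intro h
    rcases h with h | h
    · refine ⟨x, y, z, w, rfl, rfl, ?_, ?_⟩ <;>
      rw [sbtw_intCast_iff (b := b) (by omega) (by omega) (by omega) (by omega) (by omega)
        (by omega)] <;> omega
    · refine ⟨x, y, w, z, rfl, Sym2.eq_swap, ?_, ?_⟩ <;>
      rw [sbtw_intCast_iff (b := b) (by omega) (by omega) (by omega) (by omega) (by omega)
        (by omega)] <;> omega

end Coordinates

/-! ### Partial sums of the vertices of a Yoke graph -/

/-- The partial sum `v_0 + ⋯ + v_i` in `ℤ/n`. -/
def YokeVertex.psum {n m : ℕ} (v : YokeVertex n m) (i : ℕ) : ZMod n :=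
  ∑ j : Fin (m + 2), if j.val ≤ i then (v.1 j : ZMod n) else 0

section Yoke
variable {n m : ℕ}

lemma isBucket_iff (i : Fin (m + 2)) : IsBucket i ↔ i.val = 0 ∨ i.val = m + 1 := by
  rw [IsBucket, Fin.ext_iff, Fin.ext_iff, Fin.val_zero, Fin.val_last]

lemma psum_zero (v : YokeVertex n m) : v.psum 0 = (v.1 0 : ZMod n) := by
  rw [YokeVertex.psum, Finset.sum_eq_single 0]
  · simp
  · intro b _ hb
    rw [if_neg]
    intro h; exact hb (Fin.ext (by simpa using h))
  · simp

lemma psum_succ (v : YokeVertex n m) (i : ℕ) (hi : i + 1 < m + 2) :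
    v.psum (i + 1) = v.psum i + (v.1 ⟨i + 1, hi⟩ : ZMod n) := by
  have : (v.1 ⟨i + 1, hi⟩ : ZMod n) =
      ∑ j : Fin (m + 2), if j = ⟨i + 1, hi⟩ then (v.1 j : ZMod n) else 0 := by
    rw [Finset.sum_ite_eq' Finset.univ (⟨i + 1, hi⟩ : Fin (m + 2)) fun j => (v.1 j : ZMod n)]
    simp
  rw [this, YokeVertex.psum, YokeVertex.psum, ← Finset.sum_add_distrib]
  refine Finset.sum_congr rfl fun j _ => ?_
  rcases lt_trichotomy j.val (i + 1) with h | h | h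
  · rw [if_pos (by omega), if_pos (by omega), if_neg (by rw [Fin.ext_iff]; simp; omega), add_zero]
  · rw [if_pos (by omega), if_neg (by omega), if_pos (by rw [Fin.ext_iff]; exact h), zero_add]
  · rw [if_neg (by omega), if_neg (by omega), if_neg (by rw [Fin.ext_iff]; simp; omega), add_zero]

/-- This is the divisibility condition on vertices. The last partial sum is constant, so only the
indices up to `m` carry information. -/
lemma psum_last (v : YokeVertex n m) : v.psum (m + 1) = 0 := by
  have : v.psum (m + 1) = ((∑ j, v.1 j : ℕ) : ZMod n) := by
    rw [YokeVertex.psum]; push_cast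
    exact Finset.sum_congr rfl fun j _ => if_pos (by omega)
  rw [this, ZMod.natCast_eq_zero_iff]
  exact v.2.2.2

lemma entry_lt_two (v : YokeVertex n m) (i : ℕ) (hi : i + 1 < m + 2) (h : i < m) :
    v.1 ⟨i + 1, hi⟩ < 2 :=
  v.2.2.1 _ (by rw [isBucket_iff]; simp; omega)

lemma psum_step (v : YokeVertex n m) (i : ℕ) (hi : i + 1 < m + 2) (h : i < m) :
    (v.1 ⟨i + 1, hi⟩ = 0 ∧ v.psum (i + 1) = v.psum i) ∨
      (v.1 ⟨i + 1, hi⟩ = 1 ∧ v.psum (i + 1) = v.psum i + 1) := by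
  have h1 := entry_lt_two v i hi h
  have h2 := psum_succ v i hi
  rcases (by omega : v.1 ⟨i + 1, hi⟩ = 0 ∨ v.1 ⟨i + 1, hi⟩ = 1) with h3 | h3 <;> rw [h3] at h2
  · exact .inl ⟨h3, by simpa using h2⟩
  · exact .inr ⟨h3, by simpa using h2⟩

/-- The partial sums determine the entries in `ℤ/n`. -/
lemma entry_cast_eq {u v : YokeVertex n m} (j : Fin (m + 2)) (h : u.psum j = v.psum j)
    (h' : ∀ i, i + 1 = j.val → u.psum i = v.psum i) : (u.1 j : ZMod n) = v.1 j := by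
  obtain ⟨j, hj⟩ := j
  cases j with
  | zero => simpa [psum_zero] using h
  | succ i =>
    have h1 := psum_succ u i hj
    have h2 := psum_succ v i hj
    rw [h, h' i rfl, h2] at h1
    exact (add_left_cancel h1).symm

lemma entry_eq_of_cast {u v : YokeVertex n m} (hn : 2 ≤ n) {j : Fin (m + 2)}
    (h : (u.1 j : ZMod n) = v.1 j) : u.1 j = v.1 j := by
  have hu : u.1 j < n := by
    by_cases hb : IsBucket j
    · exact u.2.1 j hb
    · exact (u.2.2.1 j hb).trans_le hn
  have hv : v.1 j < n := by
    by_cases hb : IsBucket j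
    · exact v.2.1 j hb
    · exact (v.2.2.1 j hb).trans_le hn
  rw [ZMod.natCast_eq_natCast_iff, Nat.ModEq, Nat.mod_eq_of_lt hu, Nat.mod_eq_of_lt hv] at h
  exact h

lemma yokeVertex_ext_psum (hn : 2 ≤ n) {u v : YokeVertex n m}
    (h : ∀ i ≤ m, u.psum i = v.psum i) : u = v := by
  have h' : ∀ i ≤ m + 1, u.psum i = v.psum i := by
    intro i hi
    rcases hi.lt_or_eq with hi | rfl
    · exact h i (by omega)
    · rw [psum_last, psum_last]
  refine Subtype.ext (funext fun j => entry_eq_of_cast hn (entry_cast_eq j ?_ ?_))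
  · exact h' _ (by omega)
  · intro i hi; exact h' _ (by omega)

/-- A sequence in `ℤ/n` whose steps are `0` or `1`. -/
def IsStepSeq (r : ℕ → ZMod n) : Prop := ∀ i, r (i + 1) = r i ∨ r (i + 1) = r i + 1

lemma exists_psum_eq (hn : 2 ≤ n) (r : ℕ → ZMod n)
    (hr : ∀ i < m, r (i + 1) = r i ∨ r (i + 1) = r i + 1) :
    ∃ v : YokeVertex n m, ∀ i ≤ m, v.psum i = r i := by
  classical
  have : NeZero n := ⟨by omega⟩
  -- The inner entries are the steps of `r`; the last entry `-r m` makes the total sum vanish.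
  let w : Fin (m + 2) → ℕ := fun j =>
    if j.val = 0 then (r 0).val else if j.val = m + 1 then (-r m).val
    else if r j = r (j - 1) then 0 else 1
  have hsum : ∀ k ≤ m, (∑ j : Fin (m + 2), if j.val ≤ k then (w j : ZMod n) else 0) = r k := by
    intro k
    induction k with
    | zero =>
      intro _
      rw [Finset.sum_eq_single 0]
      · simp [w]
      · intro b _ hb
        rw [if_neg]
        intro h; exact hb (Fin.ext (by simpa using h))
      · simp
    | succ k ih =>
      intro hk
      have hw : (w ⟨k + 1, by omega⟩ : ZMod n) = r (k + 1) - r k := by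
        simp only [w]
        rw [if_neg (by omega), if_neg (by omega)]
        simp only [add_tsub_cancel_right]
        rcases hr k (by omega) with h | h
        · simp [h]
        · rw [if_neg]
          · simp [h]
          · rw [h]
            have : Fact (1 < n) := ⟨by omega⟩
            simp
      rw [← sub_add_cancel (r (k + 1)) (r k), ← hw, ← ih (by omega)]
      have : (w ⟨k + 1, by omega⟩ : ZMod n) =
          ∑ j : Fin (m + 2), if j = ⟨k + 1, by omega⟩ then (w j : ZMod n) else 0 := by
        rw [Finset.sum_ite_eq' Finset.univ (⟨k + 1, by omega⟩ : Fin (m + 2))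
          fun j => (w j : ZMod n)]
        simp
      rw [this, ← Finset.sum_add_distrib]
      refine Finset.sum_congr rfl fun j _ => ?_
      rcases lt_trichotomy j.val (k + 1) with h | h | h
      · rw [if_pos (by omega), if_neg (by rw [Fin.ext_iff]; simp; omega), if_pos (by omega),
          zero_add]
      · rw [if_pos (by omega), if_pos (by rw [Fin.ext_iff]; exact h), if_neg (by omega), add_zero]
      · rw [if_neg (by omega), if_neg (by rw [Fin.ext_iff]; simp; omega), if_neg (by omega),
          add_zero]
  refine ⟨⟨w, fun i hi => ?_, fun i hi => ?_, ?_⟩, fun i hi => hsum i hi⟩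
  · rw [isBucket_iff] at hi
    simp only [w]
    rcases hi with hi | hi
    · rw [if_pos hi]; exact ZMod.val_lt _
    · rw [if_neg (by omega), if_pos hi]; exact ZMod.val_lt _
  · rw [isBucket_iff, not_or] at hi
    simp only [w]
    rw [if_neg hi.1, if_neg hi.2]
    split_ifs <;> omega
  · rw [← ZMod.natCast_eq_zero_iff, Fin.sum_univ_castSucc]
    push_cast
    have h1 : (w (Fin.last (m + 1)) : ZMod n) = - r m := by simp [w]
    have h2 := hsum m le_rfl
    rw [Fin.sum_univ_castSucc] at h2
    rw [h1, ← h2, if_neg (by simp), add_zero, ← sub_eq_add_neg, sub_eq_zero]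
    exact Finset.sum_congr rfl fun j _ => (if_pos (by simp; omega)).symm

lemma EntrySucc.cast {i : Fin (m + 2)} {x y : ℕ} (h : EntrySucc n i x y) :
    (y : ZMod n) = x + 1 := by
  rcases h with h | h
  · exact h.2
  · rw [h.2]; push_cast; rfl

lemma zmod_one_ne_zero (hn : 2 ≤ n) : (1 : ZMod n) ≠ 0 := by
  have : Fact (1 < n) := ⟨by omega⟩
  exact one_ne_zero

lemma zmod_two_ne_zero (hn : 3 ≤ n) : (2 : ZMod n) ≠ 0 := by
  intro h
  have : ((2 : ℕ) : ZMod n) = 0 := by exact_mod_cast h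
  rw [ZMod.natCast_eq_zero_iff] at this
  exact absurd (Nat.le_of_dvd (by omega) this) (by omega)

/-- For inner entries the equation has to be lifted from `ℤ/n` to `{0, 1}`; the false solution `0 =
1 + 1` is excluded by `n ≥ 3`. For `m = 0` there are no inner entries. -/
lemma entrySucc_of_cast (hn : 3 ≤ n ∨ m = 0) {u v : YokeVertex n m} {i : Fin (m + 2)}
    (h : (v.1 i : ZMod n) = u.1 i + 1) : EntrySucc n i (u.1 i) (v.1 i) := by
  by_cases hb : IsBucket i
  · exact .inl ⟨hb, h⟩
  · right
    refine ⟨hb, ?_⟩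
    have hu := u.2.2.1 i hb
    have hv := v.2.2.1 i hb
    have hn : 3 ≤ n := by
      rcases hn with hn | rfl
      · exact hn
      · rw [isBucket_iff] at hb; omega
    have h1 := zmod_one_ne_zero (n := n) (by omega)
    have h2 := zmod_two_ne_zero hn
    rcases (by omega : u.1 i = 0 ∨ u.1 i = 1) with e | e <;>
      rcases (by omega : v.1 i = 0 ∨ v.1 i = 1) with e' | e' <;> rw [e, e'] at h ⊢ <;>
      norm_num at h
    · exact absurd h.symm h1
    · exact absurd h.symm h2
    · exact absurd (by linear_combination -h) h1

/-- The vertices of small or thin Yoke graphs, where every change of a single partial sum is a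
shift of a unit. -/
def YokeTight (n m : ℕ) : Prop := 2 ≤ n ∧ (3 ≤ n ∧ 1 ≤ m ∨ m = 0 ∧ n ≤ 3)

/-- For `m ≥ 1` an adjacent partial sum is common to both vertices, and both values at `i` are one
step `0` or `1` away from it on the same side. For `m = 0` one has `n ≤ 3`, where any two distinct
residues differ by `±1`. -/
lemma psum_sub_eq_one (hnm : YokeTight n m) {u v : YokeVertex n m} {i : ℕ} (hi : i ≤ m)
    (h : ∀ j ≤ m, j ≠ i → u.psum j = v.psum j) (hne : u.psum i ≠ v.psum i) :
    u.psum i = v.psum i + 1 ∨ v.psum i = u.psum i + 1 := by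
  obtain ⟨hn, hnm⟩ := hnm
  rcases Nat.eq_zero_or_pos m with rfl | hm
  · have hn3 : n = 2 ∨ n = 3 := by omega
    generalize u.psum i = x at *
    generalize v.psum i = y at *
    rcases hn3 with rfl | rfl <;> clear * - hne <;> revert x y <;> decide
  · rcases Nat.eq_zero_or_pos i with rfl | hi0
    · have e := h 1 hm (by omega)
      rcases psum_step u 0 (by omega) hm with ⟨-, h1⟩ | ⟨-, h1⟩ <;>
        rcases psum_step v 0 (by omega) hm with ⟨-, h2⟩ | ⟨-, h2⟩ <;>
        rw [zero_add] at h1 h2 <;> rw [h1, h2] at e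
      · exact absurd e hne
      · exact .inl e
      · exact .inr e.symm
      · exact absurd (add_right_cancel e) hne
    · obtain ⟨i, rfl⟩ : ∃ k, i = k + 1 := ⟨i - 1, by omega⟩
      have e := h i (by omega) (by omega)
      rcases psum_step u i (by omega) (by omega) with ⟨-, h1⟩ | ⟨-, h1⟩ <;>
        rcases psum_step v i (by omega) (by omega) with ⟨-, h2⟩ | ⟨-, h2⟩ <;>
        rw [h1, h2, e] at hne ⊢ <;> simp_all

/-- Shifting a unit between the entries `i` and `i + 1` changes precisely the `i`-th partial sum. -/
lemma yokeShift_iff (hnm : YokeTight n m) {u v : YokeVertex n m} (i : Fin (m + 1)) :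
    YokeShift i u v ↔ (∀ j ≤ m, j ≠ i.val → u.psum j = v.psum j) ∧ u.psum i ≠ v.psum i := by
  have hn := hnm.1
  have h3 : 3 ≤ n ∨ m = 0 := by rcases hnm.2 with h | h <;> omega
  constructor
  · rintro ⟨h1, h2⟩
    have hlt : ∀ j < i.val, u.psum j = v.psum j := by
      intro j hj
      refine Finset.sum_congr rfl fun k _ => ?_
      split_ifs with hk
      · rw [h1 k] <;> rw [Ne, Fin.ext_iff] <;> simp <;> omega
      · rfl
    have hi : u.psum i - v.psum i = (u.1 i.castSucc : ZMod n) - v.1 i.castSucc := by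
      obtain ⟨i, hi⟩ := i
      cases i with
      | zero => simp [psum_zero]
      | succ i =>
        have e1 := psum_succ u i (by omega)
        have e2 := psum_succ v i (by omega)
        simp only [Fin.castSucc_mk]
        rw [e1, e2, hlt i (by simp)]; ring
    -- The changes of the two entries cancel, so the partial sums agree again from index `i + 1` on.
    have hi' : u.psum (i + 1) = v.psum (i + 1) := by
      have e1 := psum_succ u i.val (by omega)
      have e2 := psum_succ v i.val (by omega)
      have e3 : (⟨i.val + 1, by omega⟩ : Fin (m + 2)) = i.succ := rfl
      rw [e1, e2, e3]
      rcases h2 with ⟨h4, h5⟩ | ⟨h4, h5⟩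
      · have h4 := h4.cast; have h5 := h5.cast
        rw [h5]; rw [h4] at hi
        linear_combination hi
      · have h4 := h4.cast; have h5 := h5.cast
        rw [h5]; rw [h4] at hi
        linear_combination hi
    refine ⟨?_, ?_⟩
    · have hgt : ∀ d, i.val + 1 + d ≤ m → u.psum (i.val + 1 + d) = v.psum (i.val + 1 + d) := by
        intro d
        induction d with
        | zero => intro _; exact hi'
        | succ d ih =>
          intro hd
          have e1 := psum_succ u (i.val + 1 + d) (by omega)
          have e2 := psum_succ v (i.val + 1 + d) (by omega)
          rw [← add_assoc, e1, e2, ih (by omega), h1]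
          · rw [Ne, Fin.ext_iff, Fin.val_castSucc]; dsimp only; omega
          · rw [Ne, Fin.ext_iff, Fin.val_succ]; dsimp only; omega
      intro j hj hji
      rcases lt_or_gt_of_ne hji with h | h
      · exact hlt j h
      · obtain ⟨d, rfl⟩ : ∃ d, j = i.val + 1 + d := ⟨j - (i.val + 1), by omega⟩
        exact hgt d hj
    · intro he
      rw [he, sub_self] at hi
      have h1 := zmod_one_ne_zero hn
      rcases h2 with ⟨h4, -⟩ | ⟨h4, -⟩
      · rw [h4.cast] at hi; apply h1; linear_combination -hi
      · rw [h4.cast] at hi; apply h1; linear_combination hi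
  · rintro ⟨h1, h2⟩
    -- The agreement extends to index `m + 1`, where both sums vanish; this covers the last entry.
    have hm1 : ∀ j ≤ m + 1, j ≠ i.val → u.psum j = v.psum j := by
      intro j hj hji
      rcases hj.lt_or_eq with hj | rfl
      · exact h1 j (by omega) hji
      · rw [psum_last, psum_last]
    have hd := psum_sub_eq_one hnm (by omega) h1 h2
    have hi : (u.1 i.castSucc : ZMod n) - v.1 i.castSucc = u.psum i - v.psum i := by
      obtain ⟨i, hi⟩ := i
      cases i with
      | zero => simp [psum_zero]
      | succ i =>
        have e1 := psum_succ u i (by omega)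
        have e2 := psum_succ v i (by omega)
        simp only [Fin.castSucc_mk]
        rw [e1, e2, hm1 i (by omega) (by simp)]; ring
    have hi' : (u.1 i.succ : ZMod n) - v.1 i.succ = v.psum i - u.psum i := by
      have e1 := psum_succ u i.val (by omega)
      have e2 := psum_succ v i.val (by omega)
      have e3 : (⟨i.val + 1, by omega⟩ : Fin (m + 2)) = i.succ := rfl
      rw [e3] at e1 e2
      have := hm1 (i.val + 1) (by omega) (by omega)
      rw [e1, e2] at this
      linear_combination this
    refine ⟨fun j hj hj' => entry_eq_of_cast hn (entry_cast_eq j ?_ ?_), ?_⟩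
    · apply hm1 _ (by omega)
      intro h; exact hj (Fin.ext h)
    · intro k hk
      apply hm1 _ (by omega)
      intro h; exact hj' (Fin.ext (by rw [← hk, h]; rfl))
    · rcases hd with hd | hd
      · left
        exact ⟨entrySucc_of_cast h3 (by linear_combination hi + hd),
          entrySucc_of_cast h3 (by linear_combination hd - hi')⟩
      · right
        exact ⟨entrySucc_of_cast h3 (by linear_combination hd - hi),
          entrySucc_of_cast h3 (by linear_combination hi' + hd)⟩

lemma yokeShift_symm (hnm : YokeTight n m) {u v : YokeVertex n m} {i : Fin (m + 1)}
    (h : YokeShift i u v) : YokeShift i v u := by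
  rw [yokeShift_iff hnm] at h ⊢
  exact ⟨fun j hj hji => (h.1 j hj hji).symm, h.2.symm⟩

lemma yokeGraph_adj_iff (hnm : YokeTight n m) {u v : YokeVertex n m} :
    (yokeGraph n m).Adj u v ↔ ∃ i, YokeShift i u v := by
  rw [yokeGraph, SimpleGraph.fromRel_adj]
  constructor
  · rintro ⟨-, ⟨i, h⟩ | ⟨i, h⟩⟩
    · exact ⟨i, h⟩
    · exact ⟨i, yokeShift_symm hnm h⟩
  · rintro ⟨i, h⟩
    refine ⟨?_, .inl ⟨i, h⟩⟩
    rintro rfl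
    rw [yokeShift_iff hnm] at h
    exact h.2 rfl

/-- The partial sums of a vertex, continued as a constant sequence. -/
lemma isStepSeq_psum (v : YokeVertex n m) : IsStepSeq fun i => v.psum (min i m) := by
  intro i
  rcases lt_or_ge i m with h | h
  · simp only [min_eq_left h.le, min_eq_left (Nat.succ_le_of_lt h)]
    rcases psum_step v i (by omega) h with ⟨-, h1⟩ | ⟨-, h1⟩
    · exact .inl h1
    · exact .inr h1
  · left
    simp only [min_eq_right h, min_eq_right (h.trans (Nat.le_succ i))]

lemma IsStepSeq.exists_add {r : ℕ → ZMod n} (hr : IsStepSeq r) (i d : ℕ) :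
    ∃ e ≤ d, r (i + d) = r i + (e : ZMod n) := by
  induction d with
  | zero => exact ⟨0, le_rfl, by simp⟩
  | succ d ih =>
    obtain ⟨e, he, h⟩ := ih
    rcases hr (i + d) with h' | h'
    · exact ⟨e, by omega, by rw [← add_assoc, h', h]⟩
    · exact ⟨e + 1, by omega, by rw [← add_assoc, h', h]; push_cast; ring⟩

end Yoke

/-! ### Arcs and growing sequences of arcs -/

/-- The arc `{e, e - 1, …, e - (k - 1)}`. -/
def arcSet {n : ℕ} (e : ZMod n) (k : ℕ) : Set (ZMod n) := {x | ∃ d < k, x = e - (d : ZMod n)}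

section Arcs
variable {n : ℕ}

lemma natCast_eq_iff_of_lt {a b : ℕ} (ha : a < n) (hb : b < n) : (a : ZMod n) = b ↔ a = b := by
  rw [ZMod.natCast_eq_natCast_iff, Nat.ModEq, Nat.mod_eq_of_lt ha, Nat.mod_eq_of_lt hb]

lemma sub_mem_arcSet_iff {e : ZMod n} {d k : ℕ} (hd : d < n) (hk : k ≤ n) :
    e - d ∈ arcSet e k ↔ d < k := by
  constructor
  · rintro ⟨d', hd', h⟩
    rw [sub_right_inj, natCast_eq_iff_of_lt hd (by omega)] at h
    omega
  · intro h; exact ⟨d, h, rfl⟩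

/-- Used with `k' = k + 1`: the end of a growing arc moves by `0` or `1`. -/
lemma exists_eq_sub_of_arcSet_subset {e e' : ZMod n} {k k' : ℕ} (hk : 1 ≤ k) (hkk : k ≤ k')
    (hk' : k' < n) (h : arcSet e k ⊆ arcSet e' k') : ∃ d ≤ k' - k, e = e' - (d : ZMod n) := by
  obtain ⟨d, hd, rfl⟩ := (h ⟨0, by omega, by simp⟩ : e ∈ arcSet e' k')
  refine ⟨d, ?_, rfl⟩
  by_contra hlt
  -- If `e` were lower, the smaller arc would reach the point `e' - k'`, the first one below the
  -- larger arc.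
  have h1 : e' - (d : ZMod n) - ((k' - d : ℕ) : ZMod n) ∈ arcSet e' k' :=
    h ⟨k' - d, by omega, rfl⟩
  rw [sub_sub, ← Nat.cast_add, sub_mem_arcSet_iff (by omega) hk'.le] at h1
  omega

lemma arcSet_injective {e e' : ZMod n} {k : ℕ} (hk : 1 ≤ k) (hk' : k < n)
    (h : arcSet e k = arcSet e' k) : e = e' := by
  obtain ⟨d, hd, rfl⟩ := exists_eq_sub_of_arcSet_subset hk le_rfl hk' h.subset
  obtain rfl : d = 0 := by omega
  simp

lemma isCyclicInterval_arcSet (e : ZMod n) (k : ℕ) : IsCyclicInterval (arcSet e k) := by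
  refine ⟨e - k + 1, k, Set.ext fun x => ⟨?_, ?_⟩⟩
  · rintro ⟨d, hd, rfl⟩
    refine ⟨k - 1 - d, by omega, ?_⟩
    obtain ⟨c, rfl⟩ : ∃ c, k = d + 1 + c := ⟨k - (d + 1), by omega⟩
    rw [show d + 1 + c - 1 - d = c by omega]; push_cast; ring
  · rintro ⟨d, hd, rfl⟩
    refine ⟨k - 1 - d, by omega, ?_⟩
    obtain ⟨c, rfl⟩ : ∃ c, k = d + 1 + c := ⟨k - (d + 1), by omega⟩
    rw [show d + 1 + c - 1 - d = c by omega]; push_cast; ring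

lemma compl_arcSet [NeZero n] (e : ZMod n) {k : ℕ} (hk : k ≤ n) :
    (arcSet e k)ᶜ = arcSet (e - (k : ZMod n)) (n - k) := by
  ext x
  obtain ⟨d, hd, rfl⟩ : ∃ d < n, x = e - (d : ZMod n) :=
    ⟨(e - x).val, ZMod.val_lt _, by rw [ZMod.natCast_zmod_val]; ring⟩
  rw [Set.mem_compl_iff, sub_mem_arcSet_iff hd hk]
  constructor
  · intro h
    refine ⟨d - k, by omega, ?_⟩
    rw [sub_sub, ← Nat.cast_add, show k + (d - k) = d by omega]
  · rintro ⟨d', hd', h⟩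
    rw [sub_sub, sub_right_inj, ← Nat.cast_add, natCast_eq_iff_of_lt hd (by omega)] at h
    omega

lemma ncard_arcSet (e : ZMod n) {k : ℕ} (hk : k ≤ n) : (arcSet e k).ncard = k := by
  have : arcSet e k = (fun d : ℕ => e - (d : ZMod n)) '' (Finset.range k : Set ℕ) := by
    ext x; simp [arcSet, eq_comm]
  rw [this, Set.InjOn.ncard_image, Set.ncard_coe_finset, Finset.card_range]
  intro a ha b hb h
  simp only [Finset.coe_range, Set.mem_Iio] at ha hb
  simp only [sub_right_inj] at h
  rwa [natCast_eq_iff_of_lt (by omega) (by omega)] at h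

lemma arcSet_eq_univ [NeZero n] (e : ZMod n) {k : ℕ} (hk : n ≤ k) : arcSet e k = Set.univ := by
  refine Set.eq_univ_of_forall fun x => ⟨(e - x).val, (ZMod.val_lt _).trans_le hk, ?_⟩
  rw [ZMod.natCast_zmod_val]; ring

lemma IsCyclicInterval.exists_arcSet {S : Set (ZMod n)} (h : IsCyclicInterval S) :
    ∃ e k, S = arcSet e k := by
  obtain ⟨a, k, rfl⟩ := h
  refine ⟨a + k - 1, k, Set.ext fun x => ⟨?_, ?_⟩⟩
  · rintro ⟨d, hd, rfl⟩
    refine ⟨k - 1 - d, by omega, ?_⟩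
    obtain ⟨c, rfl⟩ : ∃ c, k = d + 1 + c := ⟨k - (d + 1), by omega⟩
    rw [show d + 1 + c - 1 - d = c by omega]; push_cast; ring
  · rintro ⟨d, hd, rfl⟩
    refine ⟨k - 1 - d, by omega, ?_⟩
    obtain ⟨c, rfl⟩ : ∃ c, k = d + 1 + c := ⟨k - (d + 1), by omega⟩
    rw [show d + 1 + c - 1 - d = c by omega]; push_cast; ring

open Classical in
/-- The vertices in the order in which they enter the arcs `arcSet (r i) (i + 1)`. -/
noncomputable def arcVertex (r : ℕ → ZMod n) : ℕ → ZMod n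
  | 0 => r 0
  | i + 1 => if r (i + 1) = r i then r i - ((i + 1 : ℕ) : ZMod n) else r i + 1

lemma arcVertex_succ_of_eq {r : ℕ → ZMod n} {i : ℕ} (h : r (i + 1) = r i) :
    arcVertex r (i + 1) = r i - ((i + 1 : ℕ) : ZMod n) := by
  rw [arcVertex, if_pos h]

lemma arcVertex_succ_of_eq_add (hn : 2 ≤ n) {r : ℕ → ZMod n} {i : ℕ} (h : r (i + 1) = r i + 1) :
    arcVertex r (i + 1) = r i + 1 := by
  rw [arcVertex, if_neg]
  rw [h]; simpa using zmod_one_ne_zero hn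

/-- A step `0` keeps the upper end and adds a vertex below; a step `1` keeps the lower end and adds
a vertex above. -/
lemma arcSet_succ (hn : 2 ≤ n) {r : ℕ → ZMod n} (hr : IsStepSeq r) (i : ℕ) (x : ZMod n) :
    x ∈ arcSet (r (i + 1)) (i + 2) ↔ x ∈ arcSet (r i) (i + 1) ∨ x = arcVertex r (i + 1) := by
  rcases hr i with h | h
  · rw [arcVertex_succ_of_eq h, h]
    constructor
    · rintro ⟨d, hd, rfl⟩
      rcases (by omega : d < i + 1 ∨ d = i + 1) with hd | rfl
      · exact .inl ⟨d, hd, rfl⟩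
      · exact .inr rfl
    · rintro (⟨d, hd, rfl⟩ | rfl)
      · exact ⟨d, by omega, rfl⟩
      · exact ⟨i + 1, by omega, rfl⟩
  · rw [arcVertex_succ_of_eq_add hn h, h]
    constructor
    · rintro ⟨d, hd, rfl⟩
      rcases d with _ | d
      · right; simp
      · exact .inl ⟨d, by omega, by push_cast; ring⟩
    · rintro (⟨d, hd, rfl⟩ | rfl)
      · exact ⟨d + 1, by omega, by push_cast; ring⟩
      · exact ⟨0, by omega, by simp⟩

lemma mem_arcSet_iff_exists (hn : 2 ≤ n) {r : ℕ → ZMod n} (hr : IsStepSeq r) (i : ℕ)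
    (x : ZMod n) : x ∈ arcSet (r i) (i + 1) ↔ ∃ j ≤ i, x = arcVertex r j := by
  induction i with
  | zero =>
    constructor
    · rintro ⟨d, hd, rfl⟩
      exact ⟨0, le_rfl, by obtain rfl : d = 0 := by omega
                           simp [arcVertex]⟩
    · rintro ⟨j, hj, rfl⟩
      obtain rfl : j = 0 := by omega
      exact ⟨0, by omega, by simp [arcVertex]⟩
  | succ i ih =>
    rw [arcSet_succ hn hr, ih]
    constructor
    · rintro (⟨j, hj, h⟩ | h)
      · exact ⟨j, by omega, h⟩
      · exact ⟨i + 1, le_rfl, h⟩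
    · rintro ⟨j, hj, h⟩
      rcases (by omega : j ≤ i ∨ j = i + 1) with hj | rfl
      · exact .inl ⟨j, hj, h⟩
      · exact .inr h

/-- The vertex above the end of an arc is rewritten as a distance below it, the form to which
`sub_mem_arcSet_iff` applies. -/
lemma add_one_eq_sub (hn : 2 ≤ n) (x : ZMod n) : x + 1 = x - ((n - 1 : ℕ) : ZMod n) := by
  rw [Nat.cast_sub (by omega)]; simp

lemma arcVertex_notMem (hn : 2 ≤ n) {r : ℕ → ZMod n} (hr : IsStepSeq r) {i : ℕ}
    (hi : i + 1 < n) : arcVertex r (i + 1) ∉ arcSet (r i) (i + 1) := by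
  rcases hr i with h | h
  · rw [arcVertex_succ_of_eq h, sub_mem_arcSet_iff hi hi.le]; omega
  · rw [arcVertex_succ_of_eq_add hn h, add_one_eq_sub hn, sub_mem_arcSet_iff (by omega) hi.le]
    omega

/-- A later vertex lies outside an arc that contains the earlier one. Together with
`exists_eq_arcVertex`, the entering vertices of index below `n` enumerate `ℤ/n` without repetition,
so every vertex has an entry time. -/
lemma arcVertex_inj (hn : 2 ≤ n) {r : ℕ → ZMod n} (hr : IsStepSeq r) {i j : ℕ}
    (hi : i < n) (hj : j < n) (h : arcVertex r i = arcVertex r j) : i = j := by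
  have key : ∀ i j, i < j → j < n → arcVertex r i ≠ arcVertex r j := by
    intro i j hij hj h
    obtain ⟨j, rfl⟩ : ∃ k, j = k + 1 := ⟨j - 1, by omega⟩
    exact arcVertex_notMem hn hr hj
      (h ▸ (mem_arcSet_iff_exists hn hr j _).2 ⟨i, by omega, rfl⟩)
  rcases lt_trichotomy i j with h' | h' | h'
  · exact absurd h (key i j h' hj)
  · exact h'
  · exact absurd h.symm (key j i h' hi)

lemma exists_eq_arcVertex (hn : 2 ≤ n) {r : ℕ → ZMod n} (hr : IsStepSeq r) (x : ZMod n) :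
    ∃ j < n, x = arcVertex r j := by
  have : NeZero n := ⟨by omega⟩
  have h : x ∈ arcSet (r (n - 1)) (n - 1 + 1) := by
    rw [arcSet_eq_univ _ (by omega)]; trivial
  rw [mem_arcSet_iff_exists hn hr] at h
  obtain ⟨j, hj, h⟩ := h
  exact ⟨j, by omega, h⟩

end Arcs

/-! ### Arc permutations -/

section ArcPermutations
variable {n : ℕ}

lemma letter_injective : Function.Injective (letter : Fin n → ZMod n) := by
  intro x y h
  rw [letter, letter, add_left_inj, natCast_eq_iff_of_lt x.2 y.2] at h
  exact Fin.ext h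

lemma letter_mem_prefixSet {π : Equiv.Perm (Fin n)} {k : ℕ} {p : Fin n} :
    letter (π p) ∈ prefixSet π k ↔ p.val < k := by
  constructor
  · rintro ⟨i, hi, h⟩
    rwa [π.injective (letter_injective h)]
  · intro h; exact ⟨p, h, rfl⟩

lemma letter_surjective [NeZero n] (x : ZMod n) : ∃ p : Fin n, x = letter p :=
  ⟨⟨(x - 1).val, ZMod.val_lt _⟩, by rw [letter, ZMod.natCast_zmod_val]; ring⟩

/-- As complements of arcs are arcs, the condition on suffixes follows from the one on prefixes. -/
lemma suffixSet_eq_compl [NeZero n] (π : Equiv.Perm (Fin n)) (k : ℕ) :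
    suffixSet π k = (prefixSet π k)ᶜ := by
  ext x
  obtain ⟨q, rfl⟩ := letter_surjective x
  obtain ⟨p, rfl⟩ := π.surjective q
  rw [Set.mem_compl_iff, letter_mem_prefixSet, not_lt]
  constructor
  · rintro ⟨i, hi, h⟩
    rwa [π.injective (letter_injective h)]
  · intro h; exact ⟨p, h, rfl⟩

lemma ncard_prefixSet (π : Equiv.Perm (Fin n)) {k : ℕ} (hk : k ≤ n) : (prefixSet π k).ncard = k := by
  have : prefixSet π k = (fun i : Fin k => letter (π (i.castLE hk))) '' Set.univ := by
    ext x
    constructor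
    · rintro ⟨i, hi, rfl⟩
      exact ⟨⟨i, hi⟩, trivial, rfl⟩
    · rintro ⟨i, -, rfl⟩
      exact ⟨i.castLE hk, i.2, rfl⟩
  rw [this, Set.ncard_image_of_injective, Set.ncard_univ, Nat.card_fin]
  intro a b h
  exact Fin.castLE_injective hk (π.injective (letter_injective h))

lemma prefixSet_zero (π : Equiv.Perm (Fin n)) : prefixSet π 0 = ∅ := by
  ext x; simp [prefixSet]

lemma prefixSet_of_le [NeZero n] (π : Equiv.Perm (Fin n)) {k : ℕ} (hk : n ≤ k) :
    prefixSet π k = Set.univ := by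
  refine Set.eq_univ_of_forall fun x => ?_
  obtain ⟨q, rfl⟩ := letter_surjective x
  obtain ⟨p, rfl⟩ := π.surjective q
  exact letter_mem_prefixSet.2 (by omega)

/-- The prefixes of `π` are the arcs that end at the partial sums of `v`. -/
def ArcRel (π : ArcPerm n) (v : YokeVertex n (n - 2)) : Prop :=
  ∀ i ≤ n - 2, prefixSet π.1 (i + 1) = arcSet (v.psum i + 1) (i + 1)

/-- The definition of an interval leaves its length free and allows it to wrap around; counting
elements forces the length `k`. -/
lemma exists_prefixSet_eq_arcSet (π : ArcPerm n) {k : ℕ} (hk : k < n) :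
    ∃ e, prefixSet π.1 k = arcSet e k := by
  have : NeZero n := ⟨by omega⟩
  obtain ⟨e, l, h⟩ := (π.2 k hk.le).1.exists_arcSet
  refine ⟨e, ?_⟩
  have hc := ncard_prefixSet π.1 hk.le
  rw [h] at hc ⊢
  rcases le_total l n with hl | hl
  · rw [ncard_arcSet e hl] at hc; rw [hc]
  · rw [arcSet_eq_univ e hl, Set.ncard_univ, Nat.card_zmod] at hc
    omega

lemma exists_arcRel_right (hn : 2 ≤ n) (π : ArcPerm n) : ∃ v, ArcRel π v := by
  have h1 : ∀ i, ∃ e : ZMod n, i ≤ n - 2 → prefixSet π.1 (i + 1) = arcSet (e + 1) (i + 1) := by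
    intro i
    by_cases hi : i ≤ n - 2
    · obtain ⟨e, he⟩ := exists_prefixSet_eq_arcSet π (k := i + 1) (by omega)
      exact ⟨e - 1, fun _ => by rw [he, sub_add_cancel]⟩
    · exact ⟨0, fun h => absurd h hi⟩
  choose r hr using h1
  obtain ⟨v, hv⟩ := exists_psum_eq (m := n - 2) hn r (by
    intro i hi
    -- Consecutive prefixes are nested arcs whose lengths differ by one.
    have hsub : arcSet (r i + 1) (i + 1) ⊆ arcSet (r (i + 1) + 1) (i + 1 + 1) := by
      rw [← hr i hi.le, ← hr (i + 1) (by omega)]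
      rintro x ⟨j, hj, rfl⟩
      exact ⟨j, by omega, rfl⟩
    obtain ⟨d, hd, h⟩ := exists_eq_sub_of_arcSet_subset (by omega) (by omega) (by omega) hsub
    rcases (by omega : d = 0 ∨ d = 1) with rfl | rfl
    · left; push_cast at h; linear_combination -h
    · right; push_cast at h; linear_combination -h)
  exact ⟨v, fun i hi => by rw [hr i hi, hv i hi]⟩

lemma exists_arcRel_left (hn : 2 ≤ n) (v : YokeVertex n (n - 2)) : ∃ π, ArcRel π v := by
  have : NeZero n := ⟨by omega⟩
  set r : ℕ → ZMod n := fun i => v.psum (min i (n - 2)) with hr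
  have hs : IsStepSeq r := isStepSeq_psum v
  -- The permutation lists the vertices in the order in which they enter the arcs.
  let F : Fin n → Fin n := fun i => ⟨(arcVertex r i).val, ZMod.val_lt _⟩
  have hF : Function.Injective F := by
    intro i j h
    have := ZMod.val_injective n (Fin.mk.inj_iff.1 h)
    exact Fin.ext (arcVertex_inj hn hs i.2 j.2 this)
  let π : Equiv.Perm (Fin n) := Equiv.ofBijective F (Finite.injective_iff_bijective.1 hF)
  have hπ : ∀ i, letter (π i) = arcVertex r i + 1 := by
    intro i
    change ((arcVertex r i).val : ZMod n) + 1 = _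
    rw [ZMod.natCast_zmod_val]
  have hpre : ∀ i < n, prefixSet π (i + 1) = arcSet (r i + 1) (i + 1) := by
    intro i hi
    ext x
    have h1 : x ∈ arcSet (r i + 1) (i + 1) ↔ x - 1 ∈ arcSet (r i) (i + 1) := by
      constructor
      · rintro ⟨d, hd, rfl⟩; exact ⟨d, hd, by ring⟩
      · rintro ⟨d, hd, h⟩; exact ⟨d, hd, by linear_combination h⟩
    rw [h1, mem_arcSet_iff_exists hn hs]
    constructor
    · rintro ⟨j, hj, rfl⟩
      exact ⟨j, by omega, by rw [hπ]; ring⟩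
    · rintro ⟨j, hj, h⟩
      exact ⟨⟨j, by omega⟩, by simp; omega, by rw [hπ, ← h]; ring⟩
  refine ⟨⟨π, fun k hk => ?_⟩, fun i hi => ?_⟩
  · have harc : ∃ e, prefixSet π k = arcSet e k := by
      rcases k with _ | k
      · refine ⟨0, ?_⟩
        rw [prefixSet_zero]; ext x; simp [arcSet]
      · exact ⟨_, hpre k (by omega)⟩
    obtain ⟨e, he⟩ := harc
    rw [suffixSet_eq_compl, he, compl_arcSet e hk]
    exact ⟨isCyclicInterval_arcSet _ _, isCyclicInterval_arcSet _ _⟩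
  · rw [hpre i (by omega), hr]
    simp only [min_eq_left hi]

/-- The letter at position `p` is the only one in the prefix of length `p + 1` but not in that of
length `p`. -/
lemma letter_eq_of_prefixSet_eq {π σ : Equiv.Perm (Fin n)} {p : Fin n}
    (h₁ : prefixSet π p = prefixSet σ p) (h₂ : prefixSet π (p + 1) = prefixSet σ (p + 1)) :
    π p = σ p := by
  obtain ⟨q, hq⟩ := σ.surjective (π p)
  have h3 : letter (σ q) ∈ prefixSet σ (p + 1) := by
    rw [hq, ← h₂, letter_mem_prefixSet]; omega
  have h4 : letter (σ q) ∉ prefixSet σ p := by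
    rw [hq, ← h₁, letter_mem_prefixSet]; omega
  rw [letter_mem_prefixSet] at h3 h4
  rw [← hq, show q = p from Fin.ext (by omega)]

lemma ArcRel.prefixSet_eq_iff {π σ : ArcPerm n} {u v : YokeVertex n (n - 2)} (hu : ArcRel π u)
    (hv : ArcRel σ v) {i : ℕ} (hn : 2 ≤ n) (hi : i ≤ n - 2) :
    prefixSet π.1 (i + 1) = prefixSet σ.1 (i + 1) ↔ u.psum i = v.psum i := by
  rw [hu i hi, hv i hi]
  constructor
  · intro h
    exact add_right_cancel (arcSet_injective (by omega) (by omega) h)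
  · intro h; rw [h]

/-- Exchanging two adjacent letters changes only the prefix that separates them. Conversely, if only
this prefix changes, all other positions keep their letters, and the two remaining letters must be
exchanged. -/
lemma arcSwap_iff (hn : 2 ≤ n) {π σ : ArcPerm n} {u v : YokeVertex n (n - 2)}
    (hu : ArcRel π u) (hv : ArcRel σ v) {i : ℕ} (hi : i + 1 < n) :
    ArcSwap i hi π σ ↔ (∀ j ≤ n - 2, j ≠ i → u.psum j = v.psum j) ∧ u.psum i ≠ v.psum i := by
  have : NeZero n := ⟨by omega⟩
  -- The condition on partial sums becomes one on prefixes; the prefix of length `0` and those of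
  -- length at least `n` always agree.
  have e : ((∀ j ≤ n - 2, j ≠ i → u.psum j = v.psum j) ∧ u.psum i ≠ v.psum i) ↔
      (∀ k, k ≠ i + 1 → prefixSet π.1 k = prefixSet σ.1 k) ∧
        prefixSet π.1 (i + 1) ≠ prefixSet σ.1 (i + 1) := by
    rw [Ne, Ne, hu.prefixSet_eq_iff hv hn (by omega)]
    refine and_congr_left fun _ => ⟨fun h k hk => ?_, fun h j hj hji => ?_⟩
    · rcases k with _ | k
      · rw [prefixSet_zero, prefixSet_zero]
      · rcases le_or_gt k (n - 2) with h' | h'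
        · exact (hu.prefixSet_eq_iff hv hn h').2 (h k h' (by omega))
        · rw [prefixSet_of_le _ (by omega), prefixSet_of_le _ (by omega)]
    · exact (hu.prefixSet_eq_iff hv hn hj).1 (h (j + 1) (by omega))
  rw [e]
  constructor
  · intro h
    have h' : σ.1 = π.1 * Equiv.swap ⟨i, Nat.lt_of_succ_lt hi⟩ ⟨i + 1, hi⟩ := by
      rw [h, mul_assoc, Equiv.swap_mul_self, mul_one]
    have hsub : ∀ (α β : ArcPerm n), ArcSwap i hi α β → ∀ k, k ≠ i + 1 →
        prefixSet α.1 k ⊆ prefixSet β.1 k := by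
      rintro α β h k hk x ⟨j, hj, rfl⟩
      refine ⟨Equiv.swap ⟨i, Nat.lt_of_succ_lt hi⟩ ⟨i + 1, hi⟩ j, ?_, by
        rw [h, Equiv.Perm.mul_apply]⟩
      rw [Equiv.swap_apply_def]
      split_ifs with h1 h2
      · rw [h1] at hj; simp only at hj ⊢; omega
      · rw [h2] at hj; simp only at hj ⊢; omega
      · exact hj
    refine ⟨fun k hk => (hsub π σ h k hk).antisymm (hsub σ π h' k hk), fun heq => ?_⟩
    have h1 : letter (π.1 ⟨i, by omega⟩) ∈ prefixSet σ.1 (i + 1) := by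
      rw [← heq, letter_mem_prefixSet]; simp
    rw [h, Equiv.Perm.mul_apply, Equiv.swap_apply_left, letter_mem_prefixSet] at h1
    simp at h1
  · rintro ⟨h1, h2⟩
    have hne : ∀ j : Fin n, j.val ≠ i → j.val ≠ i + 1 → π.1 j = σ.1 j := fun j hj hj' =>
      letter_eq_of_prefixSet_eq (h1 _ hj') (h1 _ (by omega))
    have hmem : ∀ j : Fin n, j.val = i ∨ j.val = i + 1 →
        π.1 j = σ.1 ⟨i, by omega⟩ ∨ π.1 j = σ.1 ⟨i + 1, hi⟩ := by
      intro j hj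
      obtain ⟨q, hq⟩ := σ.1.surjective (π.1 j)
      have h3 : letter (σ.1 q) ∈ prefixSet σ.1 (i + 2) := by
        rw [hq, ← h1 _ (by omega), letter_mem_prefixSet]; omega
      have h4 : letter (σ.1 q) ∉ prefixSet σ.1 i := by
        rw [hq, ← h1 _ (by omega), letter_mem_prefixSet]; omega
      rw [letter_mem_prefixSet] at h3 h4
      rcases (by omega : q.val = i ∨ q.val = i + 1) with h | h
      · left; rw [← hq]; congr 1; exact Fin.ext h
      · right; rw [← hq]; congr 1; exact Fin.ext h
    have hi1 : π.1 ⟨i, by omega⟩ = σ.1 ⟨i + 1, hi⟩ := by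
      refine (hmem ⟨i, by omega⟩ (.inl rfl)).resolve_left fun heq => h2 ?_
      have hsucc : ∀ α : ArcPerm n, ∀ x, x ∈ prefixSet α.1 (i + 1) ↔
          x ∈ prefixSet α.1 i ∨ x = letter (α.1 ⟨i, by omega⟩) := by
        intro α x
        constructor
        · rintro ⟨j, hj, rfl⟩
          rcases (by omega : j.val < i ∨ j.val = i) with h | h
          · exact .inl ⟨j, h, rfl⟩
          · right; congr 2; exact Fin.ext h
        · rintro (⟨j, hj, rfl⟩ | rfl)
          · exact ⟨j, by omega, rfl⟩
          · exact ⟨_, by simp, rfl⟩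
      ext x
      rw [hsucc, hsucc, heq, h1 i (by omega)]
    have hi2 : π.1 ⟨i + 1, hi⟩ = σ.1 ⟨i, by omega⟩ := by
      refine (hmem ⟨i + 1, hi⟩ (.inr rfl)).resolve_right fun heq => ?_
      rw [← hi1] at heq
      simpa using π.1.injective heq
    refine Equiv.ext fun j => ?_
    rw [Equiv.Perm.mul_apply, Equiv.swap_apply_def]
    split_ifs with h3 h4
    · rw [h3]; exact hi1
    · rw [h4]; exact hi2
    · exact hne j (fun h => h3 (Fin.ext h)) (fun h => h4 (Fin.ext h))

lemma arcCode_of_arcRel (hn : 2 ≤ n) {π : ArcPerm n} {v : YokeVertex n (n - 2)}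
    (h : ArcRel π v) : ArcCode π v := by
  have : NeZero n := ⟨by omega⟩
  refine ⟨fun p hp => ?_, fun i p hi hi' hp => ?_⟩
  · have h1 : letter (π.1 p) ∈ prefixSet π.1 1 := letter_mem_prefixSet.2 (by omega)
    have h0 := h 0 (by omega)
    rw [zero_add] at h0
    rw [h0] at h1
    obtain ⟨d, hd, h1⟩ := h1
    obtain rfl : d = 0 := by omega
    rw [letter, psum_zero, Nat.cast_zero, sub_zero, add_left_inj,
      natCast_eq_iff_of_lt (π.1 p).2 (v.2.1 0 (.inl rfl))] at h1
    exact h1.symm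
  · obtain ⟨⟨i, hi2⟩, rfl⟩ : ∃ j : Fin (n - 2 + 2), j = i := ⟨i, rfl⟩
    simp only at hi hi' hp ⊢
    obtain ⟨i, rfl⟩ : ∃ k, i = k + 1 := ⟨i - 1, by omega⟩
    have h1 : letter (π.1 p) ∈ prefixSet π.1 (i + 1 + 1) := letter_mem_prefixSet.2 (by omega)
    have h2 : letter (π.1 p) ∉ prefixSet π.1 (i + 1) := by rw [letter_mem_prefixSet]; omega
    rw [h (i + 1) hi'] at h1
    rw [h i (by omega)] at h2 ⊢
    obtain ⟨d, hd, h1⟩ := h1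
    rcases psum_step v i hi2 (by omega) with ⟨e, hs⟩ | ⟨e, hs⟩ <;> rw [hs] at h1 <;> rw [h1] at h2 ⊢
    · right
      refine ⟨⟨i, by omega, ?_⟩, e⟩
      -- For a step `0` any other `d` would put the letter into the old arc, so the new letter is
      -- the lower end. For a step `1` it is the upper end `d = 0`.
      obtain rfl : d = i + 1 := by
        by_contra hne
        exact h2 ⟨d, by omega, rfl⟩
      push_cast; ring
    · left
      refine ⟨⟨0, by omega, ?_⟩, e⟩
      obtain rfl : d = 0 := by
        by_contra hne
        obtain ⟨c, rfl⟩ : ∃ c, d = c + 1 := ⟨d - 1, by omega⟩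
        exact h2 ⟨c, by omega, by push_cast; ring⟩
      push_cast; ring

lemma yokeTight_arc (hn : 2 ≤ n) : YokeTight n (n - 2) := ⟨hn, by omega⟩

theorem exists_arcGraph_iso (hn : 2 ≤ n) : ∃ f : arcGraph n ≃g yokeGraph n (n - 2),
    (∀ π : ArcPerm n, ArcCode π (f π)) ∧
      ∀ (π σ : ArcPerm n) (i : ℕ) (hi : i + 1 < n) (j : Fin (n - 2 + 1)), i = j.val →
        (ArcSwap i hi π σ ↔ YokeShift j (f π) (f σ)) := by
  have : NeZero n := ⟨by omega⟩
  obtain ⟨f, hf⟩ := exists_equiv_of_rel (ArcRel (n := n)) (exists_arcRel_right hn)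
    (exists_arcRel_left hn)
    (by
      intro π σ v h h'
      refine Subtype.ext (Equiv.ext fun p => letter_eq_of_prefixSet_eq ?_ ?_)
      · rcases Nat.eq_zero_or_pos p.val with h0 | h0
        · rw [h0, prefixSet_zero, prefixSet_zero]
        · obtain ⟨k, hk⟩ : ∃ k, p.val = k + 1 := ⟨p.val - 1, by omega⟩
          rw [hk]
          exact (h.prefixSet_eq_iff h' hn (by omega)).2 rfl
      · rcases le_or_gt p.val (n - 2) with h0 | h0
        · exact (h.prefixSet_eq_iff h' hn h0).2 rfl
        · rw [prefixSet_of_le _ (by omega), prefixSet_of_le _ (by omega)])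
    (fun π u v h h' => yokeVertex_ext_psum hn fun i hi => (h.prefixSet_eq_iff h' hn hi).1 rfl)
  have key : ∀ (π σ : ArcPerm n) (i : ℕ) (hi : i + 1 < n) (j : Fin (n - 2 + 1)), i = j.val →
      (ArcSwap i hi π σ ↔ YokeShift j (f π) (f σ)) := by
    rintro π σ i hi j rfl
    rw [arcSwap_iff hn (hf π) (hf σ), yokeShift_iff (yokeTight_arc hn)]
  refine ⟨⟨f, ?_⟩, fun π => arcCode_of_arcRel hn (hf π), key⟩
  intro π σ
  rw [yokeGraph_adj_iff (yokeTight_arc hn), arcGraph, SimpleGraph.fromRel_adj]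
  constructor
  · rintro ⟨i, h⟩
    refine ⟨?_, .inl ⟨i, by omega, (key π σ i (by omega) i rfl).2 h⟩⟩
    rintro rfl
    rw [yokeShift_iff (yokeTight_arc hn)] at h
    exact h.2 rfl
  · rintro ⟨-, ⟨i, hi, h⟩ | ⟨i, hi, h⟩⟩
    · exact ⟨⟨i, by omega⟩, (key π σ i hi _ rfl).1 h⟩
    · exact ⟨⟨i, by omega⟩, yokeShift_symm (yokeTight_arc hn) ((key σ π i hi ⟨i, by omega⟩ rfl).1 h)⟩

end ArcPermutations

/-! ### Snake triangulations -/

/-- The chord that joins the vertices next to the arc `{r_i - i, …, r_i}`. -/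
def arcChord {n : ℕ} (r : ℕ → ZMod n) (i : ℕ) : Sym2 (ZMod n) := s(r i - i - 1, r i + 1)

/-! ### Sides, diagonals and arcs in integer coordinates. -/

section Sides
variable {n : ℕ}

lemma isSide_of_eq {x y : ZMod n} (h : y = x + 1 ∨ x = y + 1) : IsSide s(x, y) := by
  rcases h with rfl | rfl
  · exact ⟨x, rfl⟩
  · exact ⟨y, Sym2.eq_swap⟩

lemma isSide_iff {x y : ZMod n} : IsSide s(x, y) ↔ y = x + 1 ∨ x = y + 1 := by
  refine ⟨?_, isSide_of_eq⟩
  rintro ⟨a, h⟩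
  rw [Sym2.eq_iff] at h
  rcases h with ⟨rfl, rfl⟩ | ⟨rfl, rfl⟩
  · exact .inl rfl
  · exact .inr rfl

lemma isSide_intCast_iff {x y : ℤ} (h : x < y) (h' : y < x + n) :
    IsSide s((x : ZMod n), (y : ZMod n)) ↔ y = x + 1 ∨ y = x + n - 1 := by
  rw [isSide_iff]
  have h1 : ((y : ZMod n) = x + 1) ↔ y = x + 1 := by
    rw [← intCast_eq_iff (n := n) (x := y) (y := x + 1) (by omega) (by omega)]; push_cast; rfl
  have h2 : ((x : ZMod n) = y + 1) ↔ x = y + 1 - n := by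
    rw [← intCast_eq_iff (n := n) (x := x) (y := y + 1 - n) (by omega) (by omega)]
    push_cast; rw [ZMod.natCast_self, sub_zero]
  rw [h1, h2]; omega

lemma isDiagonal_intCast_iff {x y : ℤ} (h : x < y) (h' : y < x + n) :
    IsDiagonal s((x : ZMod n), (y : ZMod n)) ↔ y ≠ x + 1 ∧ y ≠ x + n - 1 := by
  rw [IsDiagonal, isSide_intCast_iff h h', Sym2.mk_isDiag_iff, intCast_eq_iff (by omega) (by omega)]
  omega

lemma ne_of_isSide (hn : 2 ≤ n) {x y : ZMod n} (h : IsSide s(x, y)) : x ≠ y := by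
  rintro rfl
  rw [isSide_iff] at h
  exact zmod_one_ne_zero hn (by simpa using h)

lemma arcChord_eq {r : ℕ → ZMod n} {i : ℕ} {y : ℤ} (h : r i = (y : ZMod n)) :
    arcChord r i = s(((y - i - 1 : ℤ) : ZMod n), ((y + 1 : ℤ) : ZMod n)) := by
  rw [arcChord, h]; push_cast; rfl

/-- The end is written `y + 1` because the chord of index `i` with `r i = y` cuts off the closed
piece `{y - i - 1, …, y + 1}`, which is `arcSet (r i + 1) (i + 3)`. -/
lemma exists_int_of_mem_arcSet {x : ZMod n} {y : ℤ} {k : ℕ}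
    (h : x ∈ arcSet ((y : ZMod n) + 1) k) : ∃ w : ℤ, y + 1 - k < w ∧ w ≤ y + 1 ∧ x = (w : ZMod n) := by
  obtain ⟨d, hd, rfl⟩ := h
  exact ⟨y + 1 - d, by omega, by omega, by push_cast; rfl⟩

lemma mem_arcSet_of_int {w y : ℤ} {k : ℕ} (h : y + 1 - k < w) (h' : w ≤ y + 1) :
    (w : ZMod n) ∈ arcSet ((y : ZMod n) + 1) k := by
  refine ⟨(y + 1 - w).toNat, by omega, ?_⟩
  have : (((y + 1 - w).toNat : ℤ) : ZMod n) = ((y + 1 - w : ℤ) : ZMod n) := by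
    rw [Int.toNat_of_nonneg (by omega)]
  rw [Int.cast_natCast] at this
  rw [this]; push_cast; ring

end Sides

/-! ### The chords of a growing sequence form a triangle-free triangulation. -/

section Snake
variable {n : ℕ} [NeZero n]

lemma exists_int_coordinate (x : ZMod n) : ∃ y : ℤ, (y : ZMod n) = x :=
  ⟨x.val, by push_cast; exact ZMod.natCast_zmod_val x⟩

/-- Integer coordinates for two arcs of a growing sequence. -/
lemma IsStepSeq.exists_int {r : ℕ → ZMod n} (hr : IsStepSeq r) {i j : ℕ} (hij : i ≤ j) :
    ∃ (y : ℤ) (e : ℕ), e ≤ j - i ∧ r i = (y : ZMod n) ∧ r j = ((y + e : ℤ) : ZMod n) := by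
  obtain ⟨y, hy⟩ := exists_int_coordinate (r i)
  obtain ⟨e, he, h⟩ := hr.exists_add i (j - i)
  refine ⟨y, e, he, hy.symm, ?_⟩
  rw [show j = i + (j - i) by omega, h, ← hy]; push_cast; rfl

/-- In integer coordinates the closed pieces are nested intervals `[y - i - 1, y + 1] ⊆ [y + e - j -
1, y + e + 1]` with `e ≤ j - i`, within a window of `n` integers. -/
lemma not_crosses_arcChord {r : ℕ → ZMod n} (hr : IsStepSeq r) {i j : ℕ} (hi : i + 3 ≤ n)
    (hj : j + 3 ≤ n) : ¬ Crosses (arcChord r i) (arcChord r j) := by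
  rcases le_total i j with hij | hij <;> obtain ⟨y, e, he, h1, h2⟩ := hr.exists_int hij <;>
    rw [arcChord_eq h1, arcChord_eq h2]
  · rw [crosses_intCast_iff (b := y + e - j - 1) (by omega) (by omega) (by omega) (by omega)
      (by omega) (by omega)]
    omega
  · rw [crosses_intCast_iff (b := y + e - i - 1) (by omega) (by omega) (by omega) (by omega)
      (by omega) (by omega)]
    omega

lemma arcChord_injective {r : ℕ → ZMod n} (hr : IsStepSeq r) {i j : ℕ} (hi : i + 3 ≤ n)
    (hj : j + 3 ≤ n) (h : arcChord r i = arcChord r j) : i = j := by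
  rcases le_total i j with hij | hij <;> obtain ⟨y, e, he, h1, h2⟩ := hr.exists_int hij <;>
    rw [arcChord_eq h1, arcChord_eq h2, Sym2.eq_iff, intCast_eq_iff (by omega) (by omega),
      intCast_eq_iff (by omega) (by omega), intCast_eq_iff (by omega) (by omega),
      intCast_eq_iff (by omega) (by omega)] at h <;> omega

lemma isDiagonal_arcChord (r : ℕ → ZMod n) {i : ℕ} (hi : i + 4 ≤ n) :
    IsDiagonal (arcChord r i) := by
  obtain ⟨y, hy⟩ := exists_int_coordinate (r i)
  rw [arcChord_eq hy.symm, isDiagonal_intCast_iff (by omega) (by omega)]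
  omega

lemma mem_arcSet_of_mem_arcChord {r : ℕ → ZMod n} (hr : IsStepSeq r) {i j : ℕ} (hij : i ≤ j)
    {x : ZMod n} (h : x ∈ arcChord r i) : x ∈ arcSet (r j + 1) (j + 3) := by
  obtain ⟨y, e, he, h1, h2⟩ := hr.exists_int hij
  rw [arcChord_eq h1, Sym2.mem_iff] at h
  rw [h2]
  rcases h with rfl | rfl <;> exact mem_arcSet_of_int (by omega) (by omega)

/-- A later chord has an endpoint outside each earlier closed piece, since its arc has grown at one
of the ends. -/
lemma not_mem_arcSet_of_arcChord_eq {r : ℕ → ZMod n} (hr : IsStepSeq r) {i j : ℕ} (hij : i < j)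
    (hj : j + 4 ≤ n) {a c : ZMod n} (h : arcChord r j = s(a, c))
    (ha : a ∈ arcSet (r i + 1) (i + 3)) (hc : c ∈ arcSet (r i + 1) (i + 3)) : False := by
  obtain ⟨y, e, he, h1, h2⟩ := hr.exists_int hij.le
  rw [h1] at ha hc
  obtain ⟨a, ha1, ha2, rfl⟩ := exists_int_of_mem_arcSet ha
  obtain ⟨c, hc1, hc2, rfl⟩ := exists_int_of_mem_arcSet hc
  rw [arcChord_eq h2, Sym2.eq_iff, intCast_eq_iff (by omega) (by omega),
      intCast_eq_iff (by omega) (by omega), intCast_eq_iff (by omega) (by omega),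
      intCast_eq_iff (by omega) (by omega)] at h
  omega

/-- Induction on the closed pieces, each with one vertex more than the previous one. A diagonal from
the new vertex into the old piece must end at an endpoint of the chord of index `i`, or it would
cross it. One endpoint is joined to the new vertex by a side; the other gives the chord of index `i
+ 1`. -/
lemma exists_arcChord_eq_of_not_crosses (hn : 4 ≤ n) {r : ℕ → ZMod n} (hr : IsStepSeq r) {i : ℕ}
    (hi : i + 3 ≤ n) {x w : ZMod n} (hx : x ∈ arcSet (r i + 1) (i + 3))
    (hw : w ∈ arcSet (r i + 1) (i + 3)) (hd : IsDiagonal s(x, w))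
    (hc : ∀ j, j + 4 ≤ n → ¬ Crosses (arcChord r j) s(x, w)) :
    ∃ j, j + 4 ≤ n ∧ arcChord r j = s(x, w) := by
  induction i with
  | zero =>
    obtain ⟨y, hy⟩ := exists_int_coordinate (r 0)
    rw [← hy] at hx hw
    obtain ⟨x, hx1, hx2, rfl⟩ := exists_int_of_mem_arcSet hx
    obtain ⟨w, hw1, hw2, rfl⟩ := exists_int_of_mem_arcSet hw
    refine ⟨0, by omega, ?_⟩
    rw [arcChord_eq hy.symm]
    rcases lt_trichotomy x w with h | rfl | h
    · rw [isDiagonal_intCast_iff h (by omega)] at hd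
      rw [show x = y - (0 : ℕ) - 1 by omega, show w = y + 1 by omega]
    · exact absurd rfl hd.1
    · rw [Sym2.eq_swap (a := (x : ZMod n)), isDiagonal_intCast_iff h (by omega)] at hd
      rw [show w = y - (0 : ℕ) - 1 by omega, show x = y + 1 by omega, Sym2.eq_swap]
  | succ i ih =>
    -- Here `x` is the new vertex and `w` an old one. At the last stage, `i + 1 = n - 3`, the
    -- candidate is a side, so being a diagonal bounds the index.
    have main : ∀ x w : ZMod n, x ∈ arcSet (r (i + 1) + 1) (i + 1 + 3) →
        w ∈ arcSet (r i + 1) (i + 3) → x ∉ arcSet (r i + 1) (i + 3) → IsDiagonal s(x, w) →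
        (∀ j, j + 4 ≤ n → ¬ Crosses (arcChord r j) s(x, w)) →
        ∃ j, j + 4 ≤ n ∧ arcChord r j = s(x, w) := by
      intro x w hx hw hxn hd hc
      obtain ⟨y, e, he, h1, h2⟩ := hr.exists_int (Nat.le_succ i)
      have hci := hc i (by omega)
      rw [arcChord_eq h1] at hci
      rw [h1] at hw hxn
      rw [h2] at hx
      obtain ⟨x, hx1, hx2, rfl⟩ := exists_int_of_mem_arcSet hx
      obtain ⟨w, hw1, hw2, rfl⟩ := exists_int_of_mem_arcSet hw
      have hx3 : ¬ (y + 1 - (i + 3 : ℕ) < x ∧ x ≤ y + 1) := fun h =>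
        hxn (mem_arcSet_of_int h.1 h.2)
      rcases (by omega : e = 0 ∨ e = 1) with rfl | rfl
      · rw [crosses_intCast_iff (b := y - i - 2) (by omega) (by omega) (by omega) (by omega)
          (by omega) (by omega)] at hci
        rw [isDiagonal_intCast_iff (by omega) (by omega)] at hd
        refine ⟨i + 1, by omega, ?_⟩
        rw [arcChord_eq h2, show x = y + (0 : ℕ) - (i + 1 : ℕ) - 1 by omega,
          show w = y + (0 : ℕ) + 1 by omega]
      · rw [Sym2.eq_swap (a := (x : ZMod n)), crosses_intCast_iff (b := y - i - 1) (by omega) (by omega) (by omega)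
          (by omega) (by omega) (by omega)] at hci
        rw [Sym2.eq_swap (a := (x : ZMod n)), isDiagonal_intCast_iff (by omega) (by omega)] at hd
        refine ⟨i + 1, by omega, ?_⟩
        rw [arcChord_eq h2, Sym2.eq_swap (a := (x : ZMod n)), show w = y + (1 : ℕ) - (i + 1 : ℕ) - 1 by omega,
          show x = y + (1 : ℕ) + 1 by omega]
    by_cases hx' : x ∈ arcSet (r i + 1) (i + 3) <;> by_cases hw' : w ∈ arcSet (r i + 1) (i + 3)
    · exact ih (by omega) hx' hw'
    · rw [Sym2.eq_swap] at hd hc ⊢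
      exact main w x hw hx' hw' hd hc
    · exact main x w hx hw' hx' hd hc
    -- Only one vertex is new, so the two endpoints would coincide.
    · exfalso
      apply hd.1
      obtain ⟨y, e, he, h1, h2⟩ := hr.exists_int (Nat.le_succ i)
      rw [h2] at hx hw
      rw [h1] at hx' hw'
      obtain ⟨x, hx1, hx2, rfl⟩ := exists_int_of_mem_arcSet hx
      obtain ⟨w, hw1, hw2, rfl⟩ := exists_int_of_mem_arcSet hw
      have hx3 : ¬ (y + 1 - (i + 3 : ℕ) < x ∧ x ≤ y + 1) := fun h =>
        hx' (mem_arcSet_of_int h.1 h.2)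
      have hw3 : ¬ (y + 1 - (i + 3 : ℕ) < w ∧ w ≤ y + 1) := fun h =>
        hw' (mem_arcSet_of_int h.1 h.2)
      rw [Sym2.mk_isDiag_iff, show x = w by omega]

/-- The chords of a growing sequence of arcs form a triangulation. -/
lemma isTriangulation_arcChord {r : ℕ → ZMod n} (hr : IsStepSeq r) (hn : 4 ≤ n) :
    IsTriangulation (Set.range fun i : Fin (n - 3) => arcChord r i) := by
  refine ⟨⟨?_, ?_⟩, ?_⟩
  · rintro _ ⟨i, rfl⟩
    exact isDiagonal_arcChord r (by omega)
  · rintro _ ⟨i, rfl⟩ _ ⟨j, rfl⟩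
    exact not_crosses_arcChord hr (by omega) (by omega)
  · rintro S ⟨hS1, hS2⟩ hTS e he
    induction e using Sym2.inductionOn with
    | hf x w =>
      -- The closed piece of index `n - 3` is the whole polygon.
      have huniv : arcSet (r (n - 3) + 1) (n - 3 + 3) = Set.univ := arcSet_eq_univ _ (by omega)
      obtain ⟨j, hj, h⟩ := exists_arcChord_eq_of_not_crosses hn hr (i := n - 3) (by omega)
        (huniv ▸ Set.mem_univ x) (huniv ▸ Set.mem_univ w) (hS1 _ he) fun j hj =>
          hS2 _ (hTS ⟨⟨j, by omega⟩, rfl⟩) _ he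
      exact ⟨⟨j, by omega⟩, h⟩

/-- Of three chords forming a triangle, the one of largest index has its endpoints on the other two,
hence in an earlier closed piece. Equal indices would make one of the chords degenerate. -/
lemma isTriangleFree_arcChord {r : ℕ → ZMod n} (hr : IsStepSeq r) :
    IsTriangleFree (Set.range fun i : Fin (n - 3) => arcChord r i) := by
  rintro ⟨a, b, c, ⟨i, hi⟩, ⟨j, hj⟩, ⟨l, hl⟩⟩
  simp only at hi hj hl
  have hi4 : i.val + 4 ≤ n := by omega
  have hj4 : j.val + 4 ≤ n := by omega
  have hl4 : l.val + 4 ≤ n := by omega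
  have key : ∀ (i j l : ℕ) (a b c : ZMod n), i < l → j < l → l + 4 ≤ n →
      arcChord r i = s(a, b) → arcChord r j = s(b, c) → arcChord r l = s(a, c) → False := by
    intro i j l a b c hil hjl hl4 hi hj hl
    refine not_mem_arcSet_of_arcChord_eq hr (i := max i j) (by omega) hl4 hl
      (mem_arcSet_of_mem_arcChord hr (le_max_left i j) ?_)
      (mem_arcSet_of_mem_arcChord hr (le_max_right i j) ?_)
    · rw [hi]; exact Sym2.mem_mk_left a b
    · rw [hj]; exact Sym2.mem_mk_right b c
  have dist : ∀ (i j l : ℕ) (a b c : ZMod n), l + 4 ≤ n →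
      arcChord r i = s(a, b) → arcChord r j = s(b, c) → arcChord r l = s(a, c) → i ≠ j := by
    rintro i j l a b c hl4 hi hj hl rfl
    rw [hi, Sym2.eq_iff] at hj
    have h := (isDiagonal_arcChord r hl4).1
    rw [hl, Sym2.mk_isDiag_iff] at h
    rcases hj with ⟨rfl, rfl⟩ | ⟨h', -⟩
    · exact h rfl
    · exact h h'
  have d1 := dist i j l a b c hl4 hi hj hl
  have d2 := dist j l i b c a hi4 hj (hl.trans Sym2.eq_swap) (hi.trans Sym2.eq_swap)
  have d3 := dist i l j b a c hj4 (hi.trans Sym2.eq_swap) hl hj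
  rcases (by omega : i.val < l ∧ j.val < l ∨ i.val < j ∧ l.val < j ∨ j.val < i ∧ l.val < i)
    with h | h | h
  · exact key i j l a b c h.1 h.2 hl4 hi hj hl
  · exact key i l j b a c h.1 h.2 hj4 (hi.trans Sym2.eq_swap) hl hj
  · exact key l j i a c b h.2 h.1 hi4 hl (hj.trans Sym2.eq_swap) hi

end Snake

/-! ### Colored triangle-free triangulations -/

section Triangulations
variable {n : ℕ}

/-- The chords of `C` are those next to the arcs that end at the partial sums of `v`. -/
def CTFTRel (C : CTFT n) (v : YokeVertex n (n - 4)) : Prop :=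
  ∀ i : Fin (n - 3), C.chord i = arcChord v.psum i

lemma sym2_mk_congr {a a' b b' : ZMod n} (ha : a = a') (hb : b = b') : s(a, b) = s(a', b') := by
  rw [ha, hb]

lemma arcChord_congr {r r' : ℕ → ZMod n} {i : ℕ} (h : r i = r' i) :
    arcChord r i = arcChord r' i := by
  rw [arcChord, arcChord, h]

lemma natCast_ne_zero_of_lt {k : ℕ} (h0 : 0 < k) (hk : k < n) : (k : ZMod n) ≠ 0 := by
  rw [Ne, ZMod.natCast_eq_zero_iff]
  intro h
  exact absurd (Nat.le_of_dvd h0 h) (by omega)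

/-- A chord could also be read from its other side, with endpoints exchanged. For values at most one
apart this would force `i + 1` or `i + 3` to vanish in `ℤ/n`. -/
lemma eq_of_arcChord_eq {r r' : ℕ → ZMod n} {i : ℕ} (hi : i + 4 ≤ n)
    (hd : r i = r' i ∨ r i = r' i + 1 ∨ r' i = r i + 1) (h : arcChord r i = arcChord r' i) :
    r i = r' i := by
  rw [arcChord, arcChord, Sym2.eq_iff] at h
  rcases h with ⟨-, h⟩ | ⟨h, -⟩
  · exact add_right_cancel h
  · rcases hd with hd | hd | hd
    · exact hd
    · refine absurd ?_ (natCast_ne_zero_of_lt (n := n) (k := i + 1) (by omega) (by omega))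
      push_cast; linear_combination hd - h
    · refine absurd ?_ (natCast_ne_zero_of_lt (n := n) (k := i + 3) (by omega) (by omega))
      push_cast; linear_combination -h - hd

/-- For a short chord, exchanging the endpoints forces `4 = 0` in `ℤ/n`. This uses `n ≥ 5`: a
diagonal of a quadrilateral is short on both sides. -/
lemma eq_of_arcChord_eq_of_short (hn : 5 ≤ n) {r r' : ℕ → ZMod n} {i : ℕ} (hi : i = 0 ∨ i + 4 = n)
    (h : arcChord r i = arcChord r' i) : r i = r' i := by
  have h4 := natCast_ne_zero_of_lt (n := n) (k := 4) (by omega) (by omega)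
  push_cast at h4
  rw [arcChord, arcChord, Sym2.eq_iff] at h
  rcases h with ⟨-, h⟩ | ⟨h, h'⟩
  · exact add_right_cancel h
  · refine absurd ?_ h4
    rcases hi with rfl | hi
    · push_cast at h h'; linear_combination h' - h
    · have : (i : ZMod n) + 4 = 0 := by
        rw [← ZMod.natCast_self n, ← hi]; push_cast; rfl
      linear_combination 2 * this - h' + h

lemma psum_step' {m : ℕ} (v : YokeVertex n m) {i : ℕ} (h : i < m) :
    v.psum (i + 1) = v.psum i ∨ v.psum (i + 1) = v.psum i + 1 :=
  (psum_step v i (by omega) h).imp And.right And.right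

lemma diff_of_steps {a b c d : ZMod n} (h : a = b) (h₁ : c = a ∨ c = a + 1)
    (h₂ : d = b ∨ d = b + 1) : c = d ∨ c = d + 1 ∨ d = c + 1 := by
  subst h
  rcases h₁ with rfl | rfl <;> rcases h₂ with rfl | rfl <;> simp

lemma diff_of_steps' {a b c d : ZMod n} (h : c = d) (h₁ : c = a ∨ c = a + 1)
    (h₂ : d = b ∨ d = b + 1) : a = b ∨ a = b + 1 ∨ b = a + 1 := by
  subst h
  rcases h₁ with rfl | rfl <;> rcases h₂ with h | h
  · exact .inl h
  · exact .inr (.inl h)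
  · exact .inr (.inr h.symm)
  · exact .inl (add_right_cancel h)

lemma psum_eq_of_arcChord_eq_upward (hn : 5 ≤ n) {u v : YokeVertex n (n - 4)} {k : ℕ}
    (hk : k + 4 ≤ n) (h : ∀ j ≤ k, arcChord u.psum j = arcChord v.psum j) :
    u.psum k = v.psum k := by
  induction k with
  | zero => exact eq_of_arcChord_eq_of_short hn (.inl rfl) (h 0 le_rfl)
  | succ k ih =>
    exact eq_of_arcChord_eq hk (diff_of_steps (ih (by omega) fun j hj => h j (by omega))
      (psum_step' u (by omega)) (psum_step' v (by omega))) (h _ le_rfl)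

/-- Propagation from the last short chord, as `psum_eq_of_arcChord_eq_upward` propagates from the
first. Both are needed for a flip, which leaves the chords on either side of one label unchanged. -/
lemma psum_eq_of_arcChord_eq_downward (hn : 5 ≤ n) {u v : YokeVertex n (n - 4)} {d k : ℕ}
    (hk : d + k + 4 = n) (h : ∀ j, k ≤ j → j + 4 ≤ n → arcChord u.psum j = arcChord v.psum j) :
    u.psum k = v.psum k := by
  induction d generalizing k with
  | zero => exact eq_of_arcChord_eq_of_short hn (.inr (by omega)) (h k le_rfl (by omega))
  | succ d ih =>
    exact eq_of_arcChord_eq (by omega) (diff_of_steps' (ih (k := k + 1) (by omega) fun j hj => h j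
      (by omega)) (psum_step' u (by omega)) (psum_step' v (by omega))) (h k le_rfl (by omega))

lemma arcChord_zero_isShort (r : ℕ → ZMod n) : IsShort (arcChord r 0) :=
  ⟨r 0, by rw [arcChord]; push_cast; rw [sub_zero]⟩

lemma natCast_eq_neg_of_add_eq {i k : ℕ} (h : i + k = n) : (i : ZMod n) = -(k : ZMod n) := by
  rw [eq_neg_iff_add_eq_zero, ← Nat.cast_add, h, ZMod.natCast_self]

lemma arcChord_last_isShort (r : ℕ → ZMod n) {i : ℕ} (hi : i + 4 = n) : IsShort (arcChord r i) :=
  ⟨r i + 2, by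
    rw [arcChord, natCast_eq_neg_of_add_eq hi, Sym2.eq_swap]; push_cast; exact sym2_mk_congr (by ring) (by ring)⟩

/-- The triangulation with the chords `arcChord r i`. -/
def ctftOfStepSeq [NeZero n] (hn : 4 ≤ n) (r : ℕ → ZMod n) (hr : IsStepSeq r) : CTFT n where
  chord i := arcChord r i
  injective i j h := Fin.ext (arcChord_injective hr (by omega) (by omega) h)
  triangulation := isTriangulation_arcChord hr hn
  triangleFree := isTriangleFree_arcChord hr
  short_first i hi := by rw [hi]; exact arcChord_zero_isShort r
  short_last i hi := arcChord_last_isShort r (by omega)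
  consecutive := by
    rintro ⟨i, hi⟩ ⟨j, hj⟩ hij
    simp only at hij
    subst hij
    have m1 : arcChord r i ∈ Set.range fun i : Fin (n - 3) => arcChord r i := ⟨⟨i, hi⟩, rfl⟩
    have m2 : arcChord r (i + 1) ∈ Set.range fun i : Fin (n - 3) => arcChord r i :=
      ⟨⟨i + 1, hj⟩, rfl⟩
    -- Two consecutive chords share an endpoint, and their other endpoints are joined by a side.
    rcases hr i with h | h
    · have e1 : arcChord r i = s(r i - i - 1, r i + 1) := rfl
      have e2 : arcChord r (i + 1) = s(r i + 1, r i - i - 2) := by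
        rw [arcChord, h, Sym2.eq_swap]; push_cast; exact sym2_mk_congr (by ring) (by ring)
      refine ⟨r i - i - 1, r i + 1, r i - i - 2, ⟨.inl (e1 ▸ m1), .inl (e2 ▸ m2), .inr ?_⟩, e1, e2⟩
      exact isSide_of_eq (.inr (by ring))
    · have e1 : arcChord r i = s(r i + 1, r i - i - 1) := Sym2.eq_swap
      have e2 : arcChord r (i + 1) = s(r i - i - 1, r i + 2) := by
        rw [arcChord, h]; push_cast; exact sym2_mk_congr (by ring) (by ring)
      refine ⟨r i + 1, r i - i - 1, r i + 2, ⟨.inl (e1 ▸ m1), .inl (e2 ▸ m2), .inr ?_⟩, e1, e2⟩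
      exact isSide_of_eq (.inl (by ring))

lemma exists_ctftRel_left (hn : 5 ≤ n) (v : YokeVertex n (n - 4)) : ∃ C, CTFTRel C v := by
  have : NeZero n := ⟨by omega⟩
  refine ⟨ctftOfStepSeq (by omega) _ (isStepSeq_psum v), fun i => ?_⟩
  exact arcChord_congr (r := fun i => v.psum (min i (n - 4)))
    (congrArg v.psum (min_eq_left (show i.val ≤ n - 4 by omega)))

/-- In a triangle-free triangulation the common triangle of consecutive chords has a side of the
polygon as its third side. -/
lemma CTFT.exists_side (C : CTFT n) {i j : Fin (n - 3)} (hij : i.val + 1 = j.val) :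
    ∃ a b c : ZMod n, C.chord i = s(a, b) ∧ C.chord j = s(b, c) ∧ (c = a + 1 ∨ c = a - 1) := by
  obtain ⟨a, b, c, ⟨h1, h2, h3⟩, hi, hj⟩ := C.consecutive i j hij
  refine ⟨a, b, c, hi, hj, ?_⟩
  rcases h3 with h3 | h3
  · exact absurd ⟨a, b, c, hi ▸ ⟨i, rfl⟩, hj ▸ ⟨j, rfl⟩, h3⟩ C.triangleFree
  · rcases isSide_iff.1 h3 with h | h
    · exact .inl h
    · right; rw [h]; ring

/-- The next chord arises by moving one endpoint of the chord of index `k` along a side, which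
leaves four candidates. Two enlarge the arc at either end. The two that shrink it give a side if `k
= 0`; otherwise each either repeats or crosses the chord of index `k - 1`, depending on the last
step. -/
lemma CTFT.chord_succ (C : CTFT n) {r : ℕ → ZMod n} {k : ℕ} (hk : k + 1 < n - 3)
    (hr : ∀ i < k, r (i + 1) = r i ∨ r (i + 1) = r i + 1)
    (h : ∀ (i : ℕ) (hi : i ≤ k), C.chord ⟨i, by omega⟩ = arcChord r i) :
    ∃ x, (x = r k ∨ x = r k + 1) ∧ C.chord ⟨k + 1, hk⟩ = s(x - (k + 1 : ℕ) - 1, x + 1) := by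
  have : NeZero n := ⟨by omega⟩
  obtain ⟨a, b, c, h1, h2, h3⟩ := C.exists_side (i := ⟨k, by omega⟩) (j := ⟨k + 1, hk⟩) rfl
  have hbad1 : C.chord ⟨k + 1, hk⟩ ≠ s(r k - k, r k + 1) := by
    intro hb
    rcases k with _ | k
    · have := C.triangulation.prop.1 _ ⟨⟨0 + 1, hk⟩, rfl⟩
      rw [hb] at this
      exact this.2 (isSide_of_eq (.inl (by push_cast; ring)))
    · rcases hr k (by omega) with hs | hs
      · have := h k (by omega)
        rw [arcChord, ← hs, show r (k + 1) - (k : ZMod n) - 1 = r (k + 1) - (k + 1 : ℕ) by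
          push_cast; ring, ← hb] at this
        have := congrArg Fin.val (C.injective this)
        simp only at this
        omega
      · have hc := C.triangulation.prop.2 _ ⟨⟨k + 1 + 1, hk⟩, rfl⟩ _ ⟨⟨k, by omega⟩, rfl⟩
        obtain ⟨y, hy⟩ := exists_int_coordinate (r k)
        rw [h k (by omega), arcChord_eq hy.symm, hb, hs, ← hy,
          show (y : ZMod n) + 1 - (k + 1 : ℕ) = ((y - k : ℤ) : ZMod n) by push_cast; ring,
          show (y : ZMod n) + 1 + 1 = ((y + 2 : ℤ) : ZMod n) by push_cast; ring,
          crosses_intCast_iff (b := y - k - 1) (by omega) (by omega) (by omega) (by omega)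
          (by omega) (by omega)] at hc
        omega
  have hbad2 : C.chord ⟨k + 1, hk⟩ ≠ s(r k - k - 1, r k) := by
    intro hb
    rcases k with _ | k
    · have := C.triangulation.prop.1 _ ⟨⟨0 + 1, hk⟩, rfl⟩
      rw [hb] at this
      exact this.2 (isSide_of_eq (.inl (by push_cast; ring)))
    · rcases hr k (by omega) with hs | hs
      · have hc := C.triangulation.prop.2 _ ⟨⟨k + 1 + 1, hk⟩, rfl⟩ _ ⟨⟨k, by omega⟩, rfl⟩
        obtain ⟨y, hy⟩ := exists_int_coordinate (r k)
        rw [h k (by omega), arcChord_eq hy.symm, hb, hs, ← hy,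
          show (y : ZMod n) - (k + 1 : ℕ) - 1 = ((y - k - 2 : ℤ) : ZMod n) by push_cast; ring,
          crosses_intCast_iff (b := y - k - 2) (by omega) (by omega) (by omega) (by omega)
          (by omega) (by omega)] at hc
        omega
      · have := h k (by omega)
        rw [arcChord, show r k - (k : ZMod n) - 1 = r (k + 1) - (k + 1 : ℕ) - 1 by
          rw [hs]; push_cast; ring, ← hs, ← hb] at this
        have := congrArg Fin.val (C.injective this)
        simp only at this
        omega
  rw [h k le_rfl, arcChord, Sym2.eq_iff] at h1
  rcases h1 with ⟨rfl, rfl⟩ | ⟨rfl, rfl⟩ <;> rcases h3 with rfl | rfl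
  · exact absurd (by rw [h2, Sym2.eq_swap]; exact sym2_mk_congr (by ring) (by ring)) hbad1
  · refine ⟨r k, .inl rfl, ?_⟩
    rw [h2, Sym2.eq_swap]; push_cast; exact sym2_mk_congr (by ring) (by ring)
  · refine ⟨r k + 1, .inr rfl, ?_⟩
    rw [h2]; push_cast; exact sym2_mk_congr (by ring) (by ring)
  · exact absurd (by rw [h2]; exact sym2_mk_congr (by ring) (by ring)) hbad2

lemma CTFT.exists_stepSeq (C : CTFT n) (k : ℕ) (hk : k < n - 3) :
    ∃ r : ℕ → ZMod n, (∀ i < k, r (i + 1) = r i ∨ r (i + 1) = r i + 1) ∧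
      ∀ (i : ℕ) (hi : i ≤ k), C.chord ⟨i, by omega⟩ = arcChord r i := by
  induction k with
  | zero =>
    obtain ⟨a, ha⟩ := C.short_first ⟨0, hk⟩ rfl
    refine ⟨fun _ => a, fun i hi => absurd hi (by omega), fun i hi => ?_⟩
    obtain rfl : i = 0 := by omega
    rw [ha, arcChord]; push_cast; rw [sub_zero]
  | succ k ih =>
    obtain ⟨r, hr, h⟩ := ih (by omega)
    obtain ⟨x, hx, hc⟩ := C.chord_succ hk hr h
    refine ⟨fun i => if i ≤ k then r i else x, fun i hi => ?_, fun i hi => ?_⟩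
    · simp only
      rw [if_pos (show i ≤ k by omega)]
      rcases (by omega : i + 1 ≤ k ∨ i = k) with h' | rfl
      · rw [if_pos h']; exact hr i (by omega)
      · rw [if_neg (by omega)]; exact hx
    · rcases (by omega : i ≤ k ∨ i = k + 1) with h' | rfl
      · rw [h i h']
        exact arcChord_congr (if_pos h').symm
      · rw [hc, arcChord, if_neg (by omega)]

lemma exists_ctftRel_right (hn : 5 ≤ n) (C : CTFT n) : ∃ v, CTFTRel C v := by
  obtain ⟨r, hr, h⟩ := C.exists_stepSeq (n - 4) (by omega)
  obtain ⟨v, hv⟩ := exists_psum_eq (m := n - 4) (by omega) r hr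
  refine ⟨v, fun i => ?_⟩
  rw [h i (by omega)]
  exact arcChord_congr (hv i (by omega)).symm

lemma CTFT.ext_chord {C D : CTFT n} (h : C.chord = D.chord) : C = D := by
  cases C; cases D; simp only at h; subst h; rfl

lemma ctftRel_unique_left {C D : CTFT n} {v : YokeVertex n (n - 4)} (hC : CTFTRel C v)
    (hD : CTFTRel D v) : C = D :=
  CTFT.ext_chord (funext fun i => (hC i).trans (hD i).symm)

lemma ctftRel_unique_right (hn : 5 ≤ n) {C : CTFT n} {u v : YokeVertex n (n - 4)}
    (hu : CTFTRel C u) (hv : CTFTRel C v) : u = v :=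
  yokeVertex_ext_psum (by omega) fun _ hi =>
    psum_eq_of_arcChord_eq_upward hn (by omega) fun j _ =>
      (hu ⟨j, by omega⟩).symm.trans (hv ⟨j, by omega⟩)

lemma yokeTight_ctft (hn : 5 ≤ n) : YokeTight n (n - 4) := ⟨by omega, by omega⟩

lemma IsTriangleOf.ne_left (hn : 2 ≤ n) {T : Set (Sym2 (ZMod n))} (hT : ∀ e ∈ T, IsDiagonal e)
    {a b c : ZMod n} (h : IsTriangleOf T a b c) : a ≠ b ∧ b ≠ c := by
  have key : ∀ x y : ZMod n, s(x, y) ∈ T ∨ IsSide s(x, y) → x ≠ y := by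
    rintro x y (h | h)
    · rintro rfl; exact (hT _ h).1 rfl
    · exact ne_of_isSide hn h
  exact ⟨key _ _ h.1, key _ _ h.2.1⟩

/-- The four sides of the quadrilateral in which the arc chord of index `i` moves. -/
lemma quadrilateral_sides {T : Set (Sym2 (ZMod n))} {r : ℕ → ZMod n} {i : ℕ}
    {x : ZMod n} (hi : i + 4 ≤ n) (hT : ∀ j, j + 4 ≤ n → j ≠ i → arcChord r j ∈ T)
    (h₁ : ∀ j, j + 1 = i → r j = x) (h₂ : i + 5 ≤ n → r (i + 1) = x + 1) :
    (s(x - (i : ZMod n), x + 1) ∈ T ∨ IsSide s(x - (i : ZMod n), x + 1)) ∧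
      (s(x - (i : ZMod n) - 1, x + 2) ∈ T ∨ IsSide s(x - (i : ZMod n) - 1, x + 2)) := by
  constructor
  · rcases i with _ | i
    · right; exact isSide_of_eq (.inl (by push_cast; ring))
    · left
      have := hT i (by omega) (by omega)
      rw [arcChord, h₁ i rfl] at this
      have e : s(x - (i : ZMod n) - 1, x + 1) = s(x - ((i + 1 : ℕ) : ZMod n), x + 1) :=
        sym2_mk_congr (by push_cast; ring) rfl
      rwa [← e]
  · rcases (by omega : i + 5 ≤ n ∨ i + 4 = n) with h | h
    · left
      have := hT (i + 1) (by omega) (by omega)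
      rw [arcChord, h₂ h] at this
      have e : s(x + 1 - ((i + 1 : ℕ) : ZMod n) - 1, x + 1 + 1) = s(x - (i : ZMod n) - 1, x + 2) :=
        sym2_mk_congr (by push_cast; ring) (by ring)
      rwa [← e]
    · right; refine isSide_of_eq (.inr ?_)
      rw [natCast_eq_neg_of_add_eq h]; push_cast; ring

/-- The unchanged chords determine the partial sums below `i` from the first chord and those above
`i` from the last. Conversely, if `x` and `x + 1` are the two values at `i`, the chords are the
diagonals of the quadrilateral `x - i - 1, x - i, x + 1, x + 2`. -/
lemma ctftFlip_iff (hn : 5 ≤ n) {C D : CTFT n} {u v : YokeVertex n (n - 4)} (hC : CTFTRel C u)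
    (hD : CTFTRel D v) (i : Fin (n - 3)) :
    CTFTFlip i C D ↔ (∀ j ≤ n - 4, j ≠ i.val → u.psum j = v.psum j) ∧ u.psum i ≠ v.psum i := by
  constructor
  · rintro ⟨h, a, b, c, d, h1, h2, hbd, t1, t2⟩
    have hch : ∀ j, j + 4 ≤ n → j ≠ i.val → arcChord u.psum j = arcChord v.psum j := by
      intro j hj hji
      rw [← hC ⟨j, by omega⟩, ← hD ⟨j, by omega⟩]
      exact h _ fun h' => hji (congrArg Fin.val h')
    refine ⟨fun j hj hji => ?_, fun he => ?_⟩
    · rcases lt_or_gt_of_ne hji with hlt | hgt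
      · exact psum_eq_of_arcChord_eq_upward hn (by omega) fun k hk => hch k (by omega) (by omega)
      · exact psum_eq_of_arcChord_eq_downward hn (d := n - 4 - j) (by omega)
          fun k hk hk' => hch k (by omega) (by omega)
    · have t := t1.ne_left (by omega) C.triangulation.prop.1
      have hcd : C.chord i = D.chord i := by rw [hC i, hD i, arcChord_congr he]
      rw [h1, h2, Sym2.eq_iff] at hcd
      rcases hcd with ⟨h, -⟩ | ⟨-, h⟩
      · exact t.1 h
      · exact t.2 h.symm
  · rintro ⟨h, hne⟩
    have hch : ∀ j, j ≠ i → C.chord j = D.chord j := by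
      intro j hji
      rw [hC j, hD j]
      exact arcChord_congr (h j (by omega) fun h' => hji (Fin.ext h'))
    have h2' : ∀ x : ZMod n, x ≠ x + 1 := fun x hx =>
      zmod_one_ne_zero (n := n) (by omega) (by linear_combination -hx)
    have h2'' : ∀ x : ZMod n, x ≠ x + 1 + 1 := fun x hx =>
      zmod_two_ne_zero (n := n) (by omega) (by linear_combination -hx)
    have hne2 : ∀ x : ZMod n, x - i ≠ x + 2 := by
      intro x hx
      refine natCast_ne_zero_of_lt (n := n) (k := i.val + 2) (by omega) (by omega) ?_
      push_cast; linear_combination -hx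
    have hne1 : ∀ x : ZMod n, x - i - 1 ≠ x + 1 := by
      intro x hx
      refine natCast_ne_zero_of_lt (n := n) (k := i.val + 2) (by omega) (by omega) ?_
      push_cast; linear_combination -hx
    have hT : ∀ j, j + 4 ≤ n → arcChord u.psum j ∈ Set.range C.chord := fun j hj =>
      ⟨⟨j, by omega⟩, hC _⟩
    have hmemi : C.chord i ∈ Set.range C.chord := ⟨i, rfl⟩
    refine ⟨hch, ?_⟩
    have hprev : ∀ j, j + 1 = i.val → u.psum j = v.psum j := fun j hj => h j (by omega) (by omega)
    have hnext : i.val + 5 ≤ n → u.psum (i + 1) = v.psum (i + 1) := fun hi =>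
      h _ (by omega) (by omega)
    -- Since both values fit between the same neighbors, the partial sum before `i` is the smaller
    -- value and the one after `i` the larger. Hence the neighboring chords, or sides when `i` is
    -- extreme, bound the quadrilateral.
    rcases psum_sub_eq_one (yokeTight_ctft hn) (i := i) (by omega) h hne with hs | hs
    · obtain ⟨q1, q2⟩ := quadrilateral_sides (x := v.psum i) (i := i) (r := u.psum) (by omega)
        (fun j hj _ => hT j hj)
        (by
          intro j hj
          have e1 := psum_step' u (i := j) (by omega)
          have e2 := psum_step' v (i := j) (by omega)
          rw [hj] at e1 e2
          rw [← hprev j hj] at e2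
          rcases e2 with e2 | e2
          · exact e2.symm
          · rw [hs, e2] at e1
            rcases e1 with e1 | e1
            · exact absurd e1.symm (h2'' _)
            · exact absurd (add_right_cancel e1).symm (h2' _))
        (by
          intro hi
          have e1 := psum_step' u (i := i) (by omega)
          have e2 := psum_step' v (i := i) (by omega)
          rw [← hnext hi] at e2
          rw [hs] at e1
          rcases e2 with e2 | e2
          · rw [e2] at e1
            rcases e1 with e1 | e1
            · exact absurd e1 (h2' _)
            · exact absurd e1 (h2'' _)
          · exact e2)
      have hci : C.chord i = s(v.psum i - i, v.psum i + 2) := by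
        rw [hC i, arcChord, hs]; exact sym2_mk_congr (by ring) (by ring)
      refine ⟨v.psum i - i, v.psum i - i - 1, v.psum i + 2, v.psum i + 1, hci, ?_, hne1 _,
        ⟨.inr (isSide_of_eq (.inr (by ring))), q2, .inl (hci ▸ hmemi)⟩,
        ⟨q1, .inr (isSide_of_eq (.inl (by ring))), .inl (hci ▸ hmemi)⟩⟩
      rw [hD i, arcChord]
    · obtain ⟨q1, q2⟩ := quadrilateral_sides (x := u.psum i) (i := i) (r := u.psum) (by omega)
        (fun j hj _ => hT j hj)
        (by
          intro j hj
          have e1 := psum_step' u (i := j) (by omega)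
          have e2 := psum_step' v (i := j) (by omega)
          rw [hj] at e1 e2
          rw [← hprev j hj, hs] at e2
          rcases e1 with e1 | e1
          · exact e1.symm
          · rw [e1] at e2
            rcases e2 with e2 | e2
            · exact absurd e2.symm (h2'' _)
            · exact absurd (add_right_cancel e2).symm (h2' _))
        (by
          intro hi
          have e1 := psum_step' u (i := i) (by omega)
          have e2 := psum_step' v (i := i) (by omega)
          rw [← hnext hi, hs] at e2
          rcases e1 with e1 | e1
          · rw [e1] at e2
            rcases e2 with e2 | e2
            · exact absurd e2 (h2' _)
            · exact absurd e2 (h2'' _)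
          · exact e1)
      have hci : C.chord i = s(u.psum i - i - 1, u.psum i + 1) := by
        rw [hC i, arcChord]
      refine ⟨u.psum i - i - 1, u.psum i - i, u.psum i + 1, u.psum i + 2, hci, ?_, hne2 _,
        ⟨.inr (isSide_of_eq (.inl (by ring))), q1, .inl (hci ▸ hmemi)⟩,
        ⟨q2, .inr (isSide_of_eq (.inr (by ring))), .inl (hci ▸ hmemi)⟩⟩
      rw [hD i, arcChord, hs]; exact sym2_mk_congr (by ring) (by ring)

lemma ctftCode_of_ctftRel {C : CTFT n} {v : YokeVertex n (n - 4)}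
    (h : CTFTRel C v) : CTFTCode C v := by
  refine ⟨fun i => v.psum i - i - 1, fun i => v.psum i + 1, h, ?_, ?_, ?_⟩
  · simp only; rw [psum_zero]; push_cast; ring
  · simp only; rw [psum_zero]
  · rintro ⟨i, hi⟩ h1 h2
    simp only at h1 h2 ⊢
    obtain ⟨i, rfl⟩ : ∃ k, i = k + 1 := ⟨i - 1, by omega⟩
    simp only [add_tsub_cancel_right]
    rcases psum_step v i hi (by omega) with ⟨e, hs⟩ | ⟨e, hs⟩ <;> rw [hs]
    · exact .inl ⟨e, by push_cast; ring, rfl⟩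
    · exact .inr ⟨e, by push_cast; ring, rfl⟩

theorem exists_ctftGraph_iso (hn : 5 ≤ n) : ∃ g : ctftGraph n ≃g yokeGraph n (n - 4),
    (∀ T : CTFT n, CTFTCode T (g T)) ∧
      ∀ (T T' : CTFT n) (i : Fin (n - 3)) (j : Fin (n - 4 + 1)), i.val = j.val →
        (CTFTFlip i T T' ↔ YokeShift j (g T) (g T')) := by
  obtain ⟨f, hf⟩ := exists_equiv_of_rel (CTFTRel (n := n)) (exists_ctftRel_right hn)
    (exists_ctftRel_left hn) (fun _ _ _ => ctftRel_unique_left)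
    (fun _ _ _ => ctftRel_unique_right hn)
  have key : ∀ (T T' : CTFT n) (i : Fin (n - 3)) (j : Fin (n - 4 + 1)), i.val = j.val →
      (CTFTFlip i T T' ↔ YokeShift j (f T) (f T')) := by
    rintro T T' i j hij
    rw [ctftFlip_iff hn (hf T) (hf T'), yokeShift_iff (yokeTight_ctft hn), hij]
  refine ⟨⟨f, ?_⟩, fun T => ctftCode_of_ctftRel (hf T), key⟩
  intro T T'
  rw [yokeGraph_adj_iff (yokeTight_ctft hn), ctftGraph, SimpleGraph.fromRel_adj]
  constructor
  · rintro ⟨i, h⟩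
    refine ⟨?_, .inl ⟨⟨i, by omega⟩, (key T T' _ i rfl).2 h⟩⟩
    rintro rfl
    rw [yokeShift_iff (yokeTight_ctft hn)] at h
    exact h.2 rfl
  · rintro ⟨-, ⟨i, h⟩ | ⟨i, h⟩⟩
    · exact ⟨⟨i, by omega⟩, (key T T' i _ rfl).1 h⟩
    · exact ⟨⟨i, by omega⟩, yokeShift_symm (yokeTight_ctft hn)
        ((key T' T i ⟨i, by omega⟩ rfl).1 h)⟩

end Triangulations

/-! ### The tree of a growing sequence of arcs -/

/-- The edge that joins the vertex entering the arc of index `j + 1` to the end `r j` of the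
previous arc. -/
noncomputable def arcEdge {n : ℕ} (r : ℕ → ZMod n) (j : ℕ) : Sym2 (ZMod n) :=
  s(r j, arcVertex r (j + 1))

/-- The tree with the edges `arcEdge r j`. -/
noncomputable def arcTree {n : ℕ} (r : ℕ → ZMod n) : SimpleGraph (ZMod n) :=
  SimpleGraph.fromEdgeSet {e | ∃ j, j + 1 < n ∧ e = arcEdge r j}

section ArcTree
variable {n : ℕ} {r : ℕ → ZMod n}

lemma self_mem_arcSet (x : ZMod n) (k : ℕ) : x ∈ arcSet x (k + 1) := ⟨0, by omega, by simp⟩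

lemma arcSet_mono (hn : 2 ≤ n) (hr : IsStepSeq r) {i j : ℕ} (hij : i ≤ j) :
    arcSet (r i) (i + 1) ⊆ arcSet (r j) (j + 1) := by
  intro x
  rw [mem_arcSet_iff_exists hn hr, mem_arcSet_iff_exists hn hr]
  rintro ⟨k, hk, h⟩
  exact ⟨k, hk.trans hij, h⟩

lemma mem_arcSet_of_le (hn : 2 ≤ n) (hr : IsStepSeq r) {i j : ℕ} (hij : i ≤ j) :
    r i ∈ arcSet (r j) (j + 1) := arcSet_mono hn hr hij (self_mem_arcSet _ _)

lemma arcVertex_mem_iff (hn : 2 ≤ n) (hr : IsStepSeq r) {i j : ℕ} (hi : i < n) (hj : j < n) :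
    arcVertex r i ∈ arcSet (r j) (j + 1) ↔ i ≤ j := by
  rw [mem_arcSet_iff_exists hn hr]
  constructor
  · rintro ⟨k, hk, h⟩
    rwa [arcVertex_inj hn hr hi (by omega) h]
  · intro h; exact ⟨i, h, rfl⟩

lemma arcTree_adj (hn : 2 ≤ n) (hr : IsStepSeq r) {x y : ZMod n} :
    (arcTree r).Adj x y ↔ ∃ j, j + 1 < n ∧ s(x, y) = arcEdge r j := by
  rw [arcTree, SimpleGraph.fromEdgeSet_adj]
  refine and_iff_left_of_imp ?_
  rintro ⟨j, hj, h⟩ rfl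
  rw [arcEdge, Sym2.eq_iff] at h
  have h' : arcVertex r (j + 1) = r j := by rcases h with h | h <;> rw [← h.1, ← h.2]
  exact arcVertex_notMem hn hr hj (h' ▸ self_mem_arcSet _ _)

lemma mem_edgeSet_arcTree (hn : 2 ≤ n) (hr : IsStepSeq r) {e : Sym2 (ZMod n)} :
    e ∈ (arcTree r).edgeSet ↔ ∃ j, j + 1 < n ∧ e = arcEdge r j := by
  induction e using Sym2.inductionOn with
  | hf x y => rw [SimpleGraph.mem_edgeSet, arcTree_adj hn hr]

lemma arcTree_adj_of_lt (hn : 2 ≤ n) (hr : IsStepSeq r) {j : ℕ} (hj : j + 1 < n) :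
    (arcTree r).Adj (r j) (arcVertex r (j + 1)) := (arcTree_adj hn hr).2 ⟨j, hj, rfl⟩

/-- The later edge contains a vertex that enters after the earlier edge is complete. -/
lemma arcEdge_inj (hn : 2 ≤ n) (hr : IsStepSeq r) {i j : ℕ} (hi : i + 1 < n) (hj : j + 1 < n)
    (h : arcEdge r i = arcEdge r j) : i = j := by
  have key : ∀ i j, i < j → j + 1 < n → arcEdge r i ≠ arcEdge r j := by
    intro i j hij hj h
    have hmem : arcVertex r (j + 1) ∈ arcEdge r i := h ▸ Sym2.mem_mk_right _ _
    refine arcVertex_notMem hn hr hj ?_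
    rw [arcEdge, Sym2.mem_iff] at hmem
    rcases hmem with h | h <;> rw [h]
    · exact mem_arcSet_of_le hn hr hij.le
    · exact (arcVertex_mem_iff hn hr (by omega) (by omega)).2 hij
  rcases lt_trichotomy i j with h' | h' | h'
  · exact absurd h (key i j h' hj)
  · exact h'
  · exact absurd h.symm (key j i h' hi)

lemma arcTree_connected (hn : 2 ≤ n) (hr : IsStepSeq r) : (arcTree r).Connected := by
  have key : ∀ j < n, (arcTree r).Reachable (arcVertex r 0) (arcVertex r j) := by
    intro j
    induction j using Nat.strong_induction_on with
    | _ j ih =>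
      intro hj
      rcases j with _ | j
      · exact .refl _
      · obtain ⟨k, hk, h⟩ := (mem_arcSet_iff_exists hn hr j _).1 (self_mem_arcSet (r j) j)
        exact (h ▸ ih k (by omega) (by omega)).trans (arcTree_adj_of_lt hn hr hj).reachable
  have : Nonempty (ZMod n) := ⟨0⟩
  refine ⟨fun x y => ?_⟩
  obtain ⟨i, hi, rfl⟩ := exists_eq_arcVertex hn hr x
  obtain ⟨j, hj, rfl⟩ := exists_eq_arcVertex hn hr y
  exact (key i hi).symm.trans (key j hj)

lemma arcTree_isTree (hn : 2 ≤ n) (hr : IsStepSeq r) : (arcTree r).IsTree := by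
  have : NeZero n := ⟨by omega⟩
  rw [SimpleGraph.isTree_iff_connected_and_card]
  refine ⟨arcTree_connected hn hr, ?_⟩
  have h2 : Nat.card (arcTree r).edgeSet = n - 1 := by
    have h : (arcTree r).edgeSet = Set.range fun i : Fin (n - 1) => arcEdge r i := by
      ext e
      rw [mem_edgeSet_arcTree hn hr]
      constructor
      · rintro ⟨j, hj, rfl⟩; exact ⟨⟨j, by omega⟩, rfl⟩
      · rintro ⟨j, rfl⟩; exact ⟨j, by omega, rfl⟩
    rw [h, Nat.card_range_of_injective, Nat.card_fin]
    intro i j hij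
    exact Fin.ext (arcEdge_inj hn hr (by omega) (by omega) hij)
  rw [h2, Nat.card_zmod]; omega

/-- Both endpoints of an earlier edge lie in the arc of index `j`, while the edge of index `j` joins
the upper end of this arc to a vertex outside it. Cutting the circle just above this end makes the
claim linear. -/
lemma arcTree_isNoncrossing (hn : 2 ≤ n) (hr : IsStepSeq r) :
    IsNoncrossing (arcTree r).edgeSet := by
  have : NeZero n := ⟨by omega⟩
  have key : ∀ i j, i ≤ j → j + 1 < n → ¬ Crosses (arcEdge r i) (arcEdge r j) ∧
      ¬ Crosses (arcEdge r j) (arcEdge r i) := by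
    intro i j hij hj
    obtain ⟨y, hy⟩ := exists_int_coordinate (r j)
    obtain ⟨w, hw1, hw2, hw⟩ := exists_intCast_eq (n := n) (y - n + 1) (arcVertex r (j + 1))
    have hwn : w ≤ y - (j + 1) := by
      by_contra hlt
      refine arcVertex_notMem hn hr hj ?_
      rw [← hw, ← hy]
      have := mem_arcSet_of_int (n := n) (w := w) (y := y - 1) (k := j + 1) (by omega) (by omega)
      push_cast at this
      rwa [sub_add_cancel] at this
    have hint : ∀ x ∈ arcSet (r j) (j + 1), ∃ z : ℤ, y - j ≤ z ∧ z ≤ y ∧ x = (z : ZMod n) := by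
      intro x hx
      obtain ⟨z, h1, h2, h3⟩ := exists_int_of_mem_arcSet (n := n) (x := x) (y := y - 1) (k := j + 1)
        (by push_cast; rwa [sub_add_cancel, hy])
      exact ⟨z, by omega, by omega, h3⟩
    have hej : arcEdge r j = s((w : ZMod n), (y : ZMod n)) := by
      rw [arcEdge, hy, hw, Sym2.eq_swap]
    rcases hij.lt_or_eq with hij | rfl
    · obtain ⟨p, hp1, hp2, hp⟩ := hint _ (mem_arcSet_of_le hn hr hij.le)
      obtain ⟨q, hq1, hq2, hq⟩ := hint _ ((arcVertex_mem_iff hn hr (by omega) (by omega)).2 hij)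
      rw [hej]
      rcases le_total p q with h | h
      · rw [arcEdge, hp, hq, crosses_intCast_iff (b := y - n + 1) (by omega) (by omega) (by omega)
          (by omega) (by omega) (by omega), crosses_intCast_iff (b := y - n + 1) (by omega)
          (by omega) (by omega) (by omega) (by omega) (by omega)]
        omega
      · rw [arcEdge, hp, hq, Sym2.eq_swap (a := (p : ZMod n)), crosses_intCast_iff
          (b := y - n + 1) (by omega) (by omega) (by omega) (by omega) (by omega) (by omega),
          crosses_intCast_iff (b := y - n + 1) (by omega) (by omega) (by omega) (by omega)
          (by omega) (by omega)]
        omega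
    · rw [hej, crosses_intCast_iff (b := y - n + 1) (by omega) (by omega) (by omega) (by omega)
          (by omega) (by omega)]
      omega
  intro e he f hf
  obtain ⟨i, hi, rfl⟩ := (mem_edgeSet_arcTree hn hr).1 he
  obtain ⟨j, hj, rfl⟩ := (mem_edgeSet_arcTree hn hr).1 hf
  rcases le_total i j with h | h
  · exact (key i j h hj).1
  · exact (key j i h hi).2

open Classical in
/-- The number of indices in `[1, n - 2]` at which `r` takes the value `x`. -/
noncomputable def spineCount {n : ℕ} (r : ℕ → ZMod n) (x : ZMod n) : ℕ :=
  ((Finset.Icc 1 (n - 2)).filter fun j => r j = x).card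

/-- Every vertex but the first has one neighbor that entered before it, and gains one for each later
index `j` with `r j = x`. For the first vertex the edge of index `0` plays the role of the extra
neighbor, which is why `spineCount` starts at index `1`. -/
lemma ncard_neighborSet_arcTree (hn : 2 ≤ n) (hr : IsStepSeq r) (x : ZMod n) :
    ((arcTree r).neighborSet x).ncard = spineCount r x + 1 := by
  classical
  set F := (Finset.Icc 1 (n - 2)).filter fun j => r j = x with hF
  have memF : ∀ j, j ∈ F ↔ (1 ≤ j ∧ j + 1 < n) ∧ r j = x := by
    intro j; rw [hF, Finset.mem_filter, Finset.mem_Icc]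
    refine and_congr_left fun _ => by omega
  suffices h : ∃ p, p ∉ F.image (fun j => arcVertex r (j + 1)) ∧
      (arcTree r).neighborSet x = (insert p (F.image fun j => arcVertex r (j + 1)) : Finset _) by
    obtain ⟨p, hp, h⟩ := h
    rw [h, Set.ncard_coe_finset, Finset.card_insert_of_notMem hp, Finset.card_image_of_injOn]
    · rfl
    · intro i hi j hj hij
      rw [Finset.mem_coe, memF] at hi hj
      have := arcVertex_inj hn hr hi.1.2 hj.1.2 hij
      omega
  obtain ⟨i, hi, rfl⟩ := exists_eq_arcVertex hn hr x
  -- A vertex can be the end of an arc only once it has entered.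
  have hlt : ∀ j, j + 1 < n → r j = arcVertex r i → i ≤ j := by
    intro j hj h
    rw [← arcVertex_mem_iff hn hr hi (by omega), ← h]
    exact self_mem_arcSet _ _
  rcases i with _ | i
  · refine ⟨arcVertex r 1, ?_, ?_⟩
    · rw [Finset.mem_image]
      rintro ⟨j, hj, h⟩
      rw [memF] at hj
      have := arcVertex_inj hn hr hj.1.2 (by omega) h
      omega
    · ext y
      rw [SimpleGraph.mem_neighborSet, arcTree_adj hn hr, Finset.mem_coe, Finset.mem_insert,
        Finset.mem_image]
      constructor
      · rintro ⟨j, hj, h⟩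
        rw [arcEdge, Sym2.eq_iff] at h
        rcases h with ⟨h1, h2⟩ | ⟨h1, h2⟩
        · rcases j with _ | j
          · exact .inl h2
          · exact .inr ⟨j + 1, (memF _).2 ⟨⟨by omega, hj⟩, h1.symm⟩, h2.symm⟩
        · have := arcVertex_inj hn hr (by omega) hj h1
          omega
      · rintro (rfl | ⟨j, hj, rfl⟩)
        · exact ⟨0, by omega, rfl⟩
        · rw [memF] at hj
          exact ⟨j, hj.1.2, by rw [arcEdge, hj.2]⟩
  · refine ⟨r i, ?_, ?_⟩
    · rw [Finset.mem_image]
      rintro ⟨j, hj, h⟩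
      rw [memF] at hj
      refine arcVertex_notMem hn hr hj.1.2 (h ▸ mem_arcSet_of_le hn hr ?_)
      have := hlt j hj.1.2 hj.2
      omega
    · ext y
      rw [SimpleGraph.mem_neighborSet, arcTree_adj hn hr, Finset.mem_coe, Finset.mem_insert,
        Finset.mem_image]
      constructor
      · rintro ⟨j, hj, h⟩
        rw [arcEdge, Sym2.eq_iff] at h
        rcases h with ⟨h1, h2⟩ | ⟨h1, h2⟩
        · have := hlt j hj h1.symm
          exact .inr ⟨j, (memF _).2 ⟨⟨by omega, hj⟩, h1.symm⟩, h2.symm⟩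
        · have := arcVertex_inj hn hr hi hj h1
          obtain rfl : i = j := by omega
          exact .inl h2
      · rintro (rfl | ⟨j, hj, rfl⟩)
        · exact ⟨i, by omega, Sym2.eq_swap⟩
        · rw [memF] at hj
          exact ⟨j, hj.1.2, by rw [arcEdge, hj.2]⟩

lemma isLeaf_iff_ncard {V : Type*} (G : SimpleGraph V) (x : V) :
    IsLeaf G x ↔ (G.neighborSet x).ncard = 1 := by
  rw [Set.ncard_eq_one, IsLeaf]
  constructor
  · rintro ⟨w, hw, h⟩
    refine ⟨w, Set.ext fun y => ⟨fun hy => h y hy, ?_⟩⟩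
    rintro rfl; exact hw
  · rintro ⟨w, hw⟩
    refine ⟨w, (hw ▸ Set.mem_singleton w : w ∈ G.neighborSet x), fun y hy => ?_⟩
    have : y ∈ G.neighborSet x := hy
    rwa [hw] at this

lemma spineCount_eq_zero_iff (x : ZMod n) :
    spineCount r x = 0 ↔ ∀ j, 1 ≤ j → j ≤ n - 2 → r j ≠ x := by
  rw [spineCount, Finset.card_eq_zero, Finset.filter_eq_empty_iff]
  simp only [Finset.mem_Icc, and_imp]

lemma isLeaf_arcTree_iff (hn : 2 ≤ n) (hr : IsStepSeq r) (x : ZMod n) :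
    IsLeaf (arcTree r) x ↔ ∀ j, 1 ≤ j → j ≤ n - 2 → r j ≠ x := by
  rw [isLeaf_iff_ncard, ncard_neighborSet_arcTree hn hr, ← spineCount_eq_zero_iff]
  omega

/-- The integer heights of a sequence with steps `0` and `1`. -/
lemma IsStepSeq.exists_height (hr : IsStepSeq r) (a : ℕ) : ∃ N : ℕ → ℕ, N a = 0 ∧
    (∀ j, r (a + j) = r a + (N (a + j) : ZMod n)) ∧
    ∀ j, (N (a + j + 1) = N (a + j) ∧ r (a + j + 1) = r (a + j)) ∨
      (N (a + j + 1) = N (a + j) + 1 ∧ r (a + j + 1) = r (a + j) + 1) := by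
  classical
  let M : ℕ → ℕ := fun j => Nat.rec 0 (fun i x => if r (a + i + 1) = r (a + i) then x else x + 1) j
  have hM : ∀ j, (M (j + 1) = M j ∧ r (a + j + 1) = r (a + j)) ∨
      (M (j + 1) = M j + 1 ∧ r (a + j + 1) = r (a + j) + 1) := by
    intro j
    by_cases h : r (a + j + 1) = r (a + j)
    · exact .inl ⟨by simp only [M]; rw [if_pos h], h⟩
    · exact .inr ⟨by simp only [M]; rw [if_neg h], (hr _).resolve_left h⟩
  refine ⟨fun j => M (j - a), by simp [M], fun j => ?_, fun j => ?_⟩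
  · simp only [add_tsub_cancel_left]
    induction j with
    | zero => simp [M]
    | succ j ih =>
      rcases hM j with ⟨h1, h2⟩ | ⟨h1, h2⟩
      · rw [← add_assoc, h2, h1, ih]
      · rw [← add_assoc, h2, h1, ih]; push_cast; ring
  · simp only [add_assoc, add_tsub_cancel_left]
    exact hM j

/-- A discrete intermediate value theorem which selects the last index of height `q`, so that the
next step, if any, goes up. -/
lemma exists_height_eq {N : ℕ → ℕ} (h0 : N 0 = 0) {k : ℕ}
    (hN : ∀ j < k, N (j + 1) = N j ∨ N (j + 1) = N j + 1) {q : ℕ} (hq : q ≤ N k) :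
    ∃ j ≤ k, N j = q ∧ (j < k → N (j + 1) = q + 1) := by
  induction k with
  | zero => exact ⟨0, le_rfl, by omega, by omega⟩
  | succ k ih =>
    rcases hN k (by omega) with h | h
    · rcases (by omega : q = N (k + 1) ∨ q < N k) with h' | h'
      · exact ⟨k + 1, le_rfl, h'.symm, by omega⟩
      · obtain ⟨j, hj, h1, h2⟩ := ih (fun j hj => hN j (by omega)) h'.le
        refine ⟨j, by omega, h1, fun _ => ?_⟩
        rcases hj.lt_or_eq with hj | rfl
        · exact h2 hj
        · omega
    · rcases (by omega : q = N (k + 1) ∨ q ≤ N k) with h' | h'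
      · exact ⟨k + 1, le_rfl, h'.symm, by omega⟩
      · obtain ⟨j, hj, h1, h2⟩ := ih (fun j hj => hN j (by omega)) h'
        refine ⟨j, by omega, h1, fun _ => ?_⟩
        rcases hj.lt_or_eq with hj | rfl
        · exact h2 hj
        · omega

/-- The heights `r j = r 0 + N j` of a sequence that begins with an up-step. -/
lemma IsStepSeq.exists_height_zero (hr : IsStepSeq r) (h01 : r 1 = r 0 + 1) (hn : 2 ≤ n) :
    ∃ N : ℕ → ℕ, N 0 = 0 ∧ N 1 = 1 ∧ (∀ j, r j = r 0 + (N j : ZMod n)) ∧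
      (∀ j, N j ≤ j) ∧ ∀ j, (N (j + 1) = N j ∧ r (j + 1) = r j) ∨
      (N (j + 1) = N j + 1 ∧ r (j + 1) = r j + 1) := by
  obtain ⟨N, h0, h1, h2⟩ := hr.exists_height 0
  simp only [zero_add] at h1 h2
  refine ⟨N, h0, ?_, h1, fun j => ?_, h2⟩
  · rcases h2 0 with ⟨-, h⟩ | ⟨h, -⟩
    · rw [zero_add, h01] at h
      exact absurd (by simpa using h) (zmod_one_ne_zero hn)
    · rw [zero_add] at h; omega
  · induction j with
    | zero => omega
    | succ j ih => rcases h2 j with ⟨h, -⟩ | ⟨h, -⟩ <;> omega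

/-- The non-leaves are the values `r 1, …, r (n - 2)`. They start at `r 0 + 1` and skip nothing. -/
lemma arcTree_isCyclicInterval (hn : 3 ≤ n) (hr : IsStepSeq r) (h01 : r 1 = r 0 + 1) :
    IsCyclicInterval {x | ¬ IsLeaf (arcTree r) x} := by
  obtain ⟨N, h0, h1, hN, hle, hs⟩ := hr.exists_height_zero h01 (by omega)
  refine ⟨r 0 + 1, N (n - 2), Set.ext fun x => ?_⟩
  simp only [Set.mem_ofPred_eq, isLeaf_arcTree_iff (show 2 ≤ n by omega) hr]
  push Not
  have hmono : Monotone N := monotone_nat_of_le_succ fun j => by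
    rcases hs j with ⟨h, -⟩ | ⟨h, -⟩ <;> omega
  constructor
  · rintro ⟨j, hj1, hj2, rfl⟩
    have h2 : N 1 ≤ N j := hmono hj1
    have h3 : N j ≤ N (n - 2) := hmono hj2
    refine ⟨N j - 1, by omega, ?_⟩
    rw [hN j, Nat.cast_sub (by omega)]; push_cast; ring
  · rintro ⟨q, hq, rfl⟩
    obtain ⟨j, hj, hjq, -⟩ := exists_height_eq h0 (k := n - 2) (q := q + 1)
      (fun j _ => (hs j).imp And.left And.left) (by omega)
    refine ⟨j, ?_, hj, ?_⟩
    · by_contra h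
      obtain rfl : j = 0 := by omega
      omega
    · rw [hN j, hjq]; push_cast; ring

/-- The caterpillar of a growing sequence of arcs that begins with an up-step. -/
noncomputable def arcCaterpillar (hn : 3 ≤ n) (r : ℕ → ZMod n) (hr : IsStepSeq r)
    (h01 : r 1 = r 0 + 1) : Caterpillar n :=
  ⟨arcTree r, arcTree_isTree (by omega) hr, arcTree_isNoncrossing (by omega) hr,
    arcTree_isCyclicInterval hn hr h01⟩

lemma arcEdge_of_eq {j : ℕ} (h : r (j + 1) = r j) :
    arcEdge r j = s(r j, r j - ((j + 1 : ℕ) : ZMod n)) := by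
  rw [arcEdge, arcVertex_succ_of_eq h]

lemma arcEdge_of_eq_add (hn : 2 ≤ n) {j : ℕ} (h : r (j + 1) = r j + 1) :
    arcEdge r j = s(r j, r j + 1) := by
  rw [arcEdge, arcVertex_succ_of_eq_add hn h]

/-- Only one vertex is left to enter, and it is reached from either end of the arc; the last step of
`r` does not matter. -/
lemma arcEdge_last (hn : 2 ≤ n) (hr : IsStepSeq r) {j : ℕ} (hj : j + 2 = n) :
    arcEdge r j = s(r j, r j + 1) := by
  rcases hr j with h | h
  · rw [arcEdge_of_eq h, add_one_eq_sub hn, show n - 1 = j + 1 by omega]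
  · exact arcEdge_of_eq_add hn h

lemma exists_walk_of_adj {V : Type*} (G : SimpleGraph V) (f : ℕ → V) (k : ℕ)
    (h : ∀ q < k, G.Adj (f q) (f (q + 1))) :
    ∃ p : G.Walk (f 0) (f k), p.length = k ∧ (∀ j ≤ k, p.getVert j = f j) ∧
      ∀ e, e ∈ p.edges ↔ ∃ q < k, e = s(f q, f (q + 1)) := by
  induction k generalizing f with
  | zero => exact ⟨.nil, rfl, fun j hj => by simp [show j = 0 by omega], by simp⟩
  | succ k ih =>
    obtain ⟨p, h1, h2, h3⟩ := ih (fun q => f (q + 1)) fun q hq => h (q + 1) (by omega)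
    refine ⟨.cons (h 0 (by omega)) p, by simp [h1], fun j hj => ?_, fun e => ?_⟩
    · rcases j with _ | j
      · simp
      · rw [SimpleGraph.Walk.getVert_cons_succ]; exact h2 j (by omega)
    · rw [SimpleGraph.Walk.edges_cons, List.mem_cons, h3]
      constructor
      · rintro (rfl | ⟨q, hq, rfl⟩)
        · exact ⟨0, by omega, rfl⟩
        · exact ⟨q + 1, by omega, rfl⟩
      · rintro ⟨q, hq, rfl⟩
        rcases q with _ | q
        · exact .inl rfl
        · exact .inr ⟨q, by omega, rfl⟩

/-- The path through `r 0, r 0 + 1, …` contains every edge of the tree that is a side. Any path of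
sides therefore has at most as many edges. -/
lemma exists_isSpine (hn : 3 ≤ n) (hr : IsStepSeq r) (h01 : r 1 = r 0 + 1) :
    ∃ (b : ZMod n) (p : (arcTree r).Walk (r 0) b), IsSpine p ∧
      (∀ j ≤ p.length, p.getVert j = r 0 + (j : ZMod n)) ∧
      ∀ e ∈ (arcTree r).edgeSet, IsSide e → e ∈ p.edges := by
  have hn2 : 2 ≤ n := by omega
  obtain ⟨N, h0, h1, hN, hle, hs⟩ := hr.exists_height_zero h01 hn2
  have hmono : Monotone N := monotone_nat_of_le_succ fun j => by
    rcases hs j with ⟨h, -⟩ | ⟨h, -⟩ <;> omega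
  obtain ⟨p, hp1, hp2, hp3⟩ := exists_walk_of_adj (arcTree r) (fun q => r 0 + (q : ZMod n))
    (N (n - 2) + 1) (by
      intro q hq
      obtain ⟨j, hj, hjq, hj'⟩ := exists_height_eq h0 (k := n - 2) (q := q)
        (fun j _ => (hs j).imp And.left And.left) (by omega)
      rw [arcTree_adj hn2 hr]
      refine ⟨j, by omega, ?_⟩
      have e : arcEdge r j = s(r j, r j + 1) := by
        rcases hj.lt_or_eq with hj | rfl
        · refine arcEdge_of_eq_add hn2 ?_
          rcases hs j with ⟨h, -⟩ | ⟨-, h⟩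
          · have := hj' hj; omega
          · exact h
        · exact arcEdge_last hn2 hr (by omega)
      rw [e, hN j, hjq]
      exact sym2_mk_congr rfl (by push_cast; ring))
  have hside : ∀ e ∈ (arcTree r).edgeSet, IsSide e → e ∈ p.edges := by
    intro e he hse
    obtain ⟨j, hj, rfl⟩ := (mem_edgeSet_arcTree hn2 hr).1 he
    have e : arcEdge r j = s(r j, r j + 1) := by
      rcases hr j with h | h
      -- A step `0` gives an edge spanning `j + 1` sides, which is itself a side only for `j = 0`,
      -- excluded by the initial up-step, or `j = n - 2`.
      · rcases (by omega : j = 0 ∨ j + 2 = n ∨ (1 ≤ j ∧ j + 2 < n)) with rfl | hj' | ⟨hj1, hj2⟩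
        · rw [zero_add, h01] at h
          exact absurd (by simpa using h) (zmod_one_ne_zero hn2)
        · exact arcEdge_last hn2 hr hj'
        · rw [arcEdge_of_eq h, isSide_iff] at hse
          rcases hse with h' | h'
          · exact absurd (by push_cast at h' ⊢; linear_combination -h')
              (natCast_ne_zero_of_lt (n := n) (k := j + 2) (by omega) (by omega))
          · exact absurd (by push_cast at h'; linear_combination h')
              (natCast_ne_zero_of_lt (n := n) (k := j) (by omega) (by omega))
      · exact arcEdge_of_eq_add hn2 h
    rw [e, hp3]
    have h2 : N j ≤ N (n - 2) := hmono (by omega)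
    exact ⟨N j, by omega, by rw [hN j]; exact sym2_mk_congr rfl (by push_cast; ring)⟩
  have hlast := hle (n - 2)
  refine ⟨_, p.copy (by simp) rfl, ⟨⟨?_, ?_⟩, ?_⟩, ?_, ?_⟩
  · rw [SimpleGraph.Walk.isPath_copy, ← SimpleGraph.Walk.IsPath.getVert_injOn_iff]
    intro i hi j hj h
    rw [Set.mem_ofPred_eq, hp1] at hi hj
    rw [hp2 i hi, hp2 j hj, add_right_inj, natCast_eq_iff_of_lt (by omega) (by omega)] at h
    exact h
  · intro e he
    rw [SimpleGraph.Walk.edges_copy, hp3] at he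
    obtain ⟨q, hq, rfl⟩ := he
    exact isSide_of_eq (.inl (by push_cast; ring))
  · intro u v q hq hqs
    rw [SimpleGraph.Walk.length_copy, ← SimpleGraph.Walk.length_edges,
      ← SimpleGraph.Walk.length_edges]
    exact (hq.isTrail.edges_nodup.subperm fun e he =>
      hside e (q.edges_subset_edgeSet he) (hqs e he)).length_le
  · intro j hj
    rw [SimpleGraph.Walk.length_copy, hp1] at hj
    rw [SimpleGraph.Walk.getVert_copy, hp2 j hj]
  · simpa using hside

/-- Whether the next arc grows to the left can be read off from the tree. -/
lemma arcTree_adj_iff (hn : 3 ≤ n) (hr : IsStepSeq r) {i : ℕ} (hi : i + 2 < n) :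
    (arcTree r).Adj (r i - ((i + 1 : ℕ) : ZMod n)) (r i) ↔ r (i + 1) = r i := by
  have hn2 : 2 ≤ n := by omega
  constructor
  · intro h
    by_contra hne
    have hup := (hr i).resolve_left hne
    obtain ⟨k, hk, hky⟩ := exists_eq_arcVertex hn2 hr (r i - ((i + 1 : ℕ) : ZMod n))
    -- After an up-step the vertex below the arc is still missing at index `i + 1`. An edge from it
    -- to `r i` would require the end of the arc, already above `r i`, to return to `r i`.
    have h1 : i + 1 < k := by
      by_contra hlt
      have := (arcVertex_mem_iff hn2 hr (j := i + 1) hk (by omega)).2 (by omega)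
      rw [← hky, hup, show r i - ((i + 1 : ℕ) : ZMod n) = r i + 1 - ((i + 2 : ℕ) : ZMod n) by
        push_cast; ring, sub_mem_arcSet_iff (by omega) (by omega)] at this
      omega
    obtain ⟨j, hj, h⟩ := (arcTree_adj hn2 hr).1 h
    rw [arcEdge, Sym2.eq_iff, hky] at h
    rcases h with ⟨h2, h3⟩ | ⟨h2, h3⟩
    · have h4 : j + 1 ≤ i := (arcVertex_mem_iff hn2 hr hj (by omega)).1
        (h3 ▸ self_mem_arcSet _ _)
      have h5 : k ≤ i := (arcVertex_mem_iff hn2 hr hk (by omega)).1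
        (h2 ▸ mem_arcSet_of_le hn2 hr (by omega))
      omega
    · have h4 := arcVertex_inj hn2 hr hk hj h2
      obtain ⟨e, he, h5⟩ := hr.exists_add (i + 1) (j - (i + 1))
      rw [show i + 1 + (j - (i + 1)) = j by omega, ← h3, hup] at h5
      exact absurd (by push_cast; linear_combination -h5)
        (natCast_ne_zero_of_lt (n := n) (k := e + 1) (by omega) (by omega))
  · intro h
    have := arcTree_adj_of_lt hn2 hr (j := i) (by omega)
    rw [arcVertex_succ_of_eq h] at this
    exact this.symm

end ArcTree

/-! ### The structure of geometric caterpillars -/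

section Trees
variable {V : Type*} {G : SimpleGraph V}

lemma mem_of_reachable {X : Set V} (hX : ∀ x ∈ X, ∀ y, G.Adj x y → y ∈ X) {x y : V}
    (h : G.Reachable x y) (hx : x ∈ X) : y ∈ X := by
  obtain ⟨p⟩ := h
  induction p with
  | nil => exact hx
  | cons h _ ih => exact ih (hX _ hx _ h)

lemma exists_adj_of_connected [Nontrivial V] (hG : G.Connected) (x : V) : ∃ y, G.Adj x y := by
  by_contra! h
  obtain ⟨y, hy⟩ := exists_ne x
  exact hy (mem_of_reachable (X := {x}) (by rintro z rfl w hw; exact absurd hw (h w))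
    (hG.preconnected x y) rfl)

lemma exists_adj_ne_of_not_isLeaf [Nontrivial V] (hG : G.Connected) {x : V}
    (hx : ¬ IsLeaf G x) (t : V) : ∃ y, y ≠ t ∧ G.Adj x y := by
  by_contra! h
  obtain ⟨y, hy⟩ := exists_adj_of_connected hG x
  have hall : ∀ z, G.Adj x z → z = t := fun z hz => by
    by_contra hne; exact h z hne hz
  exact hx ⟨y, hy, fun z hz => (hall z hz).trans (hall y hy).symm⟩

/-- Two adjacent leaves form a component on their own, so a third vertex cannot be reached. -/
lemma not_isLeaf_of_adj (hG : G.Connected) {x y z : V} (hzx : z ≠ x) (hzy : z ≠ y)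
    (hxy : G.Adj x y) (hx : IsLeaf G x) : ¬ IsLeaf G y := by
  intro hy
  have h : z ∈ ({x, y} : Set V) := by
    refine mem_of_reachable (X := {x, y}) ?_ (hG.preconnected x z) (.inl rfl)
    rintro a (rfl | rfl) b hb
    · exact .inr (hx.unique hb hxy)
    · exact .inl (hy.unique hb hxy.symm)
  rcases h with h | h
  · exact hzx h
  · exact hzy h

lemma exists_isLeaf [Finite V] [Nontrivial V] (hG : G.IsTree) : ∃ x, IsLeaf G x := by
  classical
  have := Fintype.ofFinite V
  obtain ⟨x, hx⟩ := hG.exists_vert_degree_one_of_nontrivial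
  refine ⟨x, ?_⟩
  rw [isLeaf_iff_ncard, Set.ncard_eq_toFinset_card']
  exact hx

lemma eq_of_le_of_isTree [Finite V] {H : SimpleGraph V} (h : H ≤ G) (hH : H.IsTree)
    (hG : G.IsTree) : H = G := by
  have h1 := (SimpleGraph.isTree_iff_connected_and_card.1 hH).2
  have h2 := (SimpleGraph.isTree_iff_connected_and_card.1 hG).2
  rw [← SimpleGraph.edgeSet_inj]
  refine Set.eq_of_subset_of_ncard_le (SimpleGraph.edgeSet_mono h) ?_ (Set.toFinite _)
  rw [Set.ncard, Set.ncard, Set.encard, Set.encard]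
  change Nat.card G.edgeSet ≤ Nat.card H.edgeSet
  omega

end Trees

/-! ### The spine of a caterpillar and its reconstruction by growing arcs. -/

section Structure
variable {n : ℕ}

/-- Coordinates run from `1` to `n`, so that the leaf `a` preceding the non-leaves comes last. -/
lemma exists_coordinate [NeZero n] (a x : ZMod n) : ∃ q, 1 ≤ q ∧ q ≤ n ∧ x = a + (q : ZMod n) := by
  rcases Nat.eq_zero_or_pos (x - a).val with h | h
  · refine ⟨n, NeZero.one_le, le_rfl, ?_⟩
    rw [ZMod.val_eq_zero] at h
    rw [ZMod.natCast_self]; linear_combination h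
  · refine ⟨(x - a).val, h, (ZMod.val_lt _).le, ?_⟩
    rw [ZMod.natCast_zmod_val]; ring

lemma coordinate_inj [NeZero n] {a : ZMod n} {p q : ℕ} (hp : 1 ≤ p) (hp' : p ≤ n) (hq : 1 ≤ q)
    (hq' : q ≤ n) (h : a + (p : ZMod n) = a + (q : ZMod n)) : p = q := by
  rw [add_right_inj] at h
  have := (intCast_eq_iff (n := n) (x := p) (y := q) (by omega) (by omega)).1 (by simpa using h)
  exact_mod_cast this

/-- Coordinates in which the non-leaves of a caterpillar are `1, …, s`. -/
structure SpineCoordinates (C : Caterpillar n) (a : ZMod n) (s : ℕ) : Prop where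
  three_le : 3 ≤ n
  one_le : 1 ≤ s
  lt : s < n
  not_leaf : ∀ q, 1 ≤ q → q ≤ s → ¬ IsLeaf C.1 (a + (q : ZMod n))
  leaf : ∀ q, s < q → q ≤ n → IsLeaf C.1 (a + (q : ZMod n))

/-- A tree has a leaf, so the interval of non-leaves is not everything; the neighbor of that leaf is
not a leaf because `n ≥ 3`, so it is not empty. -/
lemma Caterpillar.exists_spineCoordinates (hn : 3 ≤ n) (C : Caterpillar n) :
    ∃ a s, SpineCoordinates C a s := by
  have : NeZero n := ⟨by omega⟩
  have : Fact (1 < n) := ⟨by omega⟩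
  obtain ⟨c, k, hk⟩ := C.2.2.2
  have hmem : ∀ x, ¬ IsLeaf C.1 x ↔ ∃ j < k, x = c + (j : ZMod n) := fun x => by
    have := Set.ext_iff.1 hk x; simpa using this
  obtain ⟨x, hx⟩ := exists_isLeaf C.2.1
  have hkn : k < n := by
    by_contra h
    refine (hmem x).2 ⟨(x - c).val, (ZMod.val_lt _).trans_le (by omega), ?_⟩ hx
    rw [ZMod.natCast_zmod_val]; ring
  have hk1 : 1 ≤ k := by
    obtain ⟨y, hy⟩ := exists_adj_of_connected C.2.1.connected x
    obtain ⟨z, hz⟩ : ∃ z, z ∉ ({x, y} : Finset (ZMod n)) := by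
      by_contra! h
      have h1 := Finset.card_le_card (show Finset.univ ⊆ ({x, y} : Finset (ZMod n)) from
        fun z _ => h z)
      have h2 := Finset.card_le_two (a := x) (b := y)
      rw [Finset.card_univ, ZMod.card] at h1
      omega
    simp only [Finset.mem_insert, Finset.mem_singleton, not_or] at hz
    obtain ⟨j, hj, -⟩ := (hmem y).1 (not_isLeaf_of_adj C.2.1.connected hz.1 hz.2 hy hx)
    omega
  refine ⟨c - 1, k, hn, hk1, hkn, fun q h1 h2 => (hmem _).2 ⟨q - 1, by omega, ?_⟩,
    fun q h1 h2 => ?_⟩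
  · rw [Nat.cast_sub h1]; push_cast; ring
  · by_contra h
    obtain ⟨j, hj, h⟩ := (hmem _).1 h
    have := coordinate_inj (a := c - 1) (p := q) (q := j + 1) (by omega) h2 (by omega) (by omega)
      (by rw [h]; push_cast; ring)
    omega

variable {C : Caterpillar n} {a : ZMod n} {s : ℕ}

lemma Caterpillar.not_adj_of_alternating [NeZero n] (C : Caterpillar n) {i j k l : ℕ} (hij : i < j)
    (hjk : j < k) (hkl : k < l) (hl : l < i + n) (h1 : C.1.Adj (a + (i : ZMod n)) (a + (k : ZMod n)))
    (h2 : C.1.Adj (a + (j : ZMod n)) (a + (l : ZMod n))) : False := by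
  obtain ⟨y, rfl⟩ := exists_int_coordinate a
  refine C.2.2.1 _ (C.1.mem_edgeSet.2 h1) _ (C.1.mem_edgeSet.2 h2) ?_
  have e : ∀ q : ℕ, (y : ZMod n) + (q : ZMod n) = ((y + q : ℤ) : ZMod n) := fun q => by
    push_cast; rfl
  rw [e, e, e, e, crosses_intCast_iff (b := y + i) (by omega) (by omega) (by omega) (by omega)
    (by omega) (by omega)]
  omega

namespace SpineCoordinates

lemma nontrivial (h : SpineCoordinates C a s) : Nontrivial (ZMod n) := by
  have := h.three_le
  have : Fact (1 < n) := ⟨by omega⟩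
  infer_instance

lemma neZero (h : SpineCoordinates C a s) : NeZero n := ⟨by have := h.three_le; omega⟩

/-- A non-leaf has a neighbor other than any given vertex. -/
lemma exists_adj_ne (h : SpineCoordinates C a s) {q : ℕ} (h1 : 1 ≤ q) (h2 : q ≤ s) (t : ℕ) :
    ∃ p, 1 ≤ p ∧ p ≤ n ∧ p ≠ t ∧ p ≠ q ∧ C.1.Adj (a + (q : ZMod n)) (a + (p : ZMod n)) := by
  have := h.nontrivial
  have := h.neZero
  obtain ⟨y, hy, hadj⟩ := exists_adj_ne_of_not_isLeaf C.2.1.connected (h.not_leaf q h1 h2)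
    (a + (t : ZMod n))
  obtain ⟨p, hp1, hp2, rfl⟩ := exists_coordinate a y
  refine ⟨p, hp1, hp2, ?_, ?_, hadj⟩
  · rintro rfl; exact hy rfl
  · rintro rfl; exact hadj.ne rfl

/-- A leaf is adjacent to a non-leaf. -/
lemma exists_adj_of_leaf (h : SpineCoordinates C a s) {y : ℕ} (h1 : s < y) (h2 : y ≤ n) :
    ∃ p, 1 ≤ p ∧ p ≤ s ∧ C.1.Adj (a + (p : ZMod n)) (a + (y : ZMod n)) := by
  have := h.nontrivial
  have := h.neZero
  have hl := h.leaf y h1 h2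
  obtain ⟨x, hx⟩ := exists_adj_of_connected C.2.1.connected (a + (y : ZMod n))
  obtain ⟨p, hp1, hp2, rfl⟩ := exists_coordinate a x
  refine ⟨p, hp1, ?_, hx.symm⟩
  by_contra hlt
  have h3 := h.three_le
  have hs := h.one_le
  obtain ⟨z, hz1, hz2, hz3, hz4⟩ : ∃ z, 1 ≤ z ∧ z ≤ n ∧ z ≠ y ∧ z ≠ p := by
    exact ⟨1, le_rfl, by omega, by omega, by omega⟩
  refine not_isLeaf_of_adj C.2.1.connected (z := a + (z : ZMod n)) ?_ ?_ hx hl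
    (h.leaf p (by omega) hp2)
  · intro e; exact hz3 (coordinate_inj hz1 hz2 (by omega) h2 e)
  · intro e; exact hz4 (coordinate_inj hz1 hz2 hp1 hp2 e)

/-- Adjacent non-leaves are consecutive. -/
lemma not_adj_of_two_le (h : SpineCoordinates C a s) (d : ℕ) : ∀ i, 1 ≤ i → 2 ≤ d → i + d ≤ s →
    ¬ C.1.Adj (a + (i : ZMod n)) (a + ((i + d : ℕ) : ZMod n)) := by
  have := h.neZero
  have hlt := h.lt
  induction d using Nat.strong_induction_on with
  | _ d ih =>
    intro i hi hd hid hadj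
    -- The edge from `i` to `i + d` confines the neighbors of a vertex strictly between to the same
    -- range, and by induction they are consecutive to it.
    have hnb : ∀ q p, i < q → q < i + d → 1 ≤ p → p ≤ n → p ≠ q →
        C.1.Adj (a + (q : ZMod n)) (a + (p : ZMod n)) → p = q + 1 ∨ p + 1 = q := by
      intro q p hq1 hq2 hp1 hp2 hpq hqp
      have hp3 : i ≤ p := by
        by_contra hlt
        exact C.not_adj_of_alternating (a := a) (show p < i by omega) hq1 hq2 (by omega) hqp.symm
          hadj
      have hp4 : p ≤ i + d := by
        by_contra hlt
        exact C.not_adj_of_alternating (a := a) hq1 hq2 (show i + d < p by omega) (by omega) hadj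
          hqp
      rcases lt_or_gt_of_ne hpq with hlt | hlt
      · right
        by_contra hne
        refine ih (q - p) (by omega) p (by omega) (by omega) (by omega) ?_
        rw [show p + (q - p) = q by omega]; exact hqp.symm
      · left
        by_contra hne
        refine ih (p - q) (by omega) q (by omega) (by omega) (by omega) ?_
        rw [show q + (p - q) = p by omega]; exact hqp
    -- Each inner vertex, being a non-leaf, has a neighbor other than one given side of it, hence
    -- the other one.
    have hadj' : ∀ q, i ≤ q → q < i + d →
        C.1.Adj (a + (q : ZMod n)) (a + ((q + 1 : ℕ) : ZMod n)) := by
      intro q h1 h2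
      rcases h1.lt_or_eq with h1 | rfl
      · obtain ⟨p, hp1, hp2, hp3, hp4, hqp⟩ := h.exists_adj_ne (q := q) (by omega) (by omega) (q - 1)
        rcases hnb q p h1 h2 hp1 hp2 hp4 hqp with rfl | h'
        · exact hqp
        · omega
      · obtain ⟨p, hp1, hp2, hp3, hp4, hqp⟩ := h.exists_adj_ne (q := i + 1) (by omega) (by omega)
          (i + 2)
        rcases hnb (i + 1) p (by omega) (by omega) hp1 hp2 hp4 hqp with rfl | h'
        · omega
        · rw [show p = i by omega] at hqp
          exact hqp.symm
    -- The path of sides from `i` to `i + d` bypasses the edge, which therefore closes a cycle.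
    have hbridge := SimpleGraph.isAcyclic_iff_forall_adj_isBridge.1 C.2.1.isAcyclic hadj
    rw [SimpleGraph.isBridge_iff] at hbridge
    refine hbridge ?_
    have hreach : ∀ e ≤ d, (C.1.deleteEdges {s(a + (i : ZMod n), a + ((i + d : ℕ) : ZMod n))}).Reachable
        (a + (i : ZMod n)) (a + ((i + e : ℕ) : ZMod n)) := by
      intro e he
      induction e with
      | zero => exact .refl _
      | succ e ihe =>
        refine (ihe (by omega)).trans (SimpleGraph.Adj.reachable ?_)
        rw [SimpleGraph.deleteEdges_adj]
        refine ⟨hadj' (i + e) (by omega) (by omega), ?_⟩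
        rw [Set.mem_singleton_iff, Sym2.eq_iff]
        rintro (⟨h1, h2⟩ | ⟨h1, h2⟩)
        · have := coordinate_inj (by omega) (by omega) (by omega) (by omega) h1
          have := coordinate_inj (by omega) (by omega) (by omega) (by omega) h2
          omega
        · have := coordinate_inj (by omega) (by omega) (by omega) (by omega) h1
          omega
    exact hreach d le_rfl

lemma eq_of_adj (h : SpineCoordinates C a s) {p q : ℕ} (hp1 : 1 ≤ p) (hp : p ≤ s) (hq1 : 1 ≤ q)
    (hq : q ≤ s) (hadj : C.1.Adj (a + (p : ZMod n)) (a + (q : ZMod n))) : q = p + 1 ∨ p = q + 1 := by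
  rcases lt_trichotomy p q with hlt | rfl | hlt
  · left
    by_contra hne
    refine h.not_adj_of_two_le (q - p) p hp1 (by omega) (by omega) ?_
    rw [show p + (q - p) = q by omega]; exact hadj
  · exact absurd rfl hadj.ne
  · right
    by_contra hne
    refine h.not_adj_of_two_le (p - q) q hq1 (by omega) (by omega) ?_
    rw [show q + (p - q) = p by omega]; exact hadj.symm

lemma adj_succ_of_lt (h : SpineCoordinates C a s) {q : ℕ} (hq1 : 1 ≤ q) (hq : q < s) :
    C.1.Adj (a + (q : ZMod n)) (a + ((q + 1 : ℕ) : ZMod n)) := by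
  have := h.neZero
  have hlt := h.lt
  by_contra hno
  -- Without the edge from `q` to `q + 1`, the first `q` non-leaves and their leaves would be closed
  -- under adjacency.
  let X : Set (ZMod n) := {x | (∃ p, 1 ≤ p ∧ p ≤ q ∧ x = a + (p : ZMod n)) ∨
    (IsLeaf C.1 x ∧ ∃ p, 1 ≤ p ∧ p ≤ q ∧ C.1.Adj x (a + (p : ZMod n)))}
  have hX : ∀ x ∈ X, ∀ y, C.1.Adj x y → y ∈ X := by
    rintro x (⟨p, hp1, hp, rfl⟩ | ⟨hx, p, hp1, hp, hxp⟩) y hxy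
    · obtain ⟨p', hp1', hp2', rfl⟩ := exists_coordinate a y
      by_cases hs : p' ≤ s
      · left
        rcases h.eq_of_adj hp1 (by omega) hp1' hs hxy with h' | h'
        · refine ⟨p', hp1', ?_, rfl⟩
          by_contra hlt
          obtain rfl : p = q := by omega
          exact hno (h' ▸ hxy)
        · exact ⟨p', hp1', by omega, rfl⟩
      · exact .inr ⟨h.leaf p' (by omega) hp2', p, hp1, hp, hxy.symm⟩
    · left
      exact ⟨p, hp1, hp, hx.unique hxy hxp⟩
  have hmem : a + ((q + 1 : ℕ) : ZMod n) ∈ X :=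
    mem_of_reachable hX (C.2.1.connected.preconnected (a + (1 : ℕ)) _)
      (.inl ⟨1, le_rfl, hq1, rfl⟩)
  rcases hmem with ⟨p, hp1, hp, e⟩ | ⟨hl, -⟩
  · have := coordinate_inj (by omega) (by omega) hp1 (by omega) e
    omega
  · exact h.not_leaf (q + 1) (by omega) (by omega) hl

/-- The neighbors of leaves move against the cyclic order. -/
lemma le_of_adj_leaf (h : SpineCoordinates C a s) {y y' p p' : ℕ} (hy : s < y) (hyy : y < y')
    (hy' : y' ≤ n) (hp1 : 1 ≤ p) (hp' : p' ≤ s)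
    (h1 : C.1.Adj (a + (p : ZMod n)) (a + (y : ZMod n)))
    (h2 : C.1.Adj (a + (p' : ZMod n)) (a + (y' : ZMod n))) : p' ≤ p := by
  have := h.neZero
  by_contra hlt
  exact C.not_adj_of_alternating (a := a) (show p < p' by omega) (by omega) hyy (by omega) h1 h2

/-- The first non-leaf has a neighbor besides `2`, and it must be a leaf. By monotonicity the last
leaf, of coordinate `n`, is then attached to the first non-leaf too. -/
lemma adj_first (h : SpineCoordinates C a s) : C.1.Adj a (a + 1) := by
  have := h.neZero
  have h3 := h.three_le
  have hs := h.one_le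
  have hlt := h.lt
  obtain ⟨y, hy1, hy2, hy3, hy4, hadj⟩ := h.exists_adj_ne le_rfl hs 2
  have hys : s < y := by
    by_contra hle
    have := h.eq_of_adj le_rfl hs hy1 (by omega) hadj
    omega
  obtain ⟨p, hp1, hp2, hp⟩ := h.exists_adj_of_leaf hlt le_rfl
  have h1 : p = 1 := by
    rcases hy2.lt_or_eq with hy2 | hyn
    · have := h.le_of_adj_leaf hys hy2 le_rfl le_rfl hp2 hadj hp
      omega
    · exact (coordinate_inj (by omega) (by omega) (by omega) (by omega)
        ((h.leaf n hlt le_rfl).unique hp.symm (hyn ▸ hadj.symm)))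
  subst h1
  simpa using hp.symm

lemma adj_last (h : SpineCoordinates C a s) :
    C.1.Adj (a + (s : ZMod n)) (a + ((s + 1 : ℕ) : ZMod n)) := by
  have hs := h.one_le
  have hlt := h.lt
  obtain ⟨y, hy1, hy2, hy3, hy4, hadj⟩ := h.exists_adj_ne hs le_rfl (s - 1)
  have hys : s < y := by
    by_contra hle
    have := h.eq_of_adj hs le_rfl hy1 (by omega) hadj
    omega
  rcases (by omega : y = s + 1 ∨ s + 1 < y) with rfl | hlt'
  · exact hadj
  · obtain ⟨p, hp1, hp2, hp⟩ := h.exists_adj_of_leaf (y := s + 1) (by omega) (by omega)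
    have := h.le_of_adj_leaf (y := s + 1) (by omega) hlt' hy2 hp1 le_rfl hp hadj
    rwa [show p = s by omega] at hp

lemma adj_succ (h : SpineCoordinates C a s) {q : ℕ} (hq : q ≤ s) :
    C.1.Adj (a + (q : ZMod n)) (a + ((q + 1 : ℕ) : ZMod n)) := by
  rcases Nat.eq_zero_or_pos q with rfl | hq0
  · simpa using h.adj_first
  · rcases hq.lt_or_eq with hq | rfl
    · exact h.adj_succ_of_lt hq0 hq
    · exact h.adj_last

end SpineCoordinates

open Classical in
/-- The sequence of arcs that grows to the left whenever the caterpillar has the edge for it. -/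
noncomputable def greedySeq (C : Caterpillar n) (a : ZMod n) : ℕ → ZMod n
  | 0 => a
  -- The condition `1 ≤ i` forces the initial up-step along the first spine edge.
  | i + 1 => if 1 ≤ i ∧ C.1.Adj (greedySeq C a i - ((i + 1 : ℕ) : ZMod n)) (greedySeq C a i)
      then greedySeq C a i else greedySeq C a i + 1

lemma isStepSeq_greedySeq (C : Caterpillar n) (a : ZMod n) : IsStepSeq (greedySeq C a) := by
  intro i
  rw [greedySeq]
  split_ifs <;> simp

lemma greedySeq_one (C : Caterpillar n) (a : ZMod n) : greedySeq C a 1 = greedySeq C a 0 + 1 := by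
  simp [greedySeq]

/-- The invariant of the greedy growth: at height `N`, all leaves outside the current arc are
attached to spine vertices of coordinate at least `N`. When the growth goes up, the next leaf below
the arc is not attached to `N`, hence attached higher up, and by monotonicity so are all remaining
leaves. If `N = s`, such a leaf would have nowhere to attach, so the growth never leaves the
non-leaves. -/
lemma SpineCoordinates.greedySeq_spec (h : SpineCoordinates C a s) {i : ℕ} (hi : 1 ≤ i)
    (hin : i + 2 ≤ n) : ∃ N : ℕ, greedySeq C a i = a + (N : ZMod n) ∧ N ≤ i ∧ N ≤ s ∧
      ∀ y p, s < y → y + i + 1 ≤ n + N → 1 ≤ p → p ≤ s →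
        C.1.Adj (a + (p : ZMod n)) (a + (y : ZMod n)) → N ≤ p := by
  induction i, hi using Nat.le_induction with
  | base =>
    refine ⟨1, by simp [greedySeq], le_rfl, h.one_le, ?_⟩
    intro y p _ _ hp _ _; exact hp
  | succ i hi ih =>
    obtain ⟨N, h1, h2, h3, h4⟩ := ih (by omega)
    have hy0 : greedySeq C a i - ((i + 1 : ℕ) : ZMod n) = a + ((n + N - (i + 1) : ℕ) : ZMod n) := by
      rw [h1, Nat.cast_sub (by omega)]; push_cast; rw [ZMod.natCast_self]; ring
    by_cases hadj : C.1.Adj (greedySeq C a i - ((i + 1 : ℕ) : ZMod n)) (greedySeq C a i)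
    · have hstep : greedySeq C a (i + 1) = greedySeq C a i := by
        rw [greedySeq, if_pos ⟨hi, hadj⟩]
      exact ⟨N, by rw [hstep, h1], by omega, h3, fun y p hy hyn => h4 y p hy (by omega)⟩
    · have hstep : greedySeq C a (i + 1) = greedySeq C a i + 1 := by
        rw [greedySeq, if_neg (fun h => hadj h.2)]
      have hkey : s < n + N - (i + 1) → ∃ p, N + 1 ≤ p ∧ p ≤ s ∧ 1 ≤ p ∧
          C.1.Adj (a + (p : ZMod n)) (a + ((n + N - (i + 1) : ℕ) : ZMod n)) := by
        intro hs
        obtain ⟨p, hp1, hp2, hp⟩ := h.exists_adj_of_leaf hs (by omega)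
        have h5 := h4 _ p hs (by omega) hp1 hp2 hp
        refine ⟨p, ?_, hp2, hp1, hp⟩
        rcases h5.lt_or_eq with h5 | rfl
        · exact h5
        · rw [hy0, h1] at hadj
          exact absurd hp.symm hadj
      refine ⟨N + 1, by rw [hstep, h1]; push_cast; ring, by omega, ?_, ?_⟩
      · rcases h3.lt_or_eq with h3 | rfl
        · exact h3
        · obtain ⟨p, hp1, hp2, -⟩ := hkey (by omega)
          omega
      · intro y p hy hyn hp1 hp2 hp
        obtain ⟨p', hp1', hp2', hp3', hp'⟩ := hkey (by omega)
        rcases (by omega : y = n + N - (i + 1) ∨ y < n + N - (i + 1)) with rfl | hlt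
        · have := (h.leaf _ hy (by omega)).unique hp.symm hp'.symm
          have := h.neZero
          have := coordinate_inj (by omega) (by have := h.lt; omega) (by omega)
            (by have := h.lt; omega) ‹a + (p : ZMod n) = a + (p' : ZMod n)›
          omega
        · have := h.le_of_adj_leaf hy hlt (by omega) hp1 hp2' hp hp'
          omega

/-- Each edge of the arc tree is an edge of `C`, by the greedy choice for a step `0` and as a spine
edge for a step `1`. A tree contained in a tree on the same vertices equals it. -/
lemma SpineCoordinates.arcTree_greedySeq (h : SpineCoordinates C a s) :
    arcTree (greedySeq C a) = C.1 := by
  have := h.neZero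
  have h3 := h.three_le
  have hr := isStepSeq_greedySeq C a
  refine eq_of_le_of_isTree ?_ (arcTree_isTree (by omega) hr) C.2.1
  rw [← SimpleGraph.edgeSet_subset_edgeSet]
  intro e he
  obtain ⟨j, hj, rfl⟩ := (mem_edgeSet_arcTree (by omega) hr).1 he
  have hup : ∃ N : ℕ, greedySeq C a j = a + (N : ZMod n) ∧ N ≤ s := by
    rcases Nat.eq_zero_or_pos j with rfl | hj0
    · exact ⟨0, by rw [greedySeq]; simp, by omega⟩
    · obtain ⟨N, h1, -, h2, -⟩ := h.greedySeq_spec hj0 (by omega)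
      exact ⟨N, h1, h2⟩
  by_cases hadj : 1 ≤ j ∧ C.1.Adj (greedySeq C a j - ((j + 1 : ℕ) : ZMod n)) (greedySeq C a j)
  · have hs : greedySeq C a (j + 1) = greedySeq C a j := by rw [greedySeq, if_pos hadj]
    rw [arcEdge_of_eq hs, SimpleGraph.mem_edgeSet]
    exact hadj.2.symm
  · have hs : greedySeq C a (j + 1) = greedySeq C a j + 1 := by rw [greedySeq, if_neg hadj]
    obtain ⟨N, h1, h2⟩ := hup
    rw [arcEdge_of_eq_add (by omega) hs, SimpleGraph.mem_edgeSet, h1]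
    have := h.adj_succ h2
    push_cast at this
    rwa [← add_assoc] at this

/-- Every caterpillar is the tree of a growing sequence of arcs. -/
theorem Caterpillar.exists_arcTree_eq (hn : 3 ≤ n) (C : Caterpillar n) :
    ∃ r : ℕ → ZMod n, IsStepSeq r ∧ r 1 = r 0 + 1 ∧ arcTree r = C.1 := by
  obtain ⟨a, s, h⟩ := C.exists_spineCoordinates hn
  exact ⟨greedySeq C a, isStepSeq_greedySeq C a, greedySeq_one C a, h.arcTree_greedySeq⟩

end Structure

/-! ### Shifts of geometric caterpillars -/

section Counting

/-- For a monotone sequence the values `≤ q` are taken by an initial segment of indices. -/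
lemma le_iff_le_card {N : ℕ → ℕ} {M : ℕ} (hN : ∀ i j, 1 ≤ i → i ≤ j → j ≤ M → N i ≤ N j) (q : ℕ)
    {j : ℕ} (h1 : 1 ≤ j) (hM : j ≤ M) :
    N j ≤ q ↔ j ≤ ((Finset.Icc 1 M).filter fun i => N i ≤ q).card := by
  constructor
  · intro h
    have : Finset.Icc 1 j ⊆ (Finset.Icc 1 M).filter fun i => N i ≤ q := by
      intro i hi
      rw [Finset.mem_Icc] at hi
      rw [Finset.mem_filter, Finset.mem_Icc]
      exact ⟨⟨hi.1, by omega⟩, (hN i j hi.1 hi.2 hM).trans h⟩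
    simpa using Finset.card_le_card this
  · intro h
    by_contra hlt
    have : ((Finset.Icc 1 M).filter fun i => N i ≤ q) ⊆ Finset.Icc 1 (j - 1) := by
      intro i hi
      rw [Finset.mem_filter, Finset.mem_Icc] at hi
      rw [Finset.mem_Icc]
      refine ⟨hi.1.1, ?_⟩
      by_contra hij
      have := hN j i h1 (by omega) hi.1.2
      omega
    have := Finset.card_le_card this
    rw [Nat.card_Icc] at this
    omega

variable {n : ℕ}

lemma val_add_one_of_ne [NeZero n] {x : ZMod n} (h : x + 1 ≠ 0) : (x + 1).val = x.val + 1 := by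
  have h1 : x + 1 = ((x.val + 1 : ℕ) : ZMod n) := by push_cast; rw [ZMod.natCast_zmod_val]
  have h2 := ZMod.val_lt x
  rcases (by omega : x.val + 1 = n ∨ x.val + 1 < n) with h3 | h3
  · rw [h1, h3, ZMod.natCast_self] at h
    exact absurd rfl h
  · rw [h1, ZMod.val_cast_of_lt h3]

/-- Cutting the circle at a vertex `y` that the sequence misses turns its steps into a monotone
sequence of natural numbers. -/
lemma IsStepSeq.val_sub_mono [NeZero n] {r : ℕ → ZMod n} (hr : IsStepSeq r) {y : ZMod n} {M : ℕ}
    (hy : ∀ j, 1 ≤ j → j ≤ M → r j ≠ y) :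
    ∀ i j, 1 ≤ i → i ≤ j → j ≤ M → (r i - y).val ≤ (r j - y).val := by
  intro i j hi hij
  induction j, hij using Nat.le_induction with
  | base => intro _; exact le_rfl
  | succ j hij ih =>
    intro hj
    refine (ih (by omega)).trans ?_
    rcases hr j with h | h
    · rw [h]
    · have hne : r j - y + 1 ≠ 0 := by
        intro h0
        exact hy (j + 1) (by omega) hj (by rw [h]; linear_combination h0)
      rw [h, show r j + 1 - y = r j - y + 1 by ring, val_add_one_of_ne hne]
      omega

lemma card_le_eq_sum_spineCount [NeZero n] (r : ℕ → ZMod n) (y : ZMod n) (q : ℕ) :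
    ((Finset.Icc 1 (n - 2)).filter fun i => (r i - y).val ≤ q).card =
      ∑ x ∈ Finset.univ.filter (fun x : ZMod n => (x - y).val ≤ q), spineCount r x := by
  classical
  rw [Finset.card_eq_sum_card_fiberwise (f := r)
    (t := Finset.univ.filter (fun x : ZMod n => (x - y).val ≤ q))]
  · refine Finset.sum_congr rfl fun x hx => ?_
    rw [Finset.mem_filter] at hx
    rw [spineCount, Finset.filter_filter]
    congr 1
    ext i
    simp only [Finset.mem_filter]
    refine and_congr_right fun _ => ⟨fun h => h.2, fun h => ⟨h ▸ hx.2, h⟩⟩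
  · intro i hi
    rw [Finset.mem_coe, Finset.mem_filter] at hi
    rw [Finset.mem_coe, Finset.mem_filter]
    exact ⟨Finset.mem_univ _, hi.2⟩

/-- There are at most `n - 2` values, so besides `x` some vertex is missed and can serve as a cut
point. -/
lemma exists_not_value (hn : 2 ≤ n) (r : ℕ → ZMod n) (x : ZMod n) :
    ∃ y, y ≠ x ∧ ∀ j, 1 ≤ j → j ≤ n - 2 → r j ≠ y := by
  classical
  have : NeZero n := ⟨by omega⟩
  by_contra! h
  have h1 : Finset.univ ⊆ insert x ((Finset.Icc 1 (n - 2)).image r) := by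
    intro y _
    rw [Finset.mem_insert, Finset.mem_image]
    by_cases hyx : y = x
    · exact .inl hyx
    · obtain ⟨j, h1, h2, h3⟩ := h y hyx
      exact .inr ⟨j, Finset.mem_Icc.2 ⟨h1, h2⟩, h3⟩
  have h2 := Finset.card_le_card h1
  have h3 := Finset.card_insert_le x ((Finset.Icc 1 (n - 2)).image r)
  have h4 := Finset.card_image_le (s := Finset.Icc 1 (n - 2)) (f := r)
  rw [Finset.card_univ, ZMod.card] at h2
  rw [Nat.card_Icc] at h4
  omega

lemma sub_val_inj [NeZero n] {x x' y : ZMod n} (h : (x - y).val = (x' - y).val) : x = x' :=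
  sub_left_injective (ZMod.val_injective n h)

lemma exists_index_of_spineCount_pos {r : ℕ → ZMod n} {x : ZMod n} (h : spineCount r x ≠ 0) :
    ∃ j, 1 ≤ j ∧ j ≤ n - 2 ∧ r j = x := by
  rw [Ne, spineCount_eq_zero_iff] at h
  push Not at h
  exact h

lemma spineCount_pos {r : ℕ → ZMod n} {j : ℕ} (h1 : 1 ≤ j) (h2 : j ≤ n - 2) :
    spineCount r (r j) ≠ 0 := fun h => (spineCount_eq_zero_iff _).1 h j h1 h2 rfl

/-- A monotone sequence is determined by how often it takes each value. Both sequences have the same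
values, so one cut point works for both. -/
lemma eq_of_spineCount_eq (hn : 2 ≤ n) {r r' : ℕ → ZMod n} (hr : IsStepSeq r)
    (hr' : IsStepSeq r') (h : ∀ x, spineCount r x = spineCount r' x) :
    ∀ j, 1 ≤ j → j ≤ n - 2 → r j = r' j := by
  have : NeZero n := ⟨by omega⟩
  obtain ⟨y, -, hy⟩ := exists_not_value hn r 0
  have hy' : ∀ j, 1 ≤ j → j ≤ n - 2 → r' j ≠ y := by
    rintro j h1 h2 rfl
    obtain ⟨i, hi1, hi2, hi⟩ := exists_index_of_spineCount_pos
      (h (r' j) ▸ spineCount_pos h1 h2 : spineCount r (r' j) ≠ 0)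
    exact hy i hi1 hi2 hi
  intro j h1 h2
  refine sub_val_inj (y := y) (eq_of_forall_ge_iff fun q => ?_)
  rw [le_iff_le_card (hr.val_sub_mono hy) q h1 h2, le_iff_le_card (hr'.val_sub_mono hy') q h1 h2,
    card_le_eq_sum_spineCount, card_le_eq_sum_spineCount, Finset.sum_congr rfl fun x _ => h x]

/-- Moving one value `w` of a growing sequence to `w + 1` changes it at a single index. -/
lemma exists_index_of_spineCount_shift (hn : 2 ≤ n) {r r' : ℕ → ZMod n} (hr : IsStepSeq r)
    (hr' : IsStepSeq r') {w : ZMod n} (h : ∀ x, spineCount r' x + (if x = w then 1 else 0) =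
      spineCount r x + (if x = w + 1 then 1 else 0)) :
    ∃ i, 1 ≤ i ∧ i ≤ n - 2 ∧ r i ≠ r' i ∧ ∀ j, 1 ≤ j → j ≤ n - 2 → j ≠ i → r j = r' j := by
  have : NeZero n := ⟨by omega⟩
  -- Choosing `y ≠ w + 1` makes `r'` miss `y` as well and keeps `w` and `w + 1` consecutive after
  -- the cut.
  obtain ⟨y, hyw, hy⟩ := exists_not_value hn r (w + 1)
  have hy' : ∀ j, 1 ≤ j → j ≤ n - 2 → r' j ≠ y := by
    rintro j h1 h2 rfl
    have h3 := spineCount_pos (r := r') h1 h2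
    have h4 := h (r' j)
    rw [if_neg hyw] at h4
    obtain ⟨i, hi1, hi2, hi⟩ := exists_index_of_spineCount_pos (r := r) (x := r' j) (by omega)
    exact hy i hi1 hi2 hi
  set p := (w - y).val with hp
  have hp1 : (w + 1 - y).val = p + 1 := by
    rw [show w + 1 - y = w - y + 1 by ring, val_add_one_of_ne]
    intro h0
    exact hyw (by linear_combination -h0)
  set F : ℕ → ℕ := fun q => ((Finset.Icc 1 (n - 2)).filter fun i => (r i - y).val ≤ q).card with hF
  set F' : ℕ → ℕ := fun q => ((Finset.Icc 1 (n - 2)).filter fun i => (r' i - y).val ≤ q).card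
    with hF'
  -- The two counting functions differ only at `q = p`, where `F'` is smaller by one.
  have hsum : ∀ q, F' q + (if p ≤ q then 1 else 0) = F q + (if p + 1 ≤ q then 1 else 0) := by
    intro q
    have hite : ∀ z : ZMod n, (∑ x ∈ Finset.univ.filter (fun x : ZMod n => (x - y).val ≤ q),
        if x = z then 1 else 0) = if (z - y).val ≤ q then 1 else 0 := by
      intro z
      rw [Finset.sum_ite_eq']
      simp
    rw [← hp1, hp, ← hite w, ← hite (w + 1), hF, hF']
    simp only
    rw [card_le_eq_sum_spineCount, card_le_eq_sum_spineCount, ← Finset.sum_add_distrib,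
      ← Finset.sum_add_distrib]
    exact Finset.sum_congr rfl fun x _ => h x
  have hle : ∀ q j, 1 ≤ j → j ≤ n - 2 → ((r j - y).val ≤ q ↔ j ≤ F q) := fun q j h1 h2 =>
    le_iff_le_card (hr.val_sub_mono hy) q h1 h2
  have hle' : ∀ q j, 1 ≤ j → j ≤ n - 2 → ((r' j - y).val ≤ q ↔ j ≤ F' q) := fun q j h1 h2 =>
    le_iff_le_card (hr'.val_sub_mono hy') q h1 h2
  have hFp := hsum p
  rw [if_pos le_rfl, if_neg (by omega)] at hFp
  have hFle : F p ≤ n - 2 := by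
    have : F p ≤ _ := Finset.card_filter_le (Finset.Icc 1 (n - 2)) fun i => (r i - y).val ≤ p
    rw [Nat.card_Icc] at this
    omega
  -- The index `F p` is the last one at which `r` has height at most `p`.
  refine ⟨F p, by omega, hFle, fun he => ?_, fun j h1 h2 hj => ?_⟩
  · have e1 := (hle p (F p) (by omega) hFle).2 le_rfl
    rw [he, hle' p (F p) (by omega) hFle] at e1
    omega
  · refine sub_val_inj (y := y) (eq_of_forall_ge_iff fun q => ?_)
    rw [hle q j h1 h2, hle' q j h1 h2]
    have hq := hsum q
    rcases lt_trichotomy q p with hqp | rfl | hqp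
    · rw [if_neg (by omega), if_neg (by omega)] at hq
      rw [show F q = F' q by omega]
    · omega
    · rw [if_pos (by omega), if_pos (by omega)] at hq
      rw [show F q = F' q by omega]

end Counting

/-! ### Shifts of caterpillars, degrees, and the isomorphism. -/

section Shifts
variable {n : ℕ}

lemma ncard_neighborSet_insert {V : Type*} [Finite V] [DecidableEq V] {G E : SimpleGraph V}
    {p q : V} (hpq : p ≠ q) (hE : ¬ E.Adj p q) (hG : G.edgeSet = insert s(p, q) E.edgeSet) (y : V) :
    (G.neighborSet y).ncard =
      (E.neighborSet y).ncard + (if y = p then 1 else 0) + (if y = q then 1 else 0) := by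
  have hadj : ∀ a b, G.Adj a b ↔ (a = p ∧ b = q ∨ a = q ∧ b = p) ∨ E.Adj a b := by
    intro a b
    rw [← SimpleGraph.mem_edgeSet, hG, Set.mem_insert_iff, Sym2.eq_iff, SimpleGraph.mem_edgeSet]
  by_cases h1 : y = p
  · subst h1
    have : G.neighborSet y = insert q (E.neighborSet y) := by
      ext b
      rw [SimpleGraph.mem_neighborSet, hadj, Set.mem_insert_iff, SimpleGraph.mem_neighborSet]
      simp [hpq]
    rw [this, Set.ncard_insert_of_notMem (by simpa using hE) (Set.toFinite _), if_pos rfl,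
      if_neg hpq]
  · by_cases h2 : y = q
    · subst h2
      have : G.neighborSet y = insert p (E.neighborSet y) := by
        ext b
        rw [SimpleGraph.mem_neighborSet, hadj, Set.mem_insert_iff, SimpleGraph.mem_neighborSet]
        simp [h1]
      rw [this, Set.ncard_insert_of_notMem (by simpa using fun h => hE h.symm) (Set.toFinite _),
        if_pos rfl, if_neg h1]
    · have : G.neighborSet y = E.neighborSet y := by
        ext b
        rw [SimpleGraph.mem_neighborSet, hadj, SimpleGraph.mem_neighborSet]
        simp [h1, h2]
      rw [this, if_neg h1, if_neg h2, add_zero, add_zero]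

/-- The effect of a shift on the degrees. -/
lemma CaterpillarShift.exists_ncard (hn : 2 ≤ n) {C D : Caterpillar n} (h : CaterpillarShift C D) :
    ∃ w w' : ZMod n, IsSide s(w, w') ∧ ∀ y, (D.1.neighborSet y).ncard + (if y = w then 1 else 0) =
      (C.1.neighborSet y).ncard + (if y = w' then 1 else 0) := by
  have : NeZero n := ⟨by omega⟩
  obtain ⟨u, v, p, hp, x, w, w', hadj, hw, hD⟩ := h
  have hside : IsSide s(w, w') := hp.1.2 _ hw
  have hxw' : x ≠ w' := by
    rintro rfl
    have : s(x, x) ∈ D.1.edgeSet := hD ▸ Or.inr rfl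
    exact (D.1.mem_edgeSet.1 this).ne rfl
  have hcard : ∀ C : Caterpillar n, C.1.edgeSet.ncard + 1 = n := fun C => by
    have := (SimpleGraph.isTree_iff_connected_and_card.1 C.2.1).2
    rwa [Nat.card_zmod] at this
  -- If the new edge were already present, `D` would have one edge fewer than `C`, but both are
  -- trees on the same vertices.
  have hE : ¬ (C.1.deleteEdges {s(x, w)}).Adj x w' := by
    intro hE
    rw [← SimpleGraph.mem_edgeSet, SimpleGraph.edgeSet_deleteEdges] at hE
    have h1 : D.1.edgeSet = C.1.edgeSet \ {s(x, w)} := by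
      rw [hD]
      exact Set.union_eq_left.2 (Set.singleton_subset_iff.2 hE)
    have h2 := hcard C
    have h3 := hcard D
    have h4 := Set.ncard_sdiff_singleton_add_one (C.1.mem_edgeSet.2 hadj) (Set.toFinite _)
    rw [← h1] at h4
    omega
  refine ⟨w, w', hside, fun y => ?_⟩
  have e1 := ncard_neighborSet_insert (G := C.1) (E := C.1.deleteEdges {s(x, w)}) hadj.ne
    (by simp) (by
      rw [SimpleGraph.edgeSet_deleteEdges, Set.insert_sdiff_singleton,
        Set.insert_eq_of_mem (C.1.mem_edgeSet.2 hadj)]) y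
  have e2 := ncard_neighborSet_insert (G := D.1) (E := C.1.deleteEdges {s(x, w)}) hxw' hE (by
      rw [hD, SimpleGraph.edgeSet_deleteEdges, Set.union_singleton]) y
  omega

lemma arcEdge_congr (hn : 2 ≤ n) {r r' : ℕ → ZMod n} (hr : IsStepSeq r) (hr' : IsStepSeq r') {j : ℕ}
    (hj : j + 1 < n) (h : r j = r' j) (h' : j + 2 < n → r (j + 1) = r' (j + 1)) :
    arcEdge r j = arcEdge r' j := by
  rcases (by omega : j + 2 < n ∨ j + 2 = n) with hj' | hj'
  · rw [arcEdge, arcEdge, arcVertex, arcVertex, h, h' hj']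
  · rw [arcEdge_last hn hr hj', arcEdge_last hn hr' hj', h]

lemma arcTree_congr (hn : 2 ≤ n) {r r' : ℕ → ZMod n} (hr : IsStepSeq r) (hr' : IsStepSeq r')
    (h : ∀ j ≤ n - 2, r j = r' j) : arcTree r = arcTree r' := by
  rw [← SimpleGraph.edgeSet_inj]
  ext e
  rw [mem_edgeSet_arcTree hn hr, mem_edgeSet_arcTree hn hr']
  refine exists_congr fun j => and_congr_right fun hj => ?_
  rw [arcEdge_congr hn hr hr' hj (h j (by omega)) fun h' => h _ (by omega)]

/-- Raising a growing sequence at a single index shifts an edge of the caterpillar. -/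
lemma caterpillarShift_of_eq_add_one (hn : 3 ≤ n) {r r' : ℕ → ZMod n} (hr : IsStepSeq r)
    (hr' : IsStepSeq r') (h01 : r 1 = r 0 + 1) (h01' : r' 1 = r' 0 + 1) {C D : Caterpillar n}
    (hC : arcTree r = C.1) (hD : arcTree r' = D.1) {k : ℕ} (hk1 : 1 ≤ k) (hk : k ≤ n - 2)
    (hkk : r' k = r k + 1) (h : ∀ j, 1 ≤ j → j ≤ n - 2 → j ≠ k → r j = r' j) :
    CaterpillarShift C D := by
  obtain ⟨C, hC'⟩ := C
  obtain ⟨D, hD'⟩ := D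
  simp only at hC hD
  subst hC hD
  have hn2 : 2 ≤ n := by omega
  have hne1 : ∀ x : ZMod n, x ≠ x + 1 := fun x hx =>
    zmod_one_ne_zero hn2 (by linear_combination -hx)
  have hne2 : ∀ x : ZMod n, x ≠ x + 1 + 1 := fun x hx =>
    zmod_two_ne_zero hn (by linear_combination -hx)
  have hother : ∀ j, j + 1 < n → j ≠ k → j + 1 ≠ k → arcEdge r j = arcEdge r' j := by
    intro j hj hjk hjk'
    have h0 : r j = r' j := by
      rcases Nat.eq_zero_or_pos j with rfl | hj0
      · have := h 1 le_rfl (by omega) (by omega)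
        rw [h01, h01'] at this
        exact add_right_cancel this
      · exact h j hj0 (by omega) hjk
    exact arcEdge_congr hn2 hr hr' hj h0 fun h' => h _ (by omega) (by omega) hjk'
  obtain ⟨i, rfl⟩ : ∃ i, k = i + 1 := ⟨k - 1, by omega⟩
  set w := r (i + 1) with hw
  -- Only the edges of index `i` and `i + 1` change. The spine edge `{w, w + 1}` moves from index `i
  -- + 1` to index `i`, and `{w - (i + 1), w}` is replaced by `{w - (i + 1), w + 1}`.
  have e1 : arcEdge r i = s(w - ((i + 1 : ℕ) : ZMod n), w) ∧ arcEdge r' i = s(w, w + 1) := by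
    rcases Nat.eq_zero_or_pos i with rfl | hi
    · have h0' : r' 0 = w := by
        rw [zero_add] at hkk hw
        rw [h01'] at hkk
        rw [hw]
        exact add_right_cancel hkk
      rw [arcEdge_of_eq_add hn2 (show r (0 + 1) = r 0 + 1 from h01),
        arcEdge_of_eq_add hn2 (show r' (0 + 1) = r' 0 + 1 from h01'), h0', hw]
      refine ⟨?_, rfl⟩
      rw [zero_add, h01]; exact sym2_mk_congr (by push_cast; ring) rfl
    · have h0 := h i hi (by omega) (by omega)
      have hs := hr i
      have hs' := hr' i
      rw [hkk, ← h0] at hs'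
      rw [← hw] at hs
      have hwi : w = r i := by
        rcases hs with hs | hs
        · exact hs
        · rw [hs] at hs'
          rcases hs' with hs' | hs'
          · exact absurd hs'.symm (hne2 _)
          · exact absurd (add_right_cancel hs').symm (hne1 _)
      rw [arcEdge_of_eq (hw.symm.trans hwi), arcEdge_of_eq_add hn2 (by rw [hkk, ← h0, hwi]), ← h0,
        ← hwi]
      exact ⟨Sym2.eq_swap, rfl⟩
  have e2 : arcEdge r (i + 1) = s(w, w + 1) ∧
      arcEdge r' (i + 1) = s(w - ((i + 1 : ℕ) : ZMod n), w + 1) := by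
    rcases (by omega : i + 1 + 2 < n ∨ i + 1 + 2 = n) with hi | hi
    · have h0 := h (i + 1 + 1) (by omega) (by omega) (by omega)
      have hs := hr (i + 1)
      have hs' := hr' (i + 1)
      rw [hkk, ← h0] at hs'
      rw [← hw] at hs
      have hwi : r (i + 1 + 1) = w + 1 := by
        rcases hs with hs | hs
        · rw [hs] at hs'
          rcases hs' with hs' | hs'
          · exact absurd hs' (hne1 _)
          · exact absurd hs' (hne2 _)
        · exact hs
      rw [arcEdge_of_eq_add hn2 (by rw [hwi, hw]), arcEdge_of_eq (by rw [← h0, hwi, hkk]), hkk, ← hw]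
      refine ⟨rfl, ?_⟩
      rw [Sym2.eq_swap]; exact sym2_mk_congr (by push_cast; ring) rfl
    · rw [arcEdge_last hn2 hr hi, arcEdge_last hn2 hr' hi, hkk, ← hw]
      refine ⟨rfl, ?_⟩
      rw [Sym2.eq_swap]
      refine sym2_mk_congr ?_ rfl
      rw [natCast_eq_neg_of_add_eq hi]; push_cast; ring
  obtain ⟨b, p, hp, -, hpe⟩ := exists_isSpine hn hr h01
  refine ⟨_, _, p, hp, w - ((i + 1 : ℕ) : ZMod n), w, w + 1, ?_, ?_, ?_⟩
  · exact (arcTree_adj hn2 hr).2 ⟨i, by omega, e1.1.symm⟩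
  · exact hpe _ ((mem_edgeSet_arcTree hn2 hr).2 ⟨i + 1, by omega, e2.1.symm⟩) ⟨w, rfl⟩
  · ext e
    rw [Set.mem_union, Set.mem_sdiff, Set.mem_singleton_iff, Set.mem_singleton_iff]
    change e ∈ (arcTree r').edgeSet ↔ (e ∈ (arcTree r).edgeSet ∧ _) ∨ _
    rw [mem_edgeSet_arcTree hn2 hr, mem_edgeSet_arcTree hn2 hr', ← e1.1, ← e2.2]
    constructor
    · rintro ⟨j, hj, rfl⟩
      by_cases hji : j = i
      · subst hji
        refine .inl ⟨⟨j + 1, by omega, e1.2.trans e2.1.symm⟩, fun he => ?_⟩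
        rw [e1.2, ← e2.1] at he
        have := arcEdge_inj hn2 hr (by omega) (by omega) he
        omega
      · by_cases hji' : j = i + 1
        · exact .inr (by rw [hji'])
        · rw [← hother j hj hji' (by omega)]
          exact .inl ⟨⟨j, hj, rfl⟩, fun he => hji (arcEdge_inj hn2 hr hj (by omega) he)⟩
    · rintro (⟨⟨j, hj, rfl⟩, he⟩ | rfl)
      · by_cases hji : j = i
        · exact absurd (by rw [hji]) he
        · by_cases hji' : j = i + 1
          · exact ⟨i, by omega, by rw [hji', e2.1, e1.2]⟩
          · exact ⟨j, hj, hother j hj hji' (by omega)⟩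
      · exact ⟨i + 1, by omega, rfl⟩

/-- The ends of the arcs of the caterpillar that belongs to a vertex of the Yoke graph. -/
def spineSeq (v : YokeVertex n (n - 3)) : ℕ → ZMod n
  | 0 => v.psum 0
  | j + 1 => v.psum (min j (n - 3)) + 1

lemma spineSeq_succ (v : YokeVertex n (n - 3)) {j : ℕ} (hj : j ≤ n - 3) :
    spineSeq v (j + 1) = v.psum j + 1 := by
  rw [spineSeq, min_eq_left hj]

lemma spineSeq_one (v : YokeVertex n (n - 3)) : spineSeq v 1 = spineSeq v 0 + 1 := by
  rw [spineSeq_succ v (Nat.zero_le _), spineSeq]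

lemma isStepSeq_spineSeq (v : YokeVertex n (n - 3)) : IsStepSeq (spineSeq v) := by
  intro j
  rcases j with _ | j
  · exact .inr (spineSeq_one v)
  · rcases isStepSeq_psum v j with h | h
    · left; rw [spineSeq, spineSeq]; simp only at h; rw [h]
    · right; rw [spineSeq, spineSeq]; simp only at h; rw [h]

/-- `C` is the tree of the arcs that belong to `v`. -/
def CaterpillarRel (C : Caterpillar n) (v : YokeVertex n (n - 3)) : Prop :=
  arcTree (spineSeq v) = C.1

lemma exists_caterpillarRel_left (hn : 3 ≤ n) (v : YokeVertex n (n - 3)) :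
    ∃ C, CaterpillarRel C v :=
  ⟨arcCaterpillar hn _ (isStepSeq_spineSeq v) (spineSeq_one v), rfl⟩

lemma exists_caterpillarRel_right (hn : 3 ≤ n) (C : Caterpillar n) : ∃ v, CaterpillarRel C v := by
  obtain ⟨r, hr, h01, hC⟩ := C.exists_arcTree_eq hn
  obtain ⟨v, hv⟩ := exists_psum_eq (m := n - 3) (show 2 ≤ n by omega) (fun i => r (i + 1) - 1) (by
    intro i _
    rcases hr (i + 1) with h | h
    · left; rw [h]
    · right; rw [h]; ring)
  refine ⟨v, (arcTree_congr (by omega) (isStepSeq_spineSeq v) hr fun j hj => ?_).trans hC⟩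
  rcases j with _ | j
  · rw [spineSeq, hv 0 (by omega), zero_add, h01]; ring
  · rw [spineSeq_succ v (by omega), hv j (by omega)]; ring

lemma CaterpillarRel.ncard (hn : 3 ≤ n) {C : Caterpillar n} {v : YokeVertex n (n - 3)}
    (h : CaterpillarRel C v) (x : ZMod n) :
    (C.1.neighborSet x).ncard = spineCount (spineSeq v) x + 1 := by
  rw [← h, ncard_neighborSet_arcTree (by omega) (isStepSeq_spineSeq v)]

/-- The degrees of `C` give the multiset of values of the sequence, hence the sequence. -/
lemma caterpillarRel_unique_right (hn : 3 ≤ n) {C : Caterpillar n} {u v : YokeVertex n (n - 3)}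
    (hu : CaterpillarRel C u) (hv : CaterpillarRel C v) : u = v := by
  refine yokeVertex_ext_psum (by omega) fun i hi => ?_
  have := eq_of_spineCount_eq (by omega) (isStepSeq_spineSeq u) (isStepSeq_spineSeq v) (fun x => by
    have h1 := hu.ncard hn x
    have h2 := hv.ncard hn x
    omega) (i + 1) (by omega) (by omega)
  rw [spineSeq_succ u hi, spineSeq_succ v hi] at this
  exact add_right_cancel this

lemma yokeTight_caterpillar (hn : 3 ≤ n) : YokeTight n (n - 3) := ⟨by omega, by omega⟩

lemma yokeShift_of_spineSeq (hn : 3 ≤ n) {u v : YokeVertex n (n - 3)}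
    (h : ∃ i, 1 ≤ i ∧ i ≤ n - 2 ∧ spineSeq u i ≠ spineSeq v i ∧
      ∀ j, 1 ≤ j → j ≤ n - 2 → j ≠ i → spineSeq u j = spineSeq v j) : ∃ i, YokeShift i u v := by
  obtain ⟨i, hi1, hi2, hne, h⟩ := h
  obtain ⟨i, rfl⟩ : ∃ k, i = k + 1 := ⟨i - 1, by omega⟩
  refine ⟨⟨i, by omega⟩, (yokeShift_iff (yokeTight_caterpillar hn) _).2 ⟨fun j hj hji => ?_, ?_⟩⟩
  · have := h (j + 1) (by omega) (by omega) (by simpa using hji)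
    rw [spineSeq_succ u hj, spineSeq_succ v hj] at this
    exact add_right_cancel this
  · intro he
    rw [spineSeq_succ u (by omega), spineSeq_succ v (by omega)] at hne
    exact hne (by rw [he])

/-- A shift moves one unit of degree from `w` to an adjacent vertex, so the sequence changes at one
index. If the target is `w - 1`, the roles of `C` and `D` are exchanged. -/
lemma CaterpillarShift.exists_yokeShift (hn : 3 ≤ n) {C D : Caterpillar n}
    {u v : YokeVertex n (n - 3)} (hC : CaterpillarRel C u) (hD : CaterpillarRel D v)
    (h : CaterpillarShift C D) : ∃ i, YokeShift i u v := by
  obtain ⟨w, w', hs, hdeg⟩ := h.exists_ncard (by omega)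
  rcases isSide_iff.1 hs with rfl | rfl
  · refine yokeShift_of_spineSeq hn (exists_index_of_spineCount_shift (by omega)
      (isStepSeq_spineSeq u) (isStepSeq_spineSeq v) (w := w) fun x => ?_)
    have h1 := hdeg x
    rw [hC.ncard hn, hD.ncard hn] at h1
    omega
  · obtain ⟨i, hi⟩ := yokeShift_of_spineSeq hn (exists_index_of_spineCount_shift (by omega)
      (isStepSeq_spineSeq v) (isStepSeq_spineSeq u) (w := w') fun x => by
        have h1 := hdeg x
        rw [hC.ncard hn, hD.ncard hn] at h1
        omega)
    exact ⟨i, yokeShift_symm (yokeTight_caterpillar hn) hi⟩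

lemma caterpillarShift_of_psum (hn : 3 ≤ n) {C D : Caterpillar n}
    {u v : YokeVertex n (n - 3)} (hC : CaterpillarRel C u) (hD : CaterpillarRel D v) {i : ℕ}
    (hi : i ≤ n - 3) (h : ∀ j ≤ n - 3, j ≠ i → u.psum j = v.psum j)
    (hs : v.psum i = u.psum i + 1) : CaterpillarShift C D := by
  refine caterpillarShift_of_eq_add_one hn (isStepSeq_spineSeq u) (isStepSeq_spineSeq v)
    (spineSeq_one u) (spineSeq_one v) hC hD (k := i + 1) (by omega) (by omega) ?_ ?_
  · rw [spineSeq_succ u hi, spineSeq_succ v hi, hs]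
  · intro j hj1 hj hji
    obtain ⟨j, rfl⟩ : ∃ k, j = k + 1 := ⟨j - 1, by omega⟩
    rw [spineSeq_succ u (by omega), spineSeq_succ v (by omega), h j (by omega) (by omega)]

lemma caterpillarCode_of_caterpillarRel (hn : 3 ≤ n) {C : Caterpillar n}
    {v : YokeVertex n (n - 3)} (h : CaterpillarRel C v) : CaterpillarCode C v := by
  obtain ⟨C, hC'⟩ := C
  change arcTree (spineSeq v) = C at h
  subst h
  have hr := isStepSeq_spineSeq v
  obtain ⟨b, p, hp, hv, -⟩ := exists_isSpine hn hr (spineSeq_one v)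
  -- The interval `[l i, r i]` is the arc of index `i + 1` of `spineSeq v`, with lower end `v.psum i
  -- - i` and upper end `v.psum i + 1`.
  refine ⟨_, b, p, hp, hv, (psum_zero v).symm, fun i => v.psum i - i, fun i => v.psum i + 1, ?_,
    rfl, ?_⟩
  · simp [spineSeq]
  · rintro ⟨i, hi⟩ h1 h2
    simp only at h1 h2 ⊢
    obtain ⟨i, rfl⟩ : ∃ k, i = k + 1 := ⟨i - 1, by omega⟩
    simp only [add_tsub_cancel_right]
    have hadj := arcTree_adj_iff hn hr (i := i + 1) (by omega)
    rw [spineSeq_succ v h2, spineSeq_succ v (show i ≤ n - 3 by omega), add_left_inj,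
      show v.psum i + 1 - ((i + 1 + 1 : ℕ) : ZMod n) = v.psum i - (i : ZMod n) - 1 by
        push_cast; ring] at hadj
    change (arcTree (spineSeq v)).Adj _ _ ∧ _ ∨ ¬ (arcTree (spineSeq v)).Adj _ _ ∧ _
    rw [hadj]
    rcases psum_step v i hi (by omega) with ⟨e, hs⟩ | ⟨e, hs⟩
    · exact .inl ⟨hs, by rw [hs]; push_cast; ring, by rw [hs], e⟩
    · refine .inr ⟨?_, by rw [hs]; push_cast; ring, by rw [hs], e⟩
      rw [hs]
      intro h0
      exact zmod_one_ne_zero (n := n) (by omega) (by linear_combination h0)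

theorem exists_caterpillarGraph_iso (hn : 3 ≤ n) :
    ∃ h : caterpillarGraph n ≃g yokeGraph n (n - 3), ∀ C : Caterpillar n, CaterpillarCode C (h C) := by
  obtain ⟨f, hf⟩ := exists_equiv_of_rel (CaterpillarRel (n := n)) (exists_caterpillarRel_right hn)
    (exists_caterpillarRel_left hn) (fun _ _ _ h h' => Subtype.ext (h.symm.trans h'))
    (fun _ _ _ => caterpillarRel_unique_right hn)
  refine ⟨⟨f, ?_⟩, fun C => caterpillarCode_of_caterpillarRel hn (hf C)⟩
  intro C D
  have ht := yokeTight_caterpillar hn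
  rw [yokeGraph_adj_iff ht, caterpillarGraph, SimpleGraph.fromRel_adj]
  constructor
  · rintro ⟨i, h⟩
    rw [yokeShift_iff ht] at h
    refine ⟨?_, ?_⟩
    · rintro rfl; exact h.2 rfl
    · rcases psum_sub_eq_one ht (i := i) (by omega) h.1 h.2 with hs | hs
      · exact .inr (caterpillarShift_of_psum hn (hf D) (hf C) (i := i) (by omega)
          (fun j hj hji => (h.1 j hj hji).symm) hs)
      · exact .inl (caterpillarShift_of_psum hn (hf C) (hf D) (i := i) (by omega) h.1 hs)
  · rintro ⟨-, h | h⟩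
    · exact h.exists_yokeShift hn (hf C) (hf D)
    · obtain ⟨i, hi⟩ := h.exists_yokeShift hn (hf D) (hf C)
      exact ⟨i, yokeShift_symm ht hi⟩

end Shifts

end YokeFlip

theorem mainTheorem9 :
    (∀ n : ℕ, 5 ≤ n → ∃ g : ctftGraph n ≃g yokeGraph n (n - 4),
      (∀ T : CTFT n, CTFTCode T (g T)) ∧
      ∀ (T T' : CTFT n) (i : Fin (n - 3)) (j : Fin (n - 4 + 1)), i.val = j.val →
        (CTFTFlip i T T' ↔ YokeShift j (g T) (g T'))) ∧
    (∀ n : ℕ, 2 ≤ n → ∃ f : arcGraph n ≃g yokeGraph n (n - 2),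
      (∀ π : ArcPerm n, ArcCode π (f π)) ∧
      ∀ (π σ : ArcPerm n) (i : ℕ) (hi : i + 1 < n) (j : Fin (n - 2 + 1)), i = j.val →
        (ArcSwap i hi π σ ↔ YokeShift j (f π) (f σ))) ∧
    (∀ n : ℕ, 3 ≤ n → ∃ h : caterpillarGraph n ≃g yokeGraph n (n - 3),
      ∀ C : Caterpillar n, CaterpillarCode C (h C)) := by
  exact ⟨fun _ hn => exists_ctftGraph_iso hn, fun _ hn => exists_arcGraph_iso hn,
    fun _ hn => exists_caterpillarGraph_iso hn⟩
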